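/- Let $P=\{x\in\mathbb{R}^2 : l_i(x)=\langle x,n_i\rangle-c_i\ge 0,\ i=1,\dots,d\}$ (with $n_i\in\mathbb{Z}^2$, $c_i\in\mathbb{R}$) be a Delzant polygon: $P$ is compact with non-empty interior, each $\{x\in P: l_i(x)=0\}$ is an edge of $P$, and exactly two edges meet at each vertex, their normals $n_i,n_j$ forming a basis of $\mathbb{Z}^2$. Let $d\sigma$ be the measure on $\partial P$ which on the $i$-th edge is arc length divided by $|n_i|$. A symplectic potential is a function on $P$ of the form $$u=f+\sum_{i=1}^d \tfrac12\, l_i\ln l_i ,\qquad f\in C^\infty(P),$$ (where $0\ln 0=0$) which is strictly convex in the sense that its second derivative is positive in every non-zero direction tangent to the face of $P$ containing the given point in its relative interior (so the Hessian is positive definite in the interior of $P$ and the second derivative along each edge is positive in the relative interior of that edge). It defines the torus-invariant Kähler metric which, on the open dense orbit $\operatorname{int}(P)\times (\mathbb{R}/2\pi\mathbb{Z})^2$ of the toric surface $X$ of $P$, is $$g_u=\sum u_{ij}\,dx_i\,dx_j+\sum u^{ij}\,d\theta_i\,d\theta_j,\qquad (u^{ij})=(u_{ij})^{-1}=(D^2u)^{-1}.$$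 The potential $u$ is normalized at an interior point $x_0$ of $P$ if $u(x_0)=0$ and $Du(x_0)=0$. It satisfies the $M$-condition on $P$ if, for every non-degenerate segment $\overline{x_1x_4}\subset P$ with unit direction $\vec v$ and points $x_2,x_3$ dividing it into three equal parts, $$\left|Du\cdot\vec v(x_2)-Du\cdot\vec v(x_3)\right|<M .$$ **Theorem.** Let $P$ be a Delzant polygon and let $C_1,C_2\in\mathbb{R}$. There is a constant $M>0$, depending only on $C_1$, $C_2$ and $P$, such that every symplectic potential $u$ on $P$ which is normalized (at some interior point $x_0$ of $P$), whose metric $g_u$ has Riemannian curvature $|Rm|\le C_1$ on $X$, and which satisfies $$\int_{\partial P}u\,d\sigma<C_2,$$ satisfies the $M$-condition on $P$. -/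

import Mathlib

open scoped ContDiff

noncomputable section

namespace ToricSurface

/-! ### Riemannian curvature of a metric written in global coordinates -/

section Curvature

variable {ι : Type} [Fintype ι] [DecidableEq ι]

/-- The partial derivative `∂F/∂yᵢ` at `y`. -/
def pd (i : ι) (F : (ι → ℝ) → ℝ) (y : ι → ℝ) : ℝ :=
  fderiv ℝ F y (Pi.single i 1)

/-- Christoffel symbols `Γᵏᵢⱼ = ½ gᵏᵐ (∂ᵢ gⱼₘ + ∂ⱼ gᵢₘ - ∂ₘ gᵢⱼ)` of the Levi-Civita connection of
the metric with components `g`. -/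
def christoffel (g : (ι → ℝ) → Matrix ι ι ℝ) (k i j : ι) (y : ι → ℝ) : ℝ :=
  (1 / 2) * ∑ m, (g y)⁻¹ k m *
    (pd i (fun z => g z j m) y + pd j (fun z => g z i m) y - pd m (fun z => g z i j) y)

/-- The components `Rˡₖᵢⱼ` of the curvature `R(∂ᵢ, ∂ⱼ) ∂ₖ = Rˡₖᵢⱼ ∂ₗ`. -/
def riemannUp (g : (ι → ℝ) → Matrix ι ι ℝ) (l k i j : ι) (y : ι → ℝ) : ℝ :=
  pd i (christoffel g l j k) y - pd j (christoffel g l i k) y +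
    ∑ m, (christoffel g l i m y * christoffel g m j k y
      - christoffel g l j m y * christoffel g m i k y)

/-- The components `Rₗₖᵢⱼ` of the curvature tensor with all indices lowered. -/
def riemann (g : (ι → ℝ) → Matrix ι ι ℝ) (l k i j : ι) (y : ι → ℝ) : ℝ :=
  ∑ m, g y l m * riemannUp g m k i j y

/-- The pointwise norm `|Rm|` of the curvature tensor with respect to the metric. -/
def rmNorm (g : (ι → ℝ) → Matrix ι ι ℝ) (y : ι → ℝ) : ℝ :=
  Real.sqrt (∑ a, ∑ b, ∑ c, ∑ d, ∑ a', ∑ b', ∑ c', ∑ d',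
    (g y)⁻¹ a a' * (g y)⁻¹ b b' * (g y)⁻¹ c c' * (g y)⁻¹ d d' *
      riemann g a b c d y * riemann g a' b' c' d' y)

end Curvature

/-- The Euclidean plane containing the moment polygon. -/
abbrev Plane : Type := EuclideanSpace ℝ (Fin 2)

/-! ### Delzant polygons -/

/-- Integral vectors `nᵢ` and real numbers `cᵢ` describing a polygon by the inequalities
`⟨x, nᵢ⟩ - cᵢ ≥ 0`. -/
structure PolygonData where
  /-- The number of inequalities. -/
  d : ℕ
  /-- The inward normal vectors. -/
  normal : Fin d → Fin 2 → ℤ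
  /-- The constants `cᵢ`. -/
  offset : Fin d → ℝ

namespace PolygonData

/-- The normal `nᵢ` as a vector of the Euclidean plane. -/
def nvec (P : PolygonData) (i : Fin P.d) : Plane :=
  WithLp.toLp 2 fun k => (P.normal i k : ℝ)

/-- The affine function `lᵢ(x) = ⟨x, nᵢ⟩ - cᵢ`. -/
def l (P : PolygonData) (i : Fin P.d) (x : Plane) : ℝ :=
  inner ℝ x (P.nvec i) - P.offset i

/-- The closed polygon `{x | lᵢ(x) ≥ 0 for all i}`. -/
def carrier (P : PolygonData) : Set Plane := {x | ∀ i, 0 ≤ P.l i x}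

/-- The `i`-th facet (edge). -/
def facet (P : PolygonData) (i : Fin P.d) : Set Plane := {x ∈ P.carrier | P.l i x = 0}

/-- `P` is a Delzant polygon: a compact polygon with non-empty interior, each inequality
defining an honest edge, such that exactly two edges meet at every vertex and the normals of
these two form a basis of `ℤ²` (that is, they have determinant `±1`). -/
structure IsDelzant (P : PolygonData) : Prop where
  bounded : Bornology.IsBounded P.carrier
  interior_nonempty : (interior P.carrier).Nonempty
  facet_nontrivial : ∀ i, (P.facet i).Nontrivial
  vertex : ∀ v ∈ P.carrier.extremePoints ℝ, ∃ i j : Fin P.d, i ≠ j ∧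
    (∀ k, P.l k v = 0 ↔ k = i ∨ k = j) ∧
    IsUnit (Matrix.det !![P.normal i 0, P.normal i 1; P.normal j 0, P.normal j 1])

/-- The boundary measure `dσ`: on the `i`-th edge it is arc length divided by `|nᵢ|`. -/
def boundaryMeasure (P : PolygonData) : MeasureTheory.Measure Plane :=
  ∑ i, ENNReal.ofReal (1 / ‖P.nvec i‖) •
    (MeasureTheory.Measure.hausdorffMeasure 1).restrict (P.facet i)

/-- Symplectic potentials of the torus-invariant Kähler metrics (Guillemin boundary conditions).
On the closed polygon, `u = f + ∑ ½ lᵢ log lᵢ` where `f` is smooth up to the boundary, i.e. the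
restriction of a smooth function on the plane (`0 log 0 = 0`). Strict convexity is the
non-degeneracy of the metric: the second derivative of `u` at `x` is positive in all
non-zero directions tangent to the face having `x` in its relative interior. So the Hessian is
positive definite at interior points, and the second derivative along an edge is positive at
the relative interior points of that edge; at a vertex nothing is required. -/
structure IsSymplecticPotential (P : PolygonData) (u : Plane → ℝ) : Prop where
  guillemin : ∃ f : Plane → ℝ, ContDiff ℝ ∞ f ∧
    ∀ x ∈ P.carrier, u x = f x + ∑ i, (1 / 2) * (P.l i x * Real.log (P.l i x))
  strictly_convex : ∀ x ∈ P.carrier, ∀ v : Plane, v ≠ 0 →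
    (∀ i, P.l i x = 0 → inner ℝ v (P.nvec i) = 0) →
    0 < iteratedDeriv 2 (fun t : ℝ => u (x + t • v)) 0

/-- Donaldson's `M`-condition: for every segment in the (closed) polygon, with unit direction
`v`, the derivatives of `u` in direction `v` at the two interior trisection points differ by
less than `M`. (On a segment contained in an edge only this tangential derivative exists, whence
the use of `lineDeriv`.) -/
def MCondition (P : PolygonData) (M : ℝ) (u : Plane → ℝ) : Prop :=
  ∀ p q : Plane, p ≠ q → segment ℝ p q ⊆ P.carrier →
    |lineDeriv ℝ u (p + (1 / 3 : ℝ) • (q - p)) (‖q - p‖⁻¹ • (q - p))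
      - lineDeriv ℝ u (p + (2 / 3 : ℝ) • (q - p)) (‖q - p‖⁻¹ • (q - p))| < M

end PolygonData

/-! ### The toric metric of a symplectic potential -/

/-- The Hessian matrix `(uᵢⱼ)` of `u`. -/
def hess (u : Plane → ℝ) (x : Plane) : Matrix (Fin 2) (Fin 2) ℝ :=
  Matrix.of fun i j =>
    fderiv ℝ (fun z => fderiv ℝ u z (EuclideanSpace.single j 1)) x (EuclideanSpace.single i 1)

/-- The polygon coordinates `x` of a point with coordinates `(x₁, x₂, θ₁, θ₂)`. -/
def base (y : Fin 2 ⊕ Fin 2 → ℝ) : Plane := WithLp.toLp 2 fun i => y (Sum.inl i)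

/-- The toric Kähler metric `∑ uᵢⱼ dxᵢ dxⱼ + ∑ uⁱʲ dθᵢ dθⱼ` in the action-angle coordinates
`(x, θ)` of the open dense torus orbit of the toric surface; here `(uⁱʲ)` is the inverse of the
Hessian `(uᵢⱼ)`. -/
def toricMetric (u : Plane → ℝ) (y : Fin 2 ⊕ Fin 2 → ℝ) :
    Matrix (Fin 2 ⊕ Fin 2) (Fin 2 ⊕ Fin 2) ℝ :=
  Matrix.fromBlocks (hess u (base y)) 0 0 (hess u (base y))⁻¹

/-- The Riemannian curvature of the toric metric of `u` satisfies `|Rm| ≤ C`. The metric extends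
smoothly to the compact surface, so it is enough to ask this on the open dense orbit, which lies
over the interior of the polygon. -/
def CurvatureBoundedBy (P : PolygonData) (u : Plane → ℝ) (C : ℝ) : Prop :=
  ∀ y : Fin 2 ⊕ Fin 2 → ℝ, base y ∈ interior P.carrier → rmNorm (toricMetric u) y ≤ C

/-- `u` is normalized at `x₀`: `u(x₀) = 0` and `Du(x₀) = 0`. -/
def IsNormalizedAt (u : Plane → ℝ) (x₀ : Plane) : Prop :=
  u x₀ = 0 ∧ HasFDerivAt u (0 : Plane →L[ℝ] ℝ) x₀

end ToricSurface

end

/-! ### Cauchy–Schwarz for the curvature tensor. -/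

namespace ToricSurface

/-! The theorem follows from a uniform upper bound of Guillemin type on the Hessian, D²u(v,v) ≤ K
(|v|² + ∑ ⟨v,n_k⟩² / l_k) on the interior of the polygon (`exists_hess_bound`). On the middle third
of a segment with difference vector e one has |⟨e,n_k⟩| ≤ 3 l_k, because l_k is affine and
non-negative at both ends. Hence the singular terms contribute at most a multiple of |e|, and the
derivative of u along e varies by at most a constant times |e| (`abs_dirD_sub_le`). Segments
touching the boundary are limits of interior ones (`exists_mCondition`).

Curvature enters through one identity: the second derivatives of the inverse Hessian are
combinations of curvature components (`pdv_pdv_invHess`). In a frame a, b this bounds suitable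
second derivatives of the entries of the inverse Hessian by 4C·u_aa u_bb / det = 4C / (1 - ρ²),
where ρ = u_ab / √(u_aa u_bb) is the correlation. Choosing b Hessian-orthogonal to a yields
(1/u_aa)'' ≤ 4C along a (`d2_inv_le`). Then a large u_aa persists on a length of order u_aa^(-1/2)
and makes the slope jump, which is impossible for a convex function with values in [0, B] on an
interval of fixed length (`second_deriv_le_of_room`).

Bounds on values come from the boundary integral. Normalization makes u non-negative. The
differential of u at an interior point q attains its maximum over the polygon at a vertex w, and
then u ≥ u(q) on a piece of an edge at w, so the integral controls u(q) (`value_le_of_max`). The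
piece has definite length as long as q stays away from the vertices. This gives the Hessian bound in
the interior, and the bound on second derivatives parallel to an edge away from its ends.

At the boundary, frame coordinates s = l_i, t = l_j at a vertex are used (`CornerChart`). The
inverse entry u^aa vanishes at s = 0 with slope 2, similarly u^bb at t = 0, and u^ab vanishes on
both axes. While ρ² ≤ 1/2 the curvature bound gives u^aa ≥ s, u^bb ≥ ct and |u^ab| ≤ 8Cst; the
constant c also uses the tangential bound just mentioned. Therefore ρ² = (u^ab)² / (u^aa u^bb) =
O(st), which on a thin rectangle is strictly better than what was assumed. A first-failure argument
starting at s = 0 shows that ρ² ≤ 1/2 holds on the whole rectangle (`correlation_lt`), whence u_aa ≤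
2/s and u_bb ≤ 2/(ct) (`CornerChart.d2_le`). The size of the rectangle does not depend on u, so
compactness of the polygon makes the bound global. -/

open Matrix Kronecker in
-- Cauchy–Schwarz for dual quadratic forms, read off from the discriminant of the `M`-form of r - τ
-- W v as a quadratic in τ. Giving the inverse explicitly as `W` avoids computing the inverse of a
-- Kronecker product.
theorem sq_dotProduct_le_of_posSemidef {n : Type*} [Fintype n] [DecidableEq n]
    {M W : Matrix n n ℝ} (hM : M.PosSemidef) (hMW : M * W = 1) (r v : n → ℝ) :
    (r ⬝ᵥ v) ^ 2 ≤ (r ⬝ᵥ M *ᵥ r) * (v ⬝ᵥ W *ᵥ v) := by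
  have hMt : Mᵀ = M := by simpa [Matrix.IsHermitian] using hM.1
  have h1 : M *ᵥ (W *ᵥ v) = v := by rw [mulVec_mulVec, hMW, one_mulVec]
  have h2 : (W *ᵥ v) ⬝ᵥ (M *ᵥ r) = r ⬝ᵥ v := by
    rw [dotProduct_mulVec, ← mulVec_transpose, hMt, h1, dotProduct_comm]
  have key : ∀ τ : ℝ, 0 ≤ (v ⬝ᵥ W *ᵥ v) * (τ * τ) + (-2 * (r ⬝ᵥ v)) * τ + r ⬝ᵥ M *ᵥ r := by
    intro τ
    have h := hM.dotProduct_mulVec_nonneg (r - τ • W *ᵥ v)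
    simp only [star_trivial, mulVec_sub, mulVec_smul, h1, sub_dotProduct, dotProduct_sub,
      smul_dotProduct, dotProduct_smul, h2, smul_eq_mul] at h
    rw [dotProduct_comm (W *ᵥ v) v] at h
    linarith
  have := discrim_le_zero key
  rw [discrim] at this
  nlinarith

open Matrix in
-- Iterated three times, this evaluates the norm of a decomposable 4-tensor as a product of four
-- norms.
theorem kronecker_quadratic {m n : Type*} [Fintype m] [Fintype n] (A : Matrix m m ℝ)
    (B : Matrix n n ℝ) (v : m → ℝ) (w : n → ℝ) :
    (fun x : m × n => v x.1 * w x.2) ⬝ᵥ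
      kroneckerMap (· * ·) A B *ᵥ (fun x : m × n => v x.1 * w x.2) =
      (v ⬝ᵥ A *ᵥ v) * (w ⬝ᵥ B *ᵥ w) := by
  simp only [dotProduct, mulVec, Fintype.sum_prod_type, kroneckerMap_apply]
  rw [Finset.sum_mul_sum]
  refine Finset.sum_congr rfl fun a _ => Finset.sum_congr rfl fun b _ => ?_
  rw [mul_mul_mul_comm, Finset.sum_mul_sum]
  congr 1
  refine Finset.sum_congr rfl fun a' _ => Finset.sum_congr rfl fun b' _ => ?_
  ring

section CauchySchwarz

variable {ι : Type} [Fintype ι] [DecidableEq ι]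

open Matrix in
-- The square of `rmNorm` is the quadratic form of the fourth Kronecker power of g⁻¹, whose inverse
-- is the fourth power of g. Duality against v₁ ⊗ v₂ ⊗ v₃ ⊗ v₄ gives the bound.
theorem sq_contract_riemann_le {g : (ι → ℝ) → Matrix ι ι ℝ} {y : ι → ℝ} (hg : (g y).PosDef)
    (v₁ v₂ v₃ v₄ : ι → ℝ) :
    (∑ a, ∑ b, ∑ c, ∑ d, riemann g a b c d y * (v₁ a * (v₂ b * (v₃ c * v₄ d)))) ^ 2 ≤
      rmNorm g y ^ 2 * ((v₁ ⬝ᵥ g y *ᵥ v₁) * ((v₂ ⬝ᵥ g y *ᵥ v₂) *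
        ((v₃ ⬝ᵥ g y *ᵥ v₃) * (v₄ ⬝ᵥ g y *ᵥ v₄)))) := by
  set G := g y with hG
  have hGi : G⁻¹.PosDef := hg.inv
  have hdet : IsUnit G.det := hg.det_pos.ne'.isUnit
  have h1 : G⁻¹ * G = 1 := nonsing_inv_mul _ hdet
  have hps : (kroneckerMap (· * ·) G⁻¹ (kroneckerMap (· * ·) G⁻¹
      (kroneckerMap (· * ·) G⁻¹ G⁻¹))).PosSemidef :=
    hGi.posSemidef.kronecker (hGi.posSemidef.kronecker (hGi.posSemidef.kronecker hGi.posSemidef))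
  have hmul : kroneckerMap (· * ·) G⁻¹ (kroneckerMap (· * ·) G⁻¹
      (kroneckerMap (· * ·) G⁻¹ G⁻¹)) * kroneckerMap (· * ·) G (kroneckerMap (· * ·) G
      (kroneckerMap (· * ·) G G)) = 1 := by
    erw [← mul_kronecker_mul, ← mul_kronecker_mul, ← mul_kronecker_mul, h1]
    simp
  have := sq_dotProduct_le_of_posSemidef hps hmul
    (fun x => riemann g x.1 x.2.1 x.2.2.1 x.2.2.2 y)
    (fun x => v₁ x.1 * (v₂ x.2.1 * (v₃ x.2.2.1 * v₄ x.2.2.2)))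
  have e2 : ∀ A : Matrix (ι × ι × ι × ι) (ι × ι × ι × ι) ℝ, ∀ v : ι × ι × ι × ι → ℝ,
      v ⬝ᵥ A *ᵥ v = ∑ a, ∑ a', v a * A a a' * v a' := by
    intro A v
    simp [dotProduct, mulVec, Finset.mul_sum, mul_assoc]
  refine le_trans (le_of_eq ?_) (this.trans (le_of_eq ?_))
  · simp only [dotProduct, Fintype.sum_prod_type]
  · congr 1
    · rw [rmNorm, Real.sq_sqrt]
      · rw [e2]
        simp only [Fintype.sum_prod_type, kroneckerMap_apply, ← hG]
        refine Finset.sum_congr rfl fun a _ => Finset.sum_congr rfl fun b _ =>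
          Finset.sum_congr rfl fun c _ => Finset.sum_congr rfl fun d _ =>
          Finset.sum_congr rfl fun a' _ => Finset.sum_congr rfl fun b' _ =>
          Finset.sum_congr rfl fun c' _ => Finset.sum_congr rfl fun d' _ => ?_
        ring
      · have h := hps.dotProduct_mulVec_nonneg (fun x => riemann g x.1 x.2.1 x.2.2.1 x.2.2.2 y)
        rw [star_trivial, e2] at h
        simp only [Fintype.sum_prod_type, kroneckerMap_apply] at h
        refine h.trans (le_of_eq ?_)
        refine Finset.sum_congr rfl fun a _ => Finset.sum_congr rfl fun b _ =>
          Finset.sum_congr rfl fun c _ => Finset.sum_congr rfl fun d _ =>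
          Finset.sum_congr rfl fun a' _ => Finset.sum_congr rfl fun b' _ =>
          Finset.sum_congr rfl fun c' _ => Finset.sum_congr rfl fun d' _ => ?_
        ring
    · rw [← kronecker_quadratic, ← kronecker_quadratic, ← kronecker_quadratic]

end CauchySchwarz
end ToricSurface

/-! ### Calculus on the plane, Christoffel symbols and curvature components of the toric metric. -/

namespace ToricSurface

/-- The partial derivative `∂F/∂xᵢ` on the plane. -/
noncomputable def pdv (i : Fin 2) (F : Plane → ℝ) (x : Plane) : ℝ :=
  fderiv ℝ F x (EuclideanSpace.single i 1)

section Calculus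

variable {Ω : Set Plane} {F G : Plane → ℝ} {x : Plane}

theorem pdv_contDiffOn (hΩ : IsOpen Ω) (hF : ContDiffOn ℝ ∞ F Ω) (i : Fin 2) :
    ContDiffOn ℝ ∞ (pdv i F) Ω :=
  (hF.fderiv_of_isOpen hΩ (by simp)).clm_apply contDiffOn_const

theorem differentiableAt_of_smooth (hΩ : IsOpen Ω) (hF : ContDiffOn ℝ ∞ F Ω) (hx : x ∈ Ω) :
    DifferentiableAt ℝ F x :=
  (hF.contDiffAt (hΩ.mem_nhds hx)).differentiableAt (by simp)

theorem pdv_comm (hΩ : IsOpen Ω) (hF : ContDiffOn ℝ ∞ F Ω) (hx : x ∈ Ω) (i j : Fin 2) :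
    pdv i (pdv j F) x = pdv j (pdv i F) x := by
  have hc := hF.contDiffAt (hΩ.mem_nhds hx)
  have hd : DifferentiableAt ℝ (fderiv ℝ F) x :=
    (hc.fderiv_right (m := 1) (show ((2 : ℕ∞) : WithTop ℕ∞) ≤ ∞ from WithTop.coe_le_coe.2 le_top)).differentiableAt (by simp)
  have hs : IsSymmSndFDerivAt ℝ F x := hc.isSymmSndFDerivAt (by
    simpa using (show ((2 : ℕ∞) : WithTop ℕ∞) ≤ ∞ from WithTop.coe_le_coe.2 le_top))
  have e : ∀ i j, pdv i (pdv j F) x =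
      fderiv ℝ (fderiv ℝ F) x (EuclideanSpace.single i 1) (EuclideanSpace.single j 1) := by
    intro i j
    unfold pdv
    rw [fderiv_clm_apply hd (by fun_prop)]
    simp
  rw [e, e]
  exact hs _ _

theorem pdv_congr (hΩ : IsOpen Ω) (h : Set.EqOn F G Ω) (hx : x ∈ Ω) (i : Fin 2) :
    pdv i F x = pdv i G x := by
  unfold pdv
  rw [Filter.EventuallyEq.fderiv_eq (h.eventuallyEq_of_mem (hΩ.mem_nhds hx))]

theorem pdv_mul (hF : DifferentiableAt ℝ F x) (hG : DifferentiableAt ℝ G x) (i : Fin 2) :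
    pdv i (fun z => F z * G z) x = pdv i F x * G x + F x * pdv i G x := by
  unfold pdv
  rw [fderiv_fun_mul hF hG]
  simp
  ring

theorem pdv_const_mul (hF : DifferentiableAt ℝ F x) (c : ℝ) (i : Fin 2) :
    pdv i (fun z => c * F z) x = c * pdv i F x := by
  unfold pdv
  rw [fderiv_const_mul hF]
  simp

theorem pdv_const_mul_sum {ι : Type*} (t : Finset ι) {A B : ι → Plane → ℝ}
    (hA : ∀ m, DifferentiableAt ℝ (A m) x) (hB : ∀ m, DifferentiableAt ℝ (B m) x) (c : ℝ)
    (i : Fin 2) :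
    pdv i (fun z => c * ∑ m ∈ t, A m z * B m z) x =
      c * ∑ m ∈ t, (pdv i (A m) x * B m x + A m x * pdv i (B m) x) := by
  have h : ∀ m ∈ t, DifferentiableAt ℝ (fun z => A m z * B m z) x :=
    fun m _ => (hA m).fun_mul (hB m)
  rw [pdv_const_mul (DifferentiableAt.fun_sum h)]
  congr 1
  unfold pdv
  rw [fderiv_fun_sum h, sum_apply]
  exact Finset.sum_congr rfl fun m _ => pdv_mul (hA m) (hB m) i

theorem differentiableAt_const_mul_sum {ι : Type*} (t : Finset ι) {A B : ι → Plane → ℝ}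
    (hA : ∀ m, DifferentiableAt ℝ (A m) x) (hB : ∀ m, DifferentiableAt ℝ (B m) x) (c : ℝ) :
    DifferentiableAt ℝ (fun z => c * ∑ m ∈ t, A m z * B m z) x :=
  (DifferentiableAt.fun_sum fun m _ => (hA m).fun_mul (hB m)).const_mul c

@[simp] theorem pdv_const (c : ℝ) (i : Fin 2) : pdv i (fun _ => c) x = 0 := by
  simp [pdv]

/-- `base` as a continuous linear map. -/
noncomputable def baseL : (Fin 2 ⊕ Fin 2 → ℝ) →L[ℝ] Plane :=
  (PiLp.continuousLinearEquiv 2 ℝ (fun _ : Fin 2 => ℝ)).symm.toContinuousLinearMap.comp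
    (ContinuousLinearMap.pi fun i => ContinuousLinearMap.proj (Sum.inl i))

theorem pd_comp_base {y : Fin 2 ⊕ Fin 2 → ℝ} (hF : DifferentiableAt ℝ F (base y))
    (i : Fin 2 ⊕ Fin 2) :
    pd i (fun z => F (base z)) y = fderiv ℝ F (base y) (base (Pi.single i 1)) := by
  unfold pd
  have : HasFDerivAt (fun z => F (base z)) ((fderiv ℝ F (base y)).comp baseL) y :=
    HasFDerivAt.comp (g := F) y hF.hasFDerivAt baseL.hasFDerivAt
  rw [this.fderiv]
  rfl

theorem pd_inl_comp_base {y : Fin 2 ⊕ Fin 2 → ℝ} (hF : DifferentiableAt ℝ F (base y))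
    (i : Fin 2) : pd (Sum.inl i) (fun z => F (base z)) y = pdv i F (base y) := by
  rw [pd_comp_base hF]
  unfold pdv
  congr 1
  ext k
  simp [base, Pi.single_apply, Sum.inl_injective.eq_iff]

theorem pd_inr_comp_base {y : Fin 2 ⊕ Fin 2 → ℝ} (hF : DifferentiableAt ℝ F (base y))
    (i : Fin 2) : pd (Sum.inr i) (fun z => F (base z)) y = 0 := by
  rw [pd_comp_base hF]
  have : base (Pi.single (Sum.inr i) 1) = 0 := by
    ext k
    simp [base]
  rw [this, map_zero]

theorem pd_congr_on_base (hΩ : IsOpen Ω) {A B : (Fin 2 ⊕ Fin 2 → ℝ) → ℝ}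
    (h : ∀ z, base z ∈ Ω → A z = B z) {y : Fin 2 ⊕ Fin 2 → ℝ} (hy : base y ∈ Ω)
    (i : Fin 2 ⊕ Fin 2) : pd i A y = pd i B y := by
  unfold pd
  have : A =ᶠ[nhds y] B := by
    have : base ⁻¹' Ω ∈ nhds y := (hΩ.preimage baseL.continuous).mem_nhds hy
    filter_upwards [this] with z hz using h z hz
  rw [this.fderiv_eq]

theorem base_elim (x : Plane) : base (Sum.elim (fun i => x i) 0) = x := by
  ext i
  simp [base]

end Calculus

section Metric

/-- Components of the Hessian as functions. -/
noncomputable def hessFun (u : Plane → ℝ) (i j : Fin 2) (x : Plane) : ℝ := hess u x i j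

/-- Components of the inverse Hessian as functions. -/
noncomputable def invHessFun (u : Plane → ℝ) (i j : Fin 2) (x : Plane) : ℝ := (hess u x)⁻¹ i j

/-- `u` is smooth with positive definite Hessian on the open set `Ω`. -/
structure StrictConvexSmoothOn (u : Plane → ℝ) (Ω : Set Plane) : Prop where
  isOpen : IsOpen Ω
  smooth : ContDiffOn ℝ ∞ u Ω
  posDef : ∀ x ∈ Ω, (hess u x).PosDef

namespace StrictConvexSmoothOn

variable {u : Plane → ℝ} {Ω : Set Plane} {x : Plane} (H : StrictConvexSmoothOn u Ω)

include H

theorem hessFun_smooth (i j : Fin 2) : ContDiffOn ℝ ∞ (hessFun u i j) Ω :=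
  pdv_contDiffOn H.isOpen (pdv_contDiffOn H.isOpen H.smooth j) i

theorem hessFun_symm (hx : x ∈ Ω) (i j : Fin 2) : hessFun u i j x = hessFun u j i x :=
  pdv_comm H.isOpen H.smooth hx i j

theorem det_pos (hx : x ∈ Ω) :
    0 < hessFun u 0 0 x * hessFun u 1 1 x - hessFun u 0 1 x ^ 2 := by
  have := (H.posDef x hx).det_pos
  rw [Matrix.det_fin_two] at this
  have h2 := H.hessFun_symm hx 0 1
  unfold hessFun at *
  rw [← h2] at this
  nlinarith

theorem invHess_eq (hx : x ∈ Ω) :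
    (hess u x)⁻¹ = (hessFun u 0 0 x * hessFun u 1 1 x - hessFun u 0 1 x ^ 2)⁻¹ •
      !![hessFun u 1 1 x, -hessFun u 0 1 x; -hessFun u 0 1 x, hessFun u 0 0 x] := by
  have h2 := H.hessFun_symm hx 1 0
  rw [Matrix.inv_def, Matrix.det_fin_two, Matrix.adjugate_fin_two, Ring.inverse_eq_inv']
  unfold hessFun at *
  rw [h2, sq]

theorem invHessFun_smooth (i j : Fin 2) : ContDiffOn ℝ ∞ (invHessFun u i j) Ω := by
  have hd : ContDiffOn ℝ ∞
      (fun x => (hessFun u 0 0 x * hessFun u 1 1 x - hessFun u 0 1 x ^ 2)⁻¹) Ω :=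
    (((H.hessFun_smooth 0 0).mul (H.hessFun_smooth 1 1)).sub
      ((H.hessFun_smooth 0 1).pow 2)).inv fun x hx => (H.det_pos hx).ne'
  have hm : ContDiffOn ℝ ∞ (fun x => (!![hessFun u 1 1 x, -hessFun u 0 1 x;
      -hessFun u 0 1 x, hessFun u 0 0 x] : Matrix (Fin 2) (Fin 2) ℝ) i j) Ω := by
    fin_cases i <;> fin_cases j
    · exact H.hessFun_smooth 1 1
    · exact (H.hessFun_smooth 0 1).neg
    · exact (H.hessFun_smooth 0 1).neg
    · exact H.hessFun_smooth 0 0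
  refine (hd.mul hm).congr fun x hx => ?_
  rw [invHessFun, H.invHess_eq hx]
  rfl

theorem invHess_inv (hx : x ∈ Ω) : ((hess u x)⁻¹)⁻¹ = hess u x :=
  Matrix.nonsing_inv_nonsing_inv _ (H.posDef x hx).det_pos.ne'.isUnit

theorem toricMetric_inv {y : Fin 2 ⊕ Fin 2 → ℝ} (hy : base y ∈ Ω) :
    (toricMetric u y)⁻¹ = Matrix.fromBlocks (hess u (base y))⁻¹ 0 0 (hess u (base y)) := by
  have hU : IsUnit (hess u (base y)) :=
    (Matrix.isUnit_iff_isUnit_det _).2 (H.posDef _ hy).det_pos.ne'.isUnit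
  rw [toricMetric, Matrix.inv_fromBlocks_zero₂₁_of_isUnit_iff, H.invHess_inv hy]
  · simp
  · exact ⟨fun _ => (Matrix.isUnit_iff_isUnit_det _).2
      (H.posDef _ hy).inv.det_pos.ne'.isUnit, fun _ => hU⟩

open Matrix in
theorem toricMetric_posDef {y : Fin 2 ⊕ Fin 2 → ℝ} (hy : base y ∈ Ω) :
    (toricMetric u y).PosDef := by
  have hU := H.posDef _ hy
  refine Matrix.PosDef.of_dotProduct_mulVec_pos
    (Matrix.IsHermitian.fromBlocks hU.1 (by simp) hU.inv.1) fun x hx => ?_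
  have e : star x ⬝ᵥ (toricMetric u y).mulVec x =
      star (x ∘ Sum.inl) ⬝ᵥ (hess u (base y)).mulVec (x ∘ Sum.inl) +
      star (x ∘ Sum.inr) ⬝ᵥ ((hess u (base y))⁻¹).mulVec (x ∘ Sum.inr) := by
    rw [toricMetric, Matrix.fromBlocks_mulVec]
    simp [dotProduct, Fintype.sum_sum_type]
  rw [e]
  by_cases h1 : x ∘ Sum.inl = 0
  · have h2 : x ∘ Sum.inr ≠ 0 := by
      rintro h2
      apply hx
      ext (i | i)
      · exact congrFun h1 i
      · exact congrFun h2 i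
    exact add_pos_of_nonneg_of_pos (hU.posSemidef.dotProduct_mulVec_nonneg _)
      (hU.inv.dotProduct_mulVec_pos h2)
  · exact add_pos_of_pos_of_nonneg (hU.dotProduct_mulVec_pos h1)
      (hU.inv.posSemidef.dotProduct_mulVec_nonneg _)

theorem pd_toric_ll {y : Fin 2 ⊕ Fin 2 → ℝ} (hy : base y ∈ Ω) (m : Fin 2 ⊕ Fin 2) (i j : Fin 2) :
    pd m (fun z => toricMetric u z (Sum.inl i) (Sum.inl j)) y =
      Sum.elim (fun k => pdv k (hessFun u i j) (base y)) 0 m := by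
  have hd := differentiableAt_of_smooth H.isOpen (H.hessFun_smooth i j) hy
  cases m with
  | inl k => exact pd_inl_comp_base hd k
  | inr k => exact pd_inr_comp_base hd k

theorem pd_toric_rr {y : Fin 2 ⊕ Fin 2 → ℝ} (hy : base y ∈ Ω) (m : Fin 2 ⊕ Fin 2) (i j : Fin 2) :
    pd m (fun z => toricMetric u z (Sum.inr i) (Sum.inr j)) y =
      Sum.elim (fun k => pdv k (invHessFun u i j) (base y)) 0 m := by
  have hd := differentiableAt_of_smooth H.isOpen (H.invHessFun_smooth i j) hy
  cases m with
  | inl k => exact pd_inl_comp_base hd k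
  | inr k => exact pd_inr_comp_base hd k

omit H in
theorem pd_toric_lr (y : Fin 2 ⊕ Fin 2 → ℝ) (m : Fin 2 ⊕ Fin 2) (i j : Fin 2) :
    pd m (fun z => toricMetric u z (Sum.inl i) (Sum.inr j)) y = 0 := by
  simp [toricMetric, pd]

omit H in
theorem pd_toric_rl (y : Fin 2 ⊕ Fin 2 → ℝ) (m : Fin 2 ⊕ Fin 2) (i j : Fin 2) :
    pd m (fun z => toricMetric u z (Sum.inr i) (Sum.inl j)) y = 0 := by
  simp [toricMetric, pd]

theorem pdv_hess_symm (hx : x ∈ Ω) (k i j : Fin 2) :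
    pdv k (hessFun u i j) x = pdv k (hessFun u j i) x :=
  pdv_congr H.isOpen (fun _ hz => H.hessFun_symm hz i j) hx k

theorem pdv_hess_comm (hx : x ∈ Ω) (k i j : Fin 2) :
    pdv k (hessFun u i j) x = pdv i (hessFun u k j) x :=
  pdv_comm H.isOpen (pdv_contDiffOn H.isOpen H.smooth j) hx k i

/-- `Γᵏᵢⱼ` for base indices. -/
theorem christoffel_lll {y : Fin 2 ⊕ Fin 2 → ℝ} (hy : base y ∈ Ω) (k i j : Fin 2) :
    christoffel (toricMetric u) (Sum.inl k) (Sum.inl i) (Sum.inl j) y =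
      1 / 2 * ∑ m, invHessFun u k m (base y) * pdv m (hessFun u i j) (base y) := by
  simp only [christoffel, H.toricMetric_inv hy, Fintype.sum_sum_type, Matrix.fromBlocks_apply₁₁,
    Matrix.fromBlocks_apply₁₂, Matrix.zero_apply, zero_mul, Finset.sum_const_zero, add_zero,
    H.pd_toric_ll hy, Sum.elim_inl]
  congr 1
  refine Finset.sum_congr rfl fun m _ => ?_
  -- Third derivatives of u are totally symmetric, so two of the three terms cancel and one is left.
  rw [invHessFun, H.pdv_hess_symm hy i j m, H.pdv_hess_comm hy i m j, H.pdv_hess_symm hy j i m,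
    H.pdv_hess_comm hy j m i, H.pdv_hess_symm hy m j i]
  ring

/-- In these names `l` stands for a base index and `r` for an angle index. The metric is block
diagonal and independent of the angles, so the symbols with exactly one angle index vanish. -/
theorem christoffel_lrr {y : Fin 2 ⊕ Fin 2 → ℝ} (hy : base y ∈ Ω) (k i j : Fin 2) :
    christoffel (toricMetric u) (Sum.inl k) (Sum.inr i) (Sum.inr j) y =
      -1 / 2 * ∑ m, invHessFun u k m (base y) * pdv m (invHessFun u i j) (base y) := by
  simp only [christoffel, H.toricMetric_inv hy, Fintype.sum_sum_type, Matrix.fromBlocks_apply₁₁,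
    Matrix.fromBlocks_apply₁₂, Matrix.zero_apply, zero_mul, Finset.sum_const_zero, add_zero,
    H.pd_toric_rr hy, pd_toric_rl, Sum.elim_inl, invHessFun, zero_sub]
  simp only [Finset.mul_sum]
  refine Finset.sum_congr rfl fun m _ => ?_
  ring

theorem christoffel_rlr {y : Fin 2 ⊕ Fin 2 → ℝ} (hy : base y ∈ Ω) (k i j : Fin 2) :
    christoffel (toricMetric u) (Sum.inr k) (Sum.inl i) (Sum.inr j) y =
      1 / 2 * ∑ m, hessFun u k m (base y) * pdv i (invHessFun u j m) (base y) := by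
  simp only [christoffel, H.toricMetric_inv hy, Fintype.sum_sum_type, Matrix.fromBlocks_apply₂₁,
    Matrix.fromBlocks_apply₂₂, Matrix.zero_apply, zero_mul, Finset.sum_const_zero, zero_add,
    H.pd_toric_rr hy, pd_toric_lr, Sum.elim_inl, hessFun, sub_zero, add_zero]

theorem christoffel_llr {y : Fin 2 ⊕ Fin 2 → ℝ} (hy : base y ∈ Ω) (k i j : Fin 2) :
    christoffel (toricMetric u) (Sum.inl k) (Sum.inl i) (Sum.inr j) y = 0 := by
  simp [christoffel, H.toricMetric_inv hy, H.pd_toric_rr hy, H.pd_toric_ll hy, pd_toric_rl,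
    pd_toric_lr]

theorem christoffel_lrl {y : Fin 2 ⊕ Fin 2 → ℝ} (hy : base y ∈ Ω) (k i j : Fin 2) :
    christoffel (toricMetric u) (Sum.inl k) (Sum.inr i) (Sum.inl j) y = 0 := by
  simp [christoffel, H.toricMetric_inv hy, H.pd_toric_rr hy, H.pd_toric_ll hy, pd_toric_rl,
    pd_toric_lr]

theorem christoffel_rll {y : Fin 2 ⊕ Fin 2 → ℝ} (hy : base y ∈ Ω) (k i j : Fin 2) :
    christoffel (toricMetric u) (Sum.inr k) (Sum.inl i) (Sum.inl j) y = 0 := by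
  simp [christoffel, H.toricMetric_inv hy, H.pd_toric_ll hy, pd_toric_lr]

theorem hessFun_mul_inv (hx : x ∈ Ω) (i j : Fin 2) :
    ∑ m, hessFun u i m x * invHessFun u m j x = if i = j then 1 else 0 := by
  have := Matrix.mul_nonsing_inv (hess u x) (H.posDef x hx).det_pos.ne'.isUnit
  have h := congrFun (congrFun this i) j
  rw [Matrix.mul_apply, Matrix.one_apply] at h
  exact h

open Matrix in
theorem invHessFun_symm (hx : x ∈ Ω) (i j : Fin 2) : invHessFun u i j x = invHessFun u j i x := by
  have h : ((hess u x)⁻¹)ᴴ = (hess u x)⁻¹ := (H.posDef x hx).inv.1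
  have := congrFun (congrFun h i) j
  simpa [invHessFun] using this.symm

/-- The component from which the second derivative of the inverse Hessian is recovered: it enters
linearly, and everything else is quadratic in first derivatives of the Hessian and its inverse. -/
theorem riemannUp_mixed {y : Fin 2 ⊕ Fin 2 → ℝ} (hy : base y ∈ Ω) (a j k i : Fin 2) :
    riemannUp (toricMetric u) (Sum.inl a) (Sum.inr j) (Sum.inl k) (Sum.inr i) y =
      -1 / 2 * ∑ m, (pdv k (invHessFun u a m) (base y) * pdv m (invHessFun u i j) (base y) +
        invHessFun u a m (base y) * pdv k (pdv m (invHessFun u i j)) (base y)) +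
      ∑ m, (christoffel (toricMetric u) (Sum.inl a) (Sum.inl k) (Sum.inl m) y *
          christoffel (toricMetric u) (Sum.inl m) (Sum.inr i) (Sum.inr j) y -
        christoffel (toricMetric u) (Sum.inl a) (Sum.inr i) (Sum.inr m) y *
          christoffel (toricMetric u) (Sum.inr m) (Sum.inl k) (Sum.inr j) y) := by
  have dV := fun i j => differentiableAt_of_smooth H.isOpen (H.invHessFun_smooth i j) hy
  have ddV := fun m i j => differentiableAt_of_smooth H.isOpen
    (pdv_contDiffOn H.isOpen (H.invHessFun_smooth i j) m) hy
  have e1 : pd (Sum.inl k) (christoffel (toricMetric u) (Sum.inl a) (Sum.inr i) (Sum.inr j)) y =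
      -1 / 2 * ∑ m, (pdv k (invHessFun u a m) (base y) * pdv m (invHessFun u i j) (base y) +
        invHessFun u a m (base y) * pdv k (pdv m (invHessFun u i j)) (base y)) := by
    rw [pd_congr_on_base H.isOpen (fun z hz => H.christoffel_lrr hz a i j) hy]
    rw [pd_inl_comp_base (F := fun x => -1 / 2 *
      ∑ m, invHessFun u a m x * pdv m (invHessFun u i j) x)]
    · exact pdv_const_mul_sum _ (fun m => dV a m) (fun m => ddV m i j) _ _
    · exact differentiableAt_const_mul_sum _ (fun m => dV a m) (fun m => ddV m i j) _
  have e2 : pd (Sum.inr i) (christoffel (toricMetric u) (Sum.inl a) (Sum.inl k) (Sum.inr j)) y =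
      0 := by
    rw [pd_congr_on_base H.isOpen (fun z hz => H.christoffel_llr hz a k j) hy]
    simp [pd]
  rw [riemannUp, e1, e2, Fintype.sum_sum_type]
  simp only [H.christoffel_lrl hy, H.christoffel_llr hy, zero_mul, sub_zero, zero_sub]
  rw [Finset.sum_sub_distrib, Finset.sum_neg_distrib]
  ring

/-- The fourth derivatives of u cancel by antisymmetry in the last two indices. What is left is
quadratic in third derivatives and supplies the correction needed for the mixed components. -/
theorem riemannUp_base {y : Fin 2 ⊕ Fin 2 → ℝ} (hy : base y ∈ Ω) (a b c d : Fin 2) :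
    riemannUp (toricMetric u) (Sum.inl a) (Sum.inl b) (Sum.inl c) (Sum.inl d) y =
      1 / 2 * ∑ m, (pdv c (invHessFun u a m) (base y) * pdv m (hessFun u d b) (base y) -
        pdv d (invHessFun u a m) (base y) * pdv m (hessFun u c b) (base y)) +
      ∑ m, (christoffel (toricMetric u) (Sum.inl a) (Sum.inl c) (Sum.inl m) y *
          christoffel (toricMetric u) (Sum.inl m) (Sum.inl d) (Sum.inl b) y -
        christoffel (toricMetric u) (Sum.inl a) (Sum.inl d) (Sum.inl m) y *
          christoffel (toricMetric u) (Sum.inl m) (Sum.inl c) (Sum.inl b) y) := by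
  have dV := fun i j => differentiableAt_of_smooth H.isOpen (H.invHessFun_smooth i j) hy
  have ddU := fun m i j => differentiableAt_of_smooth H.isOpen
    (pdv_contDiffOn H.isOpen (H.hessFun_smooth i j) m) hy
  have e1 : ∀ c d, pd (Sum.inl c)
      (christoffel (toricMetric u) (Sum.inl a) (Sum.inl d) (Sum.inl b)) y =
      1 / 2 * ∑ m, (pdv c (invHessFun u a m) (base y) * pdv m (hessFun u d b) (base y) +
        invHessFun u a m (base y) * pdv c (pdv m (hessFun u d b)) (base y)) := by
    intro c d
    rw [pd_congr_on_base H.isOpen (fun z hz => H.christoffel_lll hz a d b) hy]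
    rw [pd_inl_comp_base (F := fun x => 1 / 2 *
      ∑ m, invHessFun u a m x * pdv m (hessFun u d b) x)]
    · exact pdv_const_mul_sum _ (fun m => dV a m) (fun m => ddU m d b) _ _
    · exact differentiableAt_const_mul_sum _ (fun m => dV a m) (fun m => ddU m d b) _
  have e3 : ∀ m, pdv c (pdv m (hessFun u d b)) (base y) =
      pdv d (pdv m (hessFun u c b)) (base y) := by
    intro m
    rw [pdv_congr H.isOpen (fun z hz => H.pdv_hess_comm hz m d b) hy,
      pdv_comm H.isOpen (H.hessFun_smooth m b) hy,
      pdv_congr H.isOpen (fun z hz => H.pdv_hess_comm hz c m b) hy]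
  rw [riemannUp, e1, e1, Fintype.sum_sum_type]
  simp only [H.christoffel_llr hy, H.christoffel_rll hy, mul_zero, sub_zero,
    Finset.sum_const_zero, e3, Fin.sum_univ_two]
  ring

omit H in
theorem riemann_lower {y : Fin 2 ⊕ Fin 2 → ℝ} (l : Fin 2) (k i j : Fin 2 ⊕ Fin 2) :
    riemann (toricMetric u) (Sum.inl l) k i j y =
      ∑ m, hessFun u l m (base y) * riemannUp (toricMetric u) (Sum.inl m) k i j y := by
  rw [riemann, Fintype.sum_sum_type]
  simp [toricMetric, hessFun]

end StrictConvexSmoothOn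
end Metric
end ToricSurface

/-! ### Second derivatives of the inverse Hessian as curvature. -/

namespace ToricSurface

/-- Algebraic form of the curvature identity: `U` is the Hessian, `V` its inverse, `T` and `W` are
their first derivatives and `Q` is the second derivative of `V`. -/
theorem curvature_algebra {U V : Fin 2 → Fin 2 → ℝ} {T W : Fin 2 → Fin 2 → Fin 2 → ℝ}
    {Q : Fin 2 → Fin 2 → Fin 2 → Fin 2 → ℝ}
    (hU : ∀ i j, U i j = U j i) (hV : ∀ i j, V i j = V j i)
    (hT : ∀ k i j, T k i j = T i k j) (hT' : ∀ k i j, T k i j = T k j i)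
    (hUV : ∀ i j, ∑ m, U i m * V m j = if i = j then 1 else 0)
    (hW : ∀ k i j, ∑ m, U i m * W k m j = -∑ m, T k i m * V m j)
    (hWs : ∀ k i j, W k i j = W k j i) (l j k i : Fin 2) :
    Q k l i j =
      -2 * (∑ a, U l a * (-1 / 2 * ∑ m, (W k a m * W m i j + V a m * Q k m i j) +
        ∑ m, ((1 / 2 * ∑ n, V a n * T n k m) * (-1 / 2 * ∑ n, V m n * W n i j) -
          (-1 / 2 * ∑ n, V a n * W n i m) * (1 / 2 * ∑ n, U m n * W k j n))))
      - 2 * ∑ p, ∑ r, V i p * V j r *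
        (∑ a, U l a * (1 / 2 * ∑ m, (W p a m * T m k r - W k a m * T m p r) +
          ∑ m, ((1 / 2 * ∑ n, V a n * T n p m) * (1 / 2 * ∑ n, V m n * T n k r) -
            (1 / 2 * ∑ n, V a n * T n k m) * (1 / 2 * ∑ n, V m n * T n p r)))) := by
  -- Lowering the index `l` undoes the raising in the Christoffel symbols.
  have c1 : ∀ F : Fin 2 → ℝ, ∑ a, U l a * ∑ n, V a n * F n = F l := by
    intro F
    calc ∑ a, U l a * ∑ n, V a n * F n = ∑ n, (∑ a, U l a * V a n) * F n := by
          simp only [Fin.sum_univ_two]; ring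
      _ = F l := by simp [hUV]
  -- This is dV = -V dU V, which eliminates `W` in favour of `T` and `V`.
  have hWe : ∀ k i j, W k i j = -∑ a, ∑ b, V i a * T k a b * V b j := by
    intro k i j
    have h : ∑ a, V i a * ∑ m, U a m * W k m j = W k i j := by
      calc ∑ a, V i a * ∑ m, U a m * W k m j
          = ∑ m, (∑ a, U a m * V i a) * W k m j := by
            simp only [Fin.sum_univ_two]; ring
        _ = ∑ m, (if m = i then 1 else 0) * W k m j := by
            refine Finset.sum_congr rfl fun m _ => ?_
            rw [← hUV m i]
            congr 1
            exact Finset.sum_congr rfl fun a _ => by rw [hU a m, hV i a]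
        _ = W k i j := by simp
    rw [← h]
    simp only [hW, Fin.sum_univ_two]
    ring
  have r1 : (∑ a, U l a * (-1 / 2 * ∑ m, (W k a m * W m i j + V a m * Q k m i j) +
        ∑ m, ((1 / 2 * ∑ n, V a n * T n k m) * (-1 / 2 * ∑ n, V m n * W n i j) -
          (-1 / 2 * ∑ n, V a n * W n i m) * (1 / 2 * ∑ n, U m n * W k j n)))) =
      -1 / 2 * ∑ m, (∑ a, U l a * W k a m) * W m i j
        - 1 / 2 * (∑ a, U l a * ∑ m, V a m * Q k m i j) +
        ∑ m, ((1 / 2 * ∑ a, U l a * ∑ n, V a n * T n k m) * (-1 / 2 * ∑ n, V m n * W n i j) -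
          (-1 / 2 * ∑ a, U l a * ∑ n, V a n * W n i m) * (1 / 2 * ∑ n, U m n * W k n j)) := by
    simp only [Fin.sum_univ_two]
    rw [hWs k j 0, hWs k j 1]
    ring
  have r2 : ∀ p r, (∑ a, U l a * (1 / 2 * ∑ m, (W p a m * T m k r - W k a m * T m p r) +
          ∑ m, ((1 / 2 * ∑ n, V a n * T n p m) * (1 / 2 * ∑ n, V m n * T n k r) -
            (1 / 2 * ∑ n, V a n * T n k m) * (1 / 2 * ∑ n, V m n * T n p r)))) =
      1 / 2 * ∑ m, ((∑ a, U l a * W p a m) * T m k r - (∑ a, U l a * W k a m) * T m p r) +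
        ∑ m, ((1 / 2 * ∑ a, U l a * ∑ n, V a n * T n p m) * (1 / 2 * ∑ n, V m n * T n k r) -
            (1 / 2 * ∑ a, U l a * ∑ n, V a n * T n k m) * (1 / 2 * ∑ n, V m n * T n p r)) := by
    intro p r
    simp only [Fin.sum_univ_two]
    ring
  rw [r1]
  simp only [r2]
  rw [c1 (fun n => Q k n i j)]
  simp only [c1 (fun n => T n _ _), c1 (fun n => W n _ _), hW]
  -- Only four independent third derivatives and three entries of `V` remain, so each choice of
  -- indices is a polynomial identity.
  have t1 : T 0 1 0 = T 0 0 1 := hT' _ _ _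
  have t2 : T 1 0 0 = T 0 0 1 := by rw [hT, hT']
  have t3 : T 1 0 1 = T 0 1 1 := hT _ _ _
  have t4 : T 1 1 0 = T 0 1 1 := by rw [hT', hT]
  have v1 : V 1 0 = V 0 1 := hV _ _
  simp only [hWe, Fin.sum_univ_two]
  fin_cases l <;> fin_cases j <;> fin_cases k <;> fin_cases i <;>
    simp only [Fin.zero_eta, Fin.mk_one, t1, t2, t3, t4, v1] <;> ring

namespace StrictConvexSmoothOn

variable {u : Plane → ℝ} {Ω : Set Plane} {x : Plane} (H : StrictConvexSmoothOn u Ω)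

include H

theorem hess_mul_pdv_invHess (hx : x ∈ Ω) (k i j : Fin 2) :
    ∑ m, hessFun u i m x * pdv k (invHessFun u m j) x =
      -∑ m, pdv k (hessFun u i m) x * invHessFun u m j x := by
  have dU := fun i j => differentiableAt_of_smooth H.isOpen (H.hessFun_smooth i j) hx
  have dV := fun i j => differentiableAt_of_smooth H.isOpen (H.invHessFun_smooth i j) hx
  have h1 := pdv_const_mul_sum Finset.univ (A := fun m => hessFun u i m)
    (B := fun m => invHessFun u m j) (fun m => dU i m) (fun m => dV m j) 1 k
  have h2 : pdv k (fun z => 1 * ∑ m, hessFun u i m z * invHessFun u m j z) x =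
      pdv k (fun _ => if i = j then 1 else 0) x :=
    pdv_congr H.isOpen (fun z hz => by simp only [one_mul]; exact H.hessFun_mul_inv hz i j) hx k
  rw [h2, pdv_const, one_mul, Finset.sum_add_distrib] at h1
  linarith

/-- The second derivatives of the inverse Hessian are curvature components. -/
theorem pdv_pdv_invHess {y : Fin 2 ⊕ Fin 2 → ℝ} (hy : base y ∈ Ω) (l j k i : Fin 2) :
    pdv k (pdv l (invHessFun u i j)) (base y) =
      -2 * riemann (toricMetric u) (Sum.inl l) (Sum.inr j) (Sum.inl k) (Sum.inr i) y
      - 2 * ∑ p, ∑ r, invHessFun u i p (base y) * invHessFun u j r (base y) *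
        riemann (toricMetric u) (Sum.inl l) (Sum.inl r) (Sum.inl p) (Sum.inl k) y := by
  have := curvature_algebra (U := fun i j => hessFun u i j (base y))
    (V := fun i j => invHessFun u i j (base y))
    (T := fun k i j => pdv k (hessFun u i j) (base y))
    (W := fun k i j => pdv k (invHessFun u i j) (base y))
    (Q := fun k l i j => pdv k (pdv l (invHessFun u i j)) (base y))
    (H.hessFun_symm hy) (H.invHessFun_symm hy) (H.pdv_hess_comm hy) (H.pdv_hess_symm hy)
    (H.hessFun_mul_inv hy) (H.hess_mul_pdv_invHess hy)
    (fun k i j => pdv_congr H.isOpen (fun z hz => H.invHessFun_symm hz i j) hy k) l j k i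
  rw [this]
  simp only [riemann_lower, H.riemannUp_mixed hy, H.riemannUp_base hy, H.christoffel_lll hy,
    H.christoffel_lrr hy, H.christoffel_rlr hy]

open Matrix in
/-- The curvature bound as a bound for the second derivatives of the inverse Hessian. -/
theorem abs_contract_invHess_le {C : ℝ} {y : Fin 2 ⊕ Fin 2 → ℝ} (hy : base y ∈ Ω)
    (hC : rmNorm (toricMetric u) y ≤ C) (ξ η v w : Fin 2 → ℝ) :
    |∑ k, ∑ l, ∑ i, ∑ j, v k * w l * ξ i * η j * pdv k (pdv l (invHessFun u i j)) (base y)| ≤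
      4 * C * √((ξ ⬝ᵥ (hess u (base y))⁻¹ *ᵥ ξ) * (η ⬝ᵥ (hess u (base y))⁻¹ *ᵥ η) *
        (v ⬝ᵥ hess u (base y) *ᵥ v) * (w ⬝ᵥ hess u (base y) *ᵥ w)) := by
  set U := hess u (base y) with hUdef
  set S := (ξ ⬝ᵥ U⁻¹ *ᵥ ξ) * (η ⬝ᵥ U⁻¹ *ᵥ η) * (v ⬝ᵥ U *ᵥ v) * (w ⬝ᵥ U *ᵥ w) with hS
  have hpos := H.toricMetric_posDef hy
  have hC0 : 0 ≤ C := (Real.sqrt_nonneg _).trans hC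
  have hUpos : U.PosDef := H.posDef _ hy
  have hS0 : 0 ≤ S := by
    have a1 : ∀ v, 0 ≤ v ⬝ᵥ U *ᵥ v := fun v => by
      simpa using hUpos.posSemidef.dotProduct_mulVec_nonneg v
    have a2 : ∀ v, 0 ≤ v ⬝ᵥ U⁻¹ *ᵥ v := fun v => by
      simpa using hUpos.inv.posSemidef.dotProduct_mulVec_nonneg v
    have := a1 v; have := a1 w; have := a2 ξ; have := a2 η
    positivity
  have hl : ∀ a : Fin 2 → ℝ, (Sum.elim a 0 : Fin 2 ⊕ Fin 2 → ℝ) ⬝ᵥ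
      toricMetric u y *ᵥ Sum.elim a 0 = a ⬝ᵥ U *ᵥ a := by
    intro a
    rw [toricMetric, fromBlocks_mulVec]
    simp [dotProduct, Fintype.sum_sum_type, ← hUdef]
  have hr : ∀ a : Fin 2 → ℝ, (Sum.elim 0 a : Fin 2 ⊕ Fin 2 → ℝ) ⬝ᵥ
      toricMetric u y *ᵥ Sum.elim 0 a = a ⬝ᵥ U⁻¹ *ᵥ a := by
    intro a
    rw [toricMetric, fromBlocks_mulVec]
    simp [dotProduct, Fintype.sum_sum_type, ← hUdef]
  -- Raising an index is an isometry. Hence the component with ξ, η in angle slots and the one with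
  -- the raised vectors in base slots have the same bound, and the factor 4 is 2 + 2.
  have hq : ∀ a : Fin 2 → ℝ, (U⁻¹ *ᵥ a) ⬝ᵥ U *ᵥ (U⁻¹ *ᵥ a) = a ⬝ᵥ U⁻¹ *ᵥ a := by
    intro a
    rw [mulVec_mulVec, mul_nonsing_inv _ hUpos.det_pos.ne'.isUnit, one_mulVec, dotProduct_comm]
  have b1 := sq_contract_riemann_le hpos (Sum.elim w 0) (Sum.elim 0 η) (Sum.elim v 0)
    (Sum.elim 0 ξ)
  have b2 := sq_contract_riemann_le hpos (Sum.elim w 0) (Sum.elim (U⁻¹ *ᵥ η) 0)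
    (Sum.elim (U⁻¹ *ᵥ ξ) 0) (Sum.elim v 0)
  rw [hl, hr, hl, hr] at b1
  rw [hl, hl, hl, hl, hq, hq] at b2
  simp only [Fintype.sum_sum_type, Sum.elim_inl, Sum.elim_inr, Pi.zero_apply, zero_mul, mul_zero,
    Finset.sum_const_zero, add_zero, zero_add] at b1 b2
  set E1 := ∑ a, ∑ b, ∑ c, ∑ d, riemann (toricMetric u) (Sum.inl a) (Sum.inr b) (Sum.inl c)
    (Sum.inr d) y * (w a * (η b * (v c * ξ d))) with hE1
  set E2 := ∑ a, ∑ b, ∑ c, ∑ d, riemann (toricMetric u) (Sum.inl a) (Sum.inl b) (Sum.inl c)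
    (Sum.inl d) y * (w a * ((U⁻¹ *ᵥ η) b * ((U⁻¹ *ᵥ ξ) c * v d))) with hE2
  have hsum : ∑ k, ∑ l, ∑ i, ∑ j, v k * w l * ξ i * η j *
      pdv k (pdv l (invHessFun u i j)) (base y) = -2 * E1 - 2 * E2 := by
    have hm : ∀ (a : Fin 2 → ℝ) i, (U⁻¹ *ᵥ a) i = ∑ p, invHessFun u p i (base y) * a p := by
      intro a i
      simp only [mulVec, dotProduct]
      exact Finset.sum_congr rfl fun p _ => by rw [H.invHessFun_symm hy p i]; rfl
    rw [hE1, hE2]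
    simp only [H.pdv_pdv_invHess hy, hm, Fin.sum_univ_two]
    ring
  have key : ∀ E S' : ℝ, E ^ 2 ≤ rmNorm (toricMetric u) y ^ 2 * S' → S' = S → |E| ≤ C * √S := by
    intro E S' h hS'
    rw [hS'] at h
    have h2 : |E| ≤ rmNorm (toricMetric u) y * √S := by
      apply abs_le_of_sq_le_sq
      · rw [mul_pow, Real.sq_sqrt hS0]; exact h
      · exact mul_nonneg (Real.sqrt_nonneg _) (Real.sqrt_nonneg _)
    exact h2.trans (mul_le_mul_of_nonneg_right hC (Real.sqrt_nonneg _))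
  have k1 := key _ _ b1 (by rw [hS]; ring)
  have k2 := key _ _ b2 (by rw [hS]; ring)
  rw [hsum]
  calc |-2 * E1 - 2 * E2| ≤ 2 * |E1| + 2 * |E2| := by
        rw [abs_le]
        have := abs_le.1 (le_refl |E1|); have := abs_le.1 (le_refl |E2|)
        constructor <;> linarith
    _ ≤ 4 * C * √S := by linarith

end StrictConvexSmoothOn
end ToricSurface

/-! ### The curvature bound in an affine frame. -/

namespace ToricSurface

/-- The derivative of `F` in direction `v`. -/
noncomputable def dirD (v : Plane) (F : Plane → ℝ) (x : Plane) : ℝ := fderiv ℝ F x v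

/-- The second derivative of `u` in directions `v`, `w`. -/
noncomputable def d2 (u : Plane → ℝ) (v w : Plane) : Plane → ℝ := dirD v (dirD w u)

/-- The determinant of the Hessian of `u` in the basis `a`, `b`. -/
noncomputable def hessDet (u : Plane → ℝ) (a b : Plane) (x : Plane) : ℝ :=
  d2 u a a x * d2 u b b x - d2 u a b x ^ 2

section Calculus

variable {Ω : Set Plane} {F G : Plane → ℝ} {x : Plane}

theorem plane_eq_sum (v : Plane) : v = ∑ k, v k • EuclideanSpace.single k (1 : ℝ) := by
  ext i
  fin_cases i <;> simp

theorem dirD_eq_sum (v : Plane) (F : Plane → ℝ) (x : Plane) :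
    dirD v F x = ∑ k, v k * pdv k F x := by
  unfold dirD pdv
  conv_lhs => rw [plane_eq_sum v]
  rw [map_sum]
  simp

theorem dirD_contDiffOn (hΩ : IsOpen Ω) (hF : ContDiffOn ℝ ∞ F Ω) (v : Plane) :
    ContDiffOn ℝ ∞ (dirD v F) Ω :=
  (hF.fderiv_of_isOpen hΩ (by simp)).clm_apply contDiffOn_const

theorem dirD_congr (hΩ : IsOpen Ω) (h : Set.EqOn F G Ω) (v : Plane) :
    Set.EqOn (dirD v F) (dirD v G) Ω := by
  intro x hx
  unfold dirD
  rw [Filter.EventuallyEq.fderiv_eq (h.eventuallyEq_of_mem (hΩ.mem_nhds hx))]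

theorem pdv_sum_const_mul {ι : Type*} (t : Finset ι) {A : ι → Plane → ℝ}
    (hA : ∀ m, DifferentiableAt ℝ (A m) x) (c : ι → ℝ) (i : Fin 2) :
    pdv i (fun z => ∑ m ∈ t, c m * A m z) x = ∑ m ∈ t, c m * pdv i (A m) x := by
  unfold pdv
  rw [fderiv_fun_sum fun m _ => (hA m).const_mul (c m), _root_.sum_apply]
  exact Finset.sum_congr rfl fun m _ => pdv_const_mul (hA m) (c m) i

theorem dirD_dirD_eq_sum (hΩ : IsOpen Ω) (hF : ContDiffOn ℝ ∞ F Ω) (hx : x ∈ Ω) (v w : Plane) :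
    dirD v (dirD w F) x = ∑ k, ∑ l, v k * w l * pdv k (pdv l F) x := by
  have : dirD w F = fun z => ∑ l, w l * pdv l F z := funext fun z => dirD_eq_sum w F z
  rw [dirD_eq_sum, this]
  refine Finset.sum_congr rfl fun k _ => ?_
  rw [pdv_sum_const_mul _ fun l =>
    differentiableAt_of_smooth hΩ (pdv_contDiffOn hΩ hF l) hx, Finset.mul_sum]
  exact Finset.sum_congr rfl fun l _ => by ring

theorem dirD_dirD_sum_const_mul {ι : Type*} (hΩ : IsOpen Ω) (t : Finset ι) {A : ι → Plane → ℝ}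
    (hA : ∀ m, ContDiffOn ℝ ∞ (A m) Ω) (c : ι → ℝ) (hx : x ∈ Ω) (v w : Plane) :
    dirD v (dirD w fun z => ∑ m ∈ t, c m * A m z) x =
      ∑ k, ∑ l, ∑ m ∈ t, v k * w l * c m * pdv k (pdv l (A m)) x := by
  have hsm : ContDiffOn ℝ ∞ (fun z => ∑ m ∈ t, c m * A m z) Ω :=
    ContDiffOn.sum fun m _ => contDiffOn_const.mul (hA m)
  rw [dirD_dirD_eq_sum hΩ hsm hx]
  refine Finset.sum_congr rfl fun k _ => Finset.sum_congr rfl fun l _ => ?_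
  have h1 : ∀ z ∈ Ω, pdv l (fun z => ∑ m ∈ t, c m * A m z) z = ∑ m ∈ t, c m * pdv l (A m) z :=
    fun z hz => pdv_sum_const_mul _ (fun m => differentiableAt_of_smooth hΩ (hA m) hz) _ _
  rw [pdv_congr hΩ h1 hx, pdv_sum_const_mul _ fun m => differentiableAt_of_smooth hΩ
    (pdv_contDiffOn hΩ (hA m) l) hx, Finset.mul_sum]
  exact Finset.sum_congr rfl fun j _ => by ring

theorem dirD_comm (hΩ : IsOpen Ω) (hF : ContDiffOn ℝ ∞ F Ω) (hx : x ∈ Ω) (v w : Plane) :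
    dirD v (dirD w F) x = dirD w (dirD v F) x := by
  rw [dirD_dirD_eq_sum hΩ hF hx, dirD_dirD_eq_sum hΩ hF hx, Finset.sum_comm]
  refine Finset.sum_congr rfl fun k _ => Finset.sum_congr rfl fun l _ => ?_
  rw [pdv_comm hΩ hF hx l k]
  ring

end Calculus

namespace StrictConvexSmoothOn

variable {u : Plane → ℝ} {Ω : Set Plane} {x : Plane} (H : StrictConvexSmoothOn u Ω)

include H

theorem d2_smooth (v w : Plane) : ContDiffOn ℝ ∞ (d2 u v w) Ω :=
  dirD_contDiffOn H.isOpen (dirD_contDiffOn H.isOpen H.smooth w) v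

theorem d2_eq (hx : x ∈ Ω) (v w : Plane) :
    d2 u v w x = v 0 * w 0 * hessFun u 0 0 x + (v 0 * w 1 + v 1 * w 0) * hessFun u 0 1 x +
      v 1 * w 1 * hessFun u 1 1 x := by
  have h := H.hessFun_symm hx 1 0
  rw [d2, dirD_dirD_eq_sum H.isOpen H.smooth hx]
  simp only [Fin.sum_univ_two]
  change _ * hessFun u 0 0 x + _ * hessFun u 0 1 x + (_ * hessFun u 1 0 x + _ * hessFun u 1 1 x)
    = _
  rw [h]
  ring

theorem d2_symm (hx : x ∈ Ω) (v w : Plane) : d2 u v w x = d2 u w v x := by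
  rw [H.d2_eq hx, H.d2_eq hx]
  ring

open Matrix in
theorem dotProduct_hess (hx : x ∈ Ω) (v : Plane) :
    (fun k => v k) ⬝ᵥ hess u x *ᵥ (fun k => v k) = d2 u v v x := by
  have h : hess u x 1 0 = hess u x 0 1 := H.hessFun_symm hx 1 0
  rw [H.d2_eq hx]
  simp only [dotProduct, mulVec, Fin.sum_univ_two, h, hessFun]
  ring

theorem d2_pos (hx : x ∈ Ω) {v : Plane} (hv : v ≠ 0) : 0 < d2 u v v x := by
  rw [← H.dotProduct_hess hx]
  have hv' : (fun k => v k) ≠ (0 : Fin 2 → ℝ) := by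
    intro h
    exact hv (by ext k; exact congrFun h k)
  simpa using (H.posDef x hx).dotProduct_mulVec_pos hv'

theorem hessDet_eq (hx : x ∈ Ω) (a b : Plane) :
    hessDet u a b x = (a 0 * b 1 - a 1 * b 0) ^ 2 *
      (hessFun u 0 0 x * hessFun u 1 1 x - hessFun u 0 1 x ^ 2) := by
  rw [hessDet, H.d2_eq hx, H.d2_eq hx, H.d2_eq hx]
  ring

theorem hessDet_pos (hx : x ∈ Ω) {a b : Plane} (hab : a 0 * b 1 - a 1 * b 0 ≠ 0) :
    0 < hessDet u a b x := by
  rw [H.hessDet_eq hx]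
  have := H.det_pos hx
  positivity

theorem dirD_dirD_invForm (hx : x ∈ Ω) (v w : Plane) (ξ η : Fin 2 → ℝ) :
    dirD v (dirD w fun z => ∑ i, ∑ j, ξ i * η j * invHessFun u i j z) x =
      ∑ k, ∑ l, ∑ i, ∑ j, v k * w l * ξ i * η j * pdv k (pdv l (invHessFun u i j)) x := by
  have e : (fun z => ∑ i, ∑ j, ξ i * η j * invHessFun u i j z) =
      fun z => ∑ m : Fin 2 × Fin 2, (ξ m.1 * η m.2) * invHessFun u m.1 m.2 z := by
    funext z
    rw [Fintype.sum_prod_type]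
  have key := dirD_dirD_sum_const_mul H.isOpen (Finset.univ : Finset (Fin 2 × Fin 2))
    (A := fun m z => invHessFun u m.1 m.2 z)
    (fun m => H.invHessFun_smooth m.1 m.2) (fun m => ξ m.1 * η m.2) hx v w
  rw [e, key]
  refine Finset.sum_congr rfl fun k _ => Finset.sum_congr rfl fun l _ => ?_
  rw [Fintype.sum_prod_type]
  exact Finset.sum_congr rfl fun i _ => Finset.sum_congr rfl fun j _ => by ring

open Matrix in
theorem abs_dirD_dirD_invForm_le {C : ℝ}
    (hC : ∀ y, base y ∈ Ω → rmNorm (toricMetric u) y ≤ C) (hx : x ∈ Ω) (v w : Plane)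
    (ξ η : Fin 2 → ℝ) :
    |dirD v (dirD w fun z => ∑ i, ∑ j, ξ i * η j * invHessFun u i j z) x| ≤
      4 * C * √((ξ ⬝ᵥ (hess u x)⁻¹ *ᵥ ξ) * (η ⬝ᵥ (hess u x)⁻¹ *ᵥ η) * d2 u v v x * d2 u w w x) := by
  have hb := base_elim x
  rw [H.dirD_dirD_invForm hx, ← H.dotProduct_hess hx, ← H.dotProduct_hess hx]
  have := H.abs_contract_invHess_le (y := Sum.elim (fun i => x i) 0) (by rwa [hb])
    (hC _ (by rwa [hb])) ξ η (fun k => v k) (fun k => w k)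
  rwa [hb] at this

open Matrix in
theorem invForm_eq (hx : x ∈ Ω) (ξ η : Fin 2 → ℝ) :
    ∑ i, ∑ j, ξ i * η j * invHessFun u i j x =
      (hessFun u 0 0 x * hessFun u 1 1 x - hessFun u 0 1 x ^ 2)⁻¹ *
        (ξ 0 * η 0 * hessFun u 1 1 x - (ξ 0 * η 1 + ξ 1 * η 0) * hessFun u 0 1 x +
          ξ 1 * η 1 * hessFun u 0 0 x) := by
  unfold invHessFun
  rw [H.invHess_eq hx]
  simp [Fin.sum_univ_two]
  ring

omit H in
open Matrix in
theorem dotProduct_invHess (ξ : Fin 2 → ℝ) :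
    ξ ⬝ᵥ (hess u x)⁻¹ *ᵥ ξ = ∑ i, ∑ j, ξ i * ξ j * invHessFun u i j x := by
  simp only [dotProduct, mulVec, Fin.sum_univ_two, invHessFun]
  ring

/-- Curvature bound for the diagonal entries of the inverse Hessian in the basis `a`, `b`. -/
theorem abs_d2_diag_le {C : ℝ} (hC : ∀ y, base y ∈ Ω → rmNorm (toricMetric u) y ≤ C)
    (hx : x ∈ Ω) {a b : Plane} (hab : a 0 * b 1 - a 1 * b 0 ≠ 0) :
    |d2 (fun z => d2 u b b z / hessDet u a b z) a a x| ≤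
      4 * C * (d2 u a a x * d2 u b b x / hessDet u a b x) := by
  set m := a 0 * b 1 - a 1 * b 0 with hm
  -- The covector used is 1 on a and 0 on b. Its inverse-Hessian norm squared is u_bb / det, so the
  -- square root in the curvature bound collapses to u_aa u_bb / det.
  have hform : ∀ z ∈ Ω, d2 u b b z / hessDet u a b z =
      ∑ i, ∑ j, ![b 1 / m, -b 0 / m] i * ![b 1 / m, -b 0 / m] j * invHessFun u i j z := by
    intro z hz
    have := H.det_pos hz
    rw [H.invForm_eq hz, H.hessDet_eq hz, H.d2_eq hz, ← hm]
    simp only [Matrix.cons_val_zero, Matrix.cons_val_one]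
    field_simp
    ring
  have e := dirD_congr H.isOpen (dirD_congr H.isOpen hform a) a hx
  have h := H.abs_dirD_dirD_invForm_le hC hx a a ![b 1 / m, -b 0 / m] ![b 1 / m, -b 0 / m]
  rw [d2, e]
  refine h.trans (le_of_eq ?_)
  have ha : a ≠ 0 := by
    rintro rfl
    simp [hm] at hab
  have hb : b ≠ 0 := by
    rintro rfl
    simp [hm] at hab
  have := H.d2_pos hx ha; have := H.d2_pos hx hb; have := H.hessDet_pos hx hab
  rw [dotProduct_invHess, ← hform x hx]
  congr 1
  rw [show d2 u b b x / hessDet u a b x * (d2 u b b x / hessDet u a b x) * d2 u a a x * d2 u a a x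
    = (d2 u a a x * d2 u b b x / hessDet u a b x) ^ 2 by ring, Real.sqrt_sq (by positivity)]

/-- Curvature bound for the off-diagonal entry of the inverse Hessian in the basis `a`, `b`. -/
theorem abs_d2_offDiag_le {C : ℝ} (hC : ∀ y, base y ∈ Ω → rmNorm (toricMetric u) y ≤ C)
    (hx : x ∈ Ω) {a b : Plane} (hab : a 0 * b 1 - a 1 * b 0 ≠ 0) :
    |d2 (fun z => -d2 u a b z / hessDet u a b z) a b x| ≤
      4 * C * (d2 u a a x * d2 u b b x / hessDet u a b x) := by
  set m := a 0 * b 1 - a 1 * b 0 with hm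
  -- The first covector is dual to a and the second dual to b, in the frame a, b.
  have hform : ∀ z ∈ Ω, -d2 u a b z / hessDet u a b z =
      ∑ i, ∑ j, ![b 1 / m, -b 0 / m] i * ![-a 1 / m, a 0 / m] j * invHessFun u i j z := by
    intro z hz
    have := H.det_pos hz
    rw [H.invForm_eq hz, H.hessDet_eq hz, H.d2_eq hz, ← hm]
    simp only [Matrix.cons_val_zero, Matrix.cons_val_one]
    field_simp
    ring
  have hd1 : d2 u b b x / hessDet u a b x =
      ∑ i, ∑ j, ![b 1 / m, -b 0 / m] i * ![b 1 / m, -b 0 / m] j * invHessFun u i j x := by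
    have := H.det_pos hx
    rw [H.invForm_eq hx, H.hessDet_eq hx, H.d2_eq hx, ← hm]
    simp only [Matrix.cons_val_zero, Matrix.cons_val_one]
    field_simp
    ring
  have hd2 : d2 u a a x / hessDet u a b x =
      ∑ i, ∑ j, ![-a 1 / m, a 0 / m] i * ![-a 1 / m, a 0 / m] j * invHessFun u i j x := by
    have := H.det_pos hx
    rw [H.invForm_eq hx, H.hessDet_eq hx, H.d2_eq hx, ← hm]
    simp only [Matrix.cons_val_zero, Matrix.cons_val_one]
    field_simp
    ring
  have e := dirD_congr H.isOpen (dirD_congr H.isOpen hform b) a hx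
  have h := H.abs_dirD_dirD_invForm_le hC hx a b ![b 1 / m, -b 0 / m] ![-a 1 / m, a 0 / m]
  rw [d2, e]
  refine h.trans (le_of_eq ?_)
  have ha : a ≠ 0 := by
    rintro rfl
    simp [hm] at hab
  have hb : b ≠ 0 := by
    rintro rfl
    simp [hm] at hab
  have := H.d2_pos hx ha; have := H.d2_pos hx hb; have := H.hessDet_pos hx hab
  rw [dotProduct_invHess, dotProduct_invHess, ← hd1, ← hd2]
  congr 1
  rw [show d2 u b b x / hessDet u a b x * (d2 u a a x / hessDet u a b x) * d2 u a a x * d2 u b b x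
    = (d2 u a a x * d2 u b b x / hessDet u a b x) ^ 2 by ring, Real.sqrt_sq (by positivity)]

end StrictConvexSmoothOn
end ToricSurface

/-! ### Bounding the Hessian along a segment on which u is bounded. -/

namespace ToricSurface

theorem hasDerivAt_line {F : Plane → ℝ} {x v : Plane} {t : ℝ}
    (hF : DifferentiableAt ℝ F (x + t • v)) :
    HasDerivAt (fun s : ℝ => F (x + s • v)) (dirD v F (x + t • v)) t := by
  have h1 : HasDerivAt (fun s : ℝ => x + s • v) v t := by
    simpa using ((hasDerivAt_id t).smul_const v).const_add x
  exact hF.hasFDerivAt.comp_hasDerivAt t h1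

/-- With a negative second derivative the point would also be a local maximum, so the function would
be locally constant and its second derivative zero. -/
theorem deriv_deriv_nonneg_of_isLocalMin {f f' : ℝ → ℝ} {f'' a : ℝ}
    (hf : ∀ᶠ t in nhds a, HasDerivAt f (f' t) t) (hf' : HasDerivAt f' f'' a)
    (hmin : IsLocalMin f a) : 0 ≤ f'' := by
  by_contra! hneg
  have e : deriv f =ᶠ[nhds a] f' := hf.mono fun t ht => ht.deriv
  have h2 : deriv (deriv f) a = f'' := by rw [e.deriv_eq, hf'.deriv]
  have hmax : IsLocalMax f a := isLocalMax_of_deriv_deriv_neg (by rw [h2]; exact hneg)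
    hmin.deriv_eq_zero hf.self_of_nhds.continuousAt
  have hc : f =ᶠ[nhds a] fun _ => f a := by
    filter_upwards [hmin, hmax] with t h1 h2 using le_antisymm h2 h1
  have h0 : deriv f =ᶠ[nhds a] fun _ => 0 := by
    have := hc.deriv
    simpa using this
  rw [h0.deriv_eq] at h2
  simp at h2
  linarith

/-- If `f ≥ 0` is bounded by `B` on `[-r, r]`, strictly convex, and `(1 / f'')'' ≤ κ`, then
`f''` is bounded at the centre. -/
theorem second_deriv_le_of_room_aux {f f' φ ψ' ψ'' : ℝ → ℝ} {r B κ : ℝ} (hr : 0 < r) (hκ : 0 ≤ κ)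
    (hf : ∀ t, |t| ≤ r → HasDerivAt f (f' t) t) (hf' : ∀ t, |t| ≤ r → HasDerivAt f' (φ t) t)
    (hφ : ∀ t, |t| ≤ r → 0 < φ t)
    (hψ : ∀ t, |t| ≤ r → HasDerivAt (fun t => (φ t)⁻¹) (ψ' t) t)
    (hψ' : ∀ t, |t| ≤ r → HasDerivAt ψ' (ψ'' t) t) (hle : ∀ t, |t| ≤ r → ψ'' t ≤ κ)
    (h0 : ∀ t, |t| ≤ r → 0 ≤ f t) (hB : ∀ t, |t| ≤ r → f t ≤ B) (hsign : ψ' 0 ≤ 0) :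
    φ 0 ≤ 4 / r ^ 2 + (4 * B * (1 + κ / 2) / r) ^ 2 := by
  have habs : ∀ t ∈ Set.Icc (-r) r, |t| ≤ r := fun t ht => abs_le.2 ht
  have h00 : |(0 : ℝ)| ≤ r := by simpa using hr.le
  have hφ0 := hφ 0 h00
  have hsub : Set.Icc 0 r ⊆ Set.Icc (-r) r := Set.Icc_subset_Icc (by linarith) le_rfl
  have hψ'le : ∀ t ∈ Set.Icc (0 : ℝ) r, ψ' t ≤ κ * t := by
    have hanti : AntitoneOn (fun t => ψ' t - κ * t) (Set.Icc 0 r) := by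
      refine antitoneOn_of_hasDerivWithinAt_nonpos (f' := fun t => ψ'' t - κ) (convex_Icc _ _)
        (fun t ht => ?_) (fun t ht => ?_) (fun t ht => ?_)
      · exact ((hψ' t (habs t (hsub ht))).continuousAt.sub (by fun_prop)).continuousWithinAt
      · have := (hψ' t (habs t (hsub (interior_subset ht)))).sub
          ((hasDerivAt_id t).const_mul κ)
        exact (this.congr_deriv (by simp)).hasDerivWithinAt
      · have := hle t (habs t (hsub (interior_subset ht)))
        linarith
    intro t ht
    have := hanti (Set.left_mem_Icc.2 hr.le) ht ht.1
    simp only [mul_zero, sub_zero] at this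
    linarith
  have hψle : ∀ t ∈ Set.Icc (0 : ℝ) r, (φ t)⁻¹ ≤ (φ 0)⁻¹ + κ / 2 * t ^ 2 := by
    have hanti : AntitoneOn (fun t => (φ t)⁻¹ - κ / 2 * t ^ 2) (Set.Icc 0 r) := by
      refine antitoneOn_of_hasDerivWithinAt_nonpos (f' := fun t => ψ' t - κ * t) (convex_Icc _ _)
        (fun t ht => ?_) (fun t ht => ?_) (fun t ht => ?_)
      · exact ((hψ t (habs t (hsub ht))).continuousAt.sub (by fun_prop)).continuousWithinAt
      · have := (hψ t (habs t (hsub (interior_subset ht)))).sub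
          ((hasDerivAt_pow 2 t).const_mul (κ / 2))
        refine HasDerivAt.hasDerivWithinAt (this.congr_deriv ?_)
        simp
        ring
      · have := hψ'le t (interior_subset ht)
        linarith
    intro t ht
    have := hanti (Set.left_mem_Icc.2 hr.le) ht ht.1
    simp only [ne_eq, OfNat.ofNat_ne_zero, not_false_eq_true, zero_pow, mul_zero, sub_zero] at this
    linarith
  have hmono : MonotoneOn f' (Set.Icc (-r) r) := by
    refine monotoneOn_of_hasDerivWithinAt_nonneg (f' := φ) (convex_Icc _ _)
      (fun t ht => (hf' t (habs t ht)).continuousAt.continuousWithinAt)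
      (fun t ht => (hf' t (habs t (interior_subset ht))).hasDerivWithinAt)
      (fun t ht => (hφ t (habs t (interior_subset ht))).le)
  -- The natural length scale: on [0, σ] the function 1/φ grows at most by the factor 1 + κ/2, so φ
  -- remains comparable to φ 0.
  set σ := (√(φ 0))⁻¹ with hσ
  have hsq : 0 < √(φ 0) := Real.sqrt_pos.2 hφ0
  have hσ0 : 0 < σ := inv_pos.2 hsq
  have hσ2 : σ ^ 2 = (φ 0)⁻¹ := by rw [hσ, inv_pow, Real.sq_sqrt hφ0.le]
  have hnn : 0 ≤ (4 * B * (1 + κ / 2) / r) ^ 2 := sq_nonneg _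
  -- A long scale σ already means φ 0 ≤ 4/r². Otherwise at least half of [0, r] remains to the right
  -- of σ.
  by_cases hcase : r / 2 ≤ σ
  · have h1 : (r / 2) ^ 2 ≤ (φ 0)⁻¹ := by rw [← hσ2]; gcongr
    have h2 : φ 0 ≤ ((r / 2) ^ 2)⁻¹ := by
      rw [← inv_inv (φ 0)]
      exact inv_anti₀ (by positivity) h1
    have h3 : ((r / 2) ^ 2)⁻¹ = 4 / r ^ 2 := by field_simp; norm_num
    linarith
  · push Not at hcase
    have hσmem : σ ∈ Set.Icc (0 : ℝ) r := ⟨hσ0.le, by linarith⟩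
    set J := √(φ 0) / (1 + κ / 2) with hJ
    have hJ0 : 0 < J := by positivity
    have hjump : J ≤ f' σ - f' 0 := by
      obtain ⟨ξ, hξ, he⟩ := exists_hasDerivAt_eq_slope f' φ hσ0
        (fun t ht => (hf' t (habs t (hsub ⟨ht.1, ht.2.trans hσmem.2⟩))).continuousAt.continuousWithinAt)
        (fun t ht => hf' t (habs t (hsub ⟨ht.1.le, ht.2.le.trans hσmem.2⟩)))
      have hξm : ξ ∈ Set.Icc (0 : ℝ) r := ⟨hξ.1.le, hξ.2.le.trans hσmem.2⟩
      have h1 := hψle ξ hξm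
      have h2 : (φ ξ)⁻¹ ≤ σ ^ 2 * (1 + κ / 2) := by
        have : ξ ^ 2 ≤ σ ^ 2 := by
          have := hξ.1.le; have := hξ.2.le
          gcongr
        rw [← hσ2] at h1
        nlinarith
      have h3 : (σ ^ 2 * (1 + κ / 2))⁻¹ ≤ φ ξ := by
        rw [← inv_inv (φ ξ)]
        exact inv_anti₀ (inv_pos.2 (hφ ξ (habs ξ (hsub hξm)))) h2
      rw [sub_zero, eq_div_iff hσ0.ne'] at he
      rw [← he]
      calc J = (σ ^ 2 * (1 + κ / 2))⁻¹ * σ := by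
            rw [hJ, hσ]
            field_simp
        _ ≤ φ ξ * σ := by gcongr
    -- A slope jump J forces slope at least J/2 to the right of σ or at most -J/2 to the left of 0.
    -- Monotonicity of f' keeps it so over a length at least r/2, where f can change by at most `B`.
    have hJB : J * r ≤ 4 * B := by
      by_cases hc : J / 2 ≤ f' σ
      · have hlt : σ < r := by linarith
        obtain ⟨ξ, hξ, he⟩ := exists_hasDerivAt_eq_slope f f' hlt
          (fun t ht => (hf t (habs t (hsub ⟨hσ0.le.trans ht.1, ht.2⟩))).continuousAt.continuousWithinAt)
          (fun t ht => hf t (habs t (hsub ⟨hσ0.le.trans ht.1.le, ht.2.le⟩)))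
        have h1 : f' σ ≤ f' ξ := hmono (hsub hσmem)
          (hsub ⟨hσ0.le.trans hξ.1.le, hξ.2.le⟩) hξ.1.le
        rw [eq_div_iff (by linarith)] at he
        have h2 := hB r (by rw [abs_of_pos hr])
        have h3 := h0 σ (habs σ (hsub hσmem))
        have h4 : J / 2 * (r / 2) ≤ f' ξ * (r - σ) := by
          apply mul_le_mul (by linarith) (by linarith) (by linarith) (by linarith)
        linarith
      · have hneg : f' 0 ≤ -(J / 2) := by linarith
        obtain ⟨ξ, hξ, he⟩ := exists_hasDerivAt_eq_slope f f' (show -r < 0 by linarith)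
          (fun t ht => (hf t (habs t ⟨ht.1, by linarith [ht.2]⟩)).continuousAt.continuousWithinAt)
          (fun t ht => hf t (habs t ⟨ht.1.le, by linarith [ht.2]⟩))
        have h1 : f' ξ ≤ f' 0 := hmono ⟨hξ.1.le, by linarith [hξ.2]⟩ ⟨by linarith, hr.le⟩ hξ.2.le
        rw [eq_div_iff (by linarith)] at he
        have h2 := hB (-r) (by rw [abs_neg, abs_of_pos hr])
        have h3 := h0 0 h00
        have h4 : J / 2 * r ≤ -f' ξ * r := by
          apply mul_le_mul_of_nonneg_right (by linarith) hr.le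
        nlinarith
    have h5 : √(φ 0) ≤ 4 * B * (1 + κ / 2) / r := by
      rw [le_div_iff₀ hr]
      have : √(φ 0) = J * (1 + κ / 2) := by rw [hJ]; field_simp
      rw [this]
      nlinarith
    have h6 : φ 0 ≤ (4 * B * (1 + κ / 2) / r) ^ 2 := by
      rw [← Real.sq_sqrt hφ0.le]
      gcongr
    have : 0 ≤ 4 / r ^ 2 := by positivity
    linarith

/-- The reflection t ↦ -t reverses the sign of ψ' at 0, so the sign condition of the auxiliary
version can be dropped. -/
theorem second_deriv_le_of_room {f f' φ ψ' ψ'' : ℝ → ℝ} {r B κ : ℝ} (hr : 0 < r) (hκ : 0 ≤ κ)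
    (hf : ∀ t, |t| ≤ r → HasDerivAt f (f' t) t) (hf' : ∀ t, |t| ≤ r → HasDerivAt f' (φ t) t)
    (hφ : ∀ t, |t| ≤ r → 0 < φ t)
    (hψ : ∀ t, |t| ≤ r → HasDerivAt (fun t => (φ t)⁻¹) (ψ' t) t)
    (hψ' : ∀ t, |t| ≤ r → HasDerivAt ψ' (ψ'' t) t) (hle : ∀ t, |t| ≤ r → ψ'' t ≤ κ)
    (h0 : ∀ t, |t| ≤ r → 0 ≤ f t) (hB : ∀ t, |t| ≤ r → f t ≤ B) :
    φ 0 ≤ 4 / r ^ 2 + (4 * B * (1 + κ / 2) / r) ^ 2 := by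
  rcases le_total (ψ' 0) 0 with h | h
  · exact second_deriv_le_of_room_aux hr hκ hf hf' hφ hψ hψ' hle h0 hB h
  · have hn : ∀ t : ℝ, |t| ≤ r → |-t| ≤ r := fun t ht => by rwa [abs_neg]
    have hc : ∀ {F : ℝ → ℝ} {d t : ℝ}, HasDerivAt F d (-t) →
        HasDerivAt (fun t => F (-t)) (-d) t := fun {F d t} hF =>
      (hF.comp t (hasDerivAt_neg t)).congr_deriv (by simp)
    have := second_deriv_le_of_room_aux (f := fun t => f (-t)) (f' := fun t => -f' (-t))
      (φ := fun t => φ (-t)) (ψ' := fun t => -ψ' (-t)) (ψ'' := fun t => ψ'' (-t)) hr hκ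
      (fun t ht => hc (hf _ (hn t ht)))
      (fun t ht => (hc (hf' _ (hn t ht))).neg.congr_deriv (by simp))
      (fun t ht => hφ _ (hn t ht)) (fun t ht => hc (hψ _ (hn t ht)))
      (fun t ht => (hc (hψ' _ (hn t ht))).neg.congr_deriv (by simp))
      (fun t ht => hle _ (hn t ht)) (fun t ht => h0 _ (hn t ht)) (fun t ht => hB _ (hn t ht))
      (by simpa using h)
    simpa using this

namespace StrictConvexSmoothOn

variable {u : Plane → ℝ} {Ω : Set Plane} {x : Plane} (H : StrictConvexSmoothOn u Ω)

include H

theorem inv_d2_smooth {a : Plane} (ha : a ≠ 0) : ContDiffOn ℝ ∞ (fun z => (d2 u a a z)⁻¹) Ω :=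
  (H.d2_smooth a a).inv fun _ hz => (H.d2_pos hz ha).ne'

theorem diag_smooth {a b : Plane} (hab : a 0 * b 1 - a 1 * b 0 ≠ 0) (v w : Plane) :
    ContDiffOn ℝ ∞ (fun z => d2 u v w z / hessDet u a b z) Ω := by
  refine (H.d2_smooth v w).div ?_ fun z hz => (H.hessDet_pos hz hab).ne'
  exact ((H.d2_smooth a a).mul (H.d2_smooth b b)).sub ((H.d2_smooth a b).pow 2)

/-- For b Hessian-orthogonal to a at x, the inverse entry u_bb / det is at least 1/u_aa nearby, with
equality at x. The difference has a minimum along a at x, so the second derivative of 1/u_aa is at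
most that of the inverse entry, which curvature bounds by 4C because the correlation vanishes at x.
-/
theorem d2_inv_le {C : ℝ} (hC : ∀ y, base y ∈ Ω → rmNorm (toricMetric u) y ≤ C) (hx : x ∈ Ω)
    {a : Plane} (ha : a ≠ 0) : d2 (fun z => (d2 u a a z)⁻¹) a a x ≤ 4 * C := by
  obtain ⟨b, hab, hr⟩ : ∃ b : Plane, a 0 * b 1 - a 1 * b 0 ≠ 0 ∧ d2 u a b x = 0 := by
    -- The witness is the Hessian applied to a, turned by a right angle; its determinant with a is
    -- u_aa.
    refine ⟨!₂[-(a 0 * hessFun u 0 1 x + a 1 * hessFun u 1 1 x),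
      a 0 * hessFun u 0 0 x + a 1 * hessFun u 0 1 x], ?_, ?_⟩
    · have := H.d2_pos hx ha
      rw [H.d2_eq hx] at this
      simp
      intro h
      apply this.ne'
      linear_combination h
    · rw [H.d2_eq hx]
      simp
      ring
  have hb : b ≠ 0 := by
    rintro rfl
    simp at hab
  have hpa := H.d2_pos hx ha
  have hpb := H.d2_pos hx hb
  have h := (abs_le.1 (H.abs_d2_diag_le hC hx hab)).2
  have hdet : hessDet u a b x = d2 u a a x * d2 u b b x := by rw [hessDet, hr]; ring
  rw [hdet, div_self (by positivity), mul_one] at h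
  refine le_trans ?_ h
  set F := fun z => (d2 u a a z)⁻¹ with hF
  set G := fun z => d2 u b b z / hessDet u a b z with hG
  have sF : ContDiffOn ℝ ∞ F Ω := H.inv_d2_smooth ha
  have sG : ContDiffOn ℝ ∞ G Ω := H.diag_smooth hab b b
  have hcont : Filter.Tendsto (fun t : ℝ => x + t • a) (nhds 0) (nhds x) := by
    have : Continuous fun t : ℝ => x + t • a := by fun_prop
    simpa using this.tendsto 0
  have hev := hcont.eventually (H.isOpen.mem_nhds hx)
  have e0 : x + (0 : ℝ) • a = x := by simp
  have key := deriv_deriv_nonneg_of_isLocalMin (a := 0)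
    (f := fun t : ℝ => G (x + t • a) - F (x + t • a))
    (f' := fun t : ℝ => dirD a G (x + t • a) - dirD a F (x + t • a))
    (f'' := d2 G a a x - d2 F a a x)
    (hev.mono fun t ht => (hasDerivAt_line (differentiableAt_of_smooth H.isOpen sG ht)).sub
      (hasDerivAt_line (differentiableAt_of_smooth H.isOpen sF ht)))
    (by
      have h1 := hasDerivAt_line (x := x) (v := a) (t := 0) (differentiableAt_of_smooth H.isOpen
        (dirD_contDiffOn H.isOpen sG a) (by rwa [e0]))
      have h2 := hasDerivAt_line (x := x) (v := a) (t := 0) (differentiableAt_of_smooth H.isOpen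
        (dirD_contDiffOn H.isOpen sF a) (by rwa [e0]))
      rw [e0] at h1 h2
      exact h1.sub h2)
    (by
      have hz : G x - F x = 0 := by
        simp only [hG, hF, hdet]
        field_simp
        ring
      filter_upwards [hev] with t ht
      simp only [e0, hz]
      have p1 := H.d2_pos ht ha
      have p2 := H.d2_pos ht hb
      have p3 := H.hessDet_pos ht hab
      simp only [hG, hF]
      rw [sub_nonneg, inv_eq_one_div, div_le_div_iff₀ p1 p3, hessDet]
      nlinarith [sq_nonneg (d2 u a b (x + t • a))])
  linarith

theorem d2_le_of_room {C B r : ℝ} (hr : 0 < r)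
    (hC : ∀ y, base y ∈ Ω → rmNorm (toricMetric u) y ≤ C) {v : Plane} (hv : v ≠ 0)
    (hx : ∀ t : ℝ, |t| ≤ r → x + t • v ∈ Ω) (h0 : ∀ t : ℝ, |t| ≤ r → 0 ≤ u (x + t • v))
    (hB : ∀ t : ℝ, |t| ≤ r → u (x + t • v) ≤ B) :
    d2 u v v x ≤ 4 / r ^ 2 + (4 * B * (1 + 4 * C / 2) / r) ^ 2 := by
  have hx0 : x ∈ Ω := by simpa using hx 0 (by simpa using hr.le)
  have hC0 : 0 ≤ C := (Real.sqrt_nonneg _).trans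
    (hC (Sum.elim (fun i => x i) 0) (by rwa [base_elim]))
  have sψ := H.inv_d2_smooth hv
  have := second_deriv_le_of_room (f := fun t => u (x + t • v))
    (f' := fun t => dirD v u (x + t • v)) (φ := fun t => d2 u v v (x + t • v))
    (ψ' := fun t => dirD v (fun z => (d2 u v v z)⁻¹) (x + t • v))
    (ψ'' := fun t => d2 (fun z => (d2 u v v z)⁻¹) v v (x + t • v)) hr
    (show 0 ≤ 4 * C by positivity)
    (fun t ht => hasDerivAt_line (differentiableAt_of_smooth H.isOpen H.smooth (hx t ht)))
    (fun t ht => hasDerivAt_line (differentiableAt_of_smooth H.isOpen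
      (dirD_contDiffOn H.isOpen H.smooth v) (hx t ht)))
    (fun t ht => H.d2_pos (hx t ht) hv)
    (fun t ht => hasDerivAt_line (F := fun z => (d2 u v v z)⁻¹)
      (differentiableAt_of_smooth H.isOpen sψ (hx t ht)))
    (fun t ht => hasDerivAt_line (differentiableAt_of_smooth H.isOpen
      (dirD_contDiffOn H.isOpen sψ v) (hx t ht)))
    (fun t ht => H.d2_inv_le hC (hx t ht) hv) h0 hB
  simpa using this

end StrictConvexSmoothOn
end ToricSurface

/-! ### Two calculus estimates with boundary data given as limits. -/

namespace ToricSurface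

open Filter Topology

/-- Lower bound for a function with slope `2` at `0` and bounded second derivative. -/
theorem two_mul_sub_le_of_second_deriv {h h' h'' : ℝ → ℝ} {κ S : ℝ} (hS : 0 < S)
    (hh : ∀ s ∈ Set.Ioc 0 S, HasDerivAt h (h' s) s)
    (hh' : ∀ s ∈ Set.Ioc 0 S, HasDerivAt h' (h'' s) s)
    (hb : ∀ s ∈ Set.Ioc 0 S, -(2 * κ) ≤ h'' s)
    (hlim : Tendsto (fun s => h s / s) (𝓝[>] 0) (𝓝 2)) : 2 * S - κ * S ^ 2 ≤ h S := by
  set k : ℝ → ℝ := fun s => h s + κ * s ^ 2 with hk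
  have hconv : ConvexOn ℝ (Set.Ioc 0 S) k := by
    refine convexOn_of_hasDerivWithinAt2_nonneg (f' := fun s => h' s + κ * (2 * s))
      (f'' := fun s => h'' s + κ * 2) (convex_Ioc _ _) (fun s hs => ?_) (fun s hs => ?_)
      (fun s hs => ?_) (fun s hs => ?_)
    · exact ((hh s hs).continuousAt.add (by fun_prop)).continuousWithinAt
    · have hs' := interior_subset hs
      refine HasDerivAt.hasDerivWithinAt (((hh s hs').add
        ((hasDerivAt_pow 2 s).const_mul κ)).congr_deriv ?_)
      simp
    · have hs' := interior_subset hs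
      refine HasDerivAt.hasDerivWithinAt (((hh' s hs').add
        (((hasDerivAt_id s).const_mul 2).const_mul κ)).congr_deriv ?_)
      simp
    · have := hb s (interior_subset hs)
      linarith
  have hid : Tendsto (fun s : ℝ => s) (𝓝[>] 0) (𝓝 0) := tendsto_nhdsWithin_of_tendsto_nhds tendsto_id
  have hkl : Tendsto (fun s => k s / s) (𝓝[>] 0) (𝓝 2) := by
    have h1 : Tendsto (fun s : ℝ => h s / s + κ * s) (𝓝[>] 0) (𝓝 (2 + κ * 0)) :=
      hlim.add (hid.const_mul κ)
    rw [mul_zero, add_zero] at h1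
    refine h1.congr' ?_
    filter_upwards [self_mem_nhdsWithin] with s hs
    have : s ≠ 0 := (Set.mem_Ioi.1 hs).ne'
    simp only [hk]
    field_simp
  have hk0 : Tendsto k (𝓝[>] 0) (𝓝 0) := by
    have h1 := hkl.mul hid
    rw [mul_zero] at h1
    refine h1.congr' ?_
    filter_upwards [self_mem_nhdsWithin] with s hs
    have : s ≠ 0 := (Set.mem_Ioi.1 hs).ne'
    field_simp
  have hhalf : Tendsto (fun s : ℝ => s / 2) (𝓝[>] 0) (𝓝[>] 0) := by
    refine tendsto_nhdsWithin_iff.2 ⟨?_, ?_⟩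
    · simpa using hid.div_const 2
    · filter_upwards [self_mem_nhdsWithin] with s hs
      exact half_pos (Set.mem_Ioi.1 hs)
  -- No derivative at 0 is available. The slope of the convex function k over [s/2, s] replaces it:
  -- it equals 2·k(s)/s - k(s/2)/(s/2) and so tends to 2.
  have hl : Tendsto (fun s => (k s - k (s / 2)) / (s - s / 2)) (𝓝[>] 0) (𝓝 2) := by
    have h1 := (hkl.const_mul 2).sub (hkl.comp hhalf)
    norm_num at h1
    refine h1.congr' ?_
    filter_upwards [self_mem_nhdsWithin] with s hs
    have : s ≠ 0 := (Set.mem_Ioi.1 hs).ne'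
    have : s - s / 2 ≠ 0 := by
      rw [sub_half]; positivity
    field_simp
    ring
  have hr : Tendsto (fun s => (k S - k s) / (S - s)) (𝓝[>] 0) (𝓝 ((k S - 0) / (S - 0))) :=
    (tendsto_const_nhds.sub hk0).div (tendsto_const_nhds.sub hid) (by simpa using hS.ne')
  have hle : 2 ≤ (k S - 0) / (S - 0) := by
    refine le_of_tendsto_of_tendsto hl hr ?_
    filter_upwards [Ioo_mem_nhdsGT hS] with s hs
    exact hconv.slope_mono_adjacent ⟨half_pos hs.1, by linarith [hs.1, hs.2]⟩
      ⟨hS, le_rfl⟩ (by linarith [hs.1]) hs.2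
  rw [sub_zero, sub_zero, le_div_iff₀ hS] at hle
  simp only [hk] at hle
  linarith

/-- A function of two variables that vanishes on both axes is controlled by its mixed second
derivative. -/
theorem abs_le_of_mixed_deriv {b b₂ b₁₂ : ℝ → ℝ → ℝ} {M S T : ℝ} (hS : 0 < S) (hT : 0 < T)
    (h2 : ∀ s ∈ Set.Ioc 0 S, ∀ t ∈ Set.Ioc 0 T, HasDerivAt (fun t => b s t) (b₂ s t) t)
    (h12 : ∀ s ∈ Set.Ioc 0 S, ∀ t ∈ Set.Ioc 0 T, HasDerivAt (fun s => b₂ s t) (b₁₂ s t) s)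
    (hM : ∀ s ∈ Set.Ioc 0 S, ∀ t ∈ Set.Ioc 0 T, |b₁₂ s t| ≤ M)
    (hs0 : Tendsto (fun s => b s T) (𝓝[>] 0) (𝓝 0))
    (ht0 : ∀ s ∈ Set.Ioc 0 S, Tendsto (fun t => b s t) (𝓝[>] 0) (𝓝 0)) :
    |b S T| ≤ M * S * T := by
  have hM0 : 0 ≤ M := (abs_nonneg _).trans (hM S ⟨hS, le_rfl⟩ T ⟨hT, le_rfl⟩)
  have hSm : S ∈ Set.Ioc 0 S := ⟨hS, le_rfl⟩
  have hTm : T ∈ Set.Ioc 0 T := ⟨hT, le_rfl⟩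
  have e1 : ∀ s ∈ Set.Ioo 0 S, ∀ t ∈ Set.Ioc 0 T, |b₂ S t - b₂ s t| ≤ M * S := by
    intro s hs t ht
    have := Convex.norm_image_sub_le_of_norm_hasDerivWithin_le (f := fun s => b₂ s t)
      (f' := fun s => b₁₂ s t) (s := Set.Ioc 0 S) (C := M) (x := s) (y := S)
      (fun z hz => (h12 z hz t ht).hasDerivWithinAt) (fun z hz => hM z hz t ht) (convex_Ioc _ _)
      ⟨hs.1, hs.2.le⟩ hSm
    simp only [Real.norm_eq_abs] at this
    refine this.trans ?_
    rw [abs_of_pos (by linarith [hs.2])]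
    nlinarith [hs.1]
  -- The double difference over a rectangle is bounded by two applications of the mean value
  -- inequality. Letting t and then s tend to 0 removes the three corners on the axes.
  have e2 : ∀ s ∈ Set.Ioo 0 S, ∀ t ∈ Set.Ioo 0 T,
      |(b S T - b s T) - (b S t - b s t)| ≤ M * S * T := by
    intro s hs t ht
    have hs' : s ∈ Set.Ioc 0 S := ⟨hs.1, hs.2.le⟩
    have := Convex.norm_image_sub_le_of_norm_hasDerivWithin_le (f := fun t => b S t - b s t)
      (f' := fun t => b₂ S t - b₂ s t) (s := Set.Ioc 0 T) (C := M * S) (x := t) (y := T)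
      (fun z hz => ((h2 S hSm z hz).sub (h2 s hs' z hz)).hasDerivWithinAt)
      (fun z hz => e1 s hs z hz) (convex_Ioc _ _) ⟨ht.1, ht.2.le⟩ hTm
    simp only [Real.norm_eq_abs] at this
    refine this.trans ?_
    rw [abs_of_pos (by linarith [ht.2])]
    have : 0 ≤ M * S := by positivity
    nlinarith [ht.1]
  have e3 : ∀ s ∈ Set.Ioo 0 S, |b S T - b s T| ≤ M * S * T := by
    intro s hs
    have hl : Tendsto (fun t => |(b S T - b s T) - (b S t - b s t)|) (𝓝[>] 0)
        (𝓝 |(b S T - b s T) - (0 - 0)|) :=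
      (tendsto_const_nhds.sub ((ht0 S hSm).sub (ht0 s ⟨hs.1, hs.2.le⟩))).abs
    rw [sub_zero, sub_zero] at hl
    refine le_of_tendsto hl ?_
    filter_upwards [Ioo_mem_nhdsGT hT] with t ht using e2 s hs t ht
  have hl : Tendsto (fun s => |b S T - b s T|) (𝓝[>] 0) (𝓝 |b S T - 0|) :=
    (tendsto_const_nhds.sub hs0).abs
  rw [sub_zero] at hl
  refine le_of_tendsto hl ?_
  filter_upwards [Ioo_mem_nhdsGT hS] with s hs using e3 s hs

end ToricSurface

/-! ### Corner charts and the first-failure argument for the correlation. -/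

namespace ToricSurface

open Filter Topology

/-- The point with coordinates `(s, t)` in the affine frame `(w; a, b)`. -/
noncomputable def framePt (w a b : Plane) (s t : ℝ) : Plane := w + s • a + t • b

theorem framePt_swap (w a b : Plane) (s t : ℝ) : framePt w b a t s = framePt w a b s t := by
  unfold framePt
  abel

theorem framePt_eq (w a b : Plane) (s t : ℝ) : framePt w a b s t = (w + t • b) + s • a := by
  unfold framePt
  abel

/-- The Hessian of `u` in an affine frame has the Guillemin form on the rectangle
`(0, δ] × (0, y]`: it is `diag (1 / (2 s), 1 / (2 t))` plus continuous terms. -/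
structure CornerChart (u : Plane → ℝ) (Ω : Set Plane) (w a b : Plane) (δ y : ℝ)
    (A B D : ℝ → ℝ → ℝ) : Prop where
  det : a 0 * b 1 - a 1 * b 0 ≠ 0
  mem : ∀ s ∈ Set.Ioc 0 δ, ∀ t ∈ Set.Ioc 0 y, framePt w a b s t ∈ Ω
  contA : ContinuousOn (fun z : ℝ × ℝ => A z.1 z.2) (Set.Icc 0 δ ×ˢ Set.Icc 0 y)
  contB : ContinuousOn (fun z : ℝ × ℝ => B z.1 z.2) (Set.Icc 0 δ ×ˢ Set.Icc 0 y)
  contD : ContinuousOn (fun z : ℝ × ℝ => D z.1 z.2) (Set.Icc 0 δ ×ˢ Set.Icc 0 y)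
  d2_aa : ∀ s ∈ Set.Ioc 0 δ, ∀ t ∈ Set.Ioc 0 y,
    d2 u a a (framePt w a b s t) = 1 / (2 * s) + A s t
  d2_ab : ∀ s ∈ Set.Ioc 0 δ, ∀ t ∈ Set.Ioc 0 y, d2 u a b (framePt w a b s t) = B s t
  d2_bb : ∀ s ∈ Set.Ioc 0 δ, ∀ t ∈ Set.Ioc 0 y,
    d2 u b b (framePt w a b s t) = 1 / (2 * t) + D s t
  posA : ∀ s ∈ Set.Icc 0 δ, 0 < 1 + 2 * s * A s 0
  posD : ∀ t ∈ Set.Icc 0 y, 0 < 1 + 2 * t * D 0 t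

namespace CornerChart

variable {u : Plane → ℝ} {Ω : Set Plane} {w a b : Plane} {δ y : ℝ} {A B D : ℝ → ℝ → ℝ}

theorem swap (K : CornerChart u Ω w a b δ y A B D) (H : StrictConvexSmoothOn u Ω) :
    CornerChart u Ω w b a y δ (fun t s => D s t) (fun t s => B s t) (fun t s => A s t) where
  det h := K.det (by linear_combination -h)
  mem t ht s hs := by rw [framePt_swap]; exact K.mem s hs t ht
  contA := K.contD.comp continuous_swap.continuousOn fun z hz => ⟨hz.2, hz.1⟩
  contB := K.contB.comp continuous_swap.continuousOn fun z hz => ⟨hz.2, hz.1⟩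
  contD := K.contA.comp continuous_swap.continuousOn fun z hz => ⟨hz.2, hz.1⟩
  d2_aa t ht s hs := by rw [framePt_swap]; exact K.d2_bb s hs t ht
  d2_ab t ht s hs := by
    rw [framePt_swap, H.d2_symm (K.mem s hs t ht)]
    exact K.d2_ab s hs t ht
  d2_bb t ht s hs := by rw [framePt_swap]; exact K.d2_aa s hs t ht
  posA := K.posD
  posD := K.posA

variable (K : CornerChart u Ω w a b δ y A B D) (H : StrictConvexSmoothOn u Ω)

include K in
theorem ne_zero : a ≠ 0 ∧ b ≠ 0 := by
  have := K.det
  constructor <;> rintro rfl <;> simp at this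

include K H in
-- This quantity is 2s·u_aa off the axes and extends continuously to them. It equals 1 at s = 0, and
-- at t = 0 its positivity is the non-degeneracy `posA` of u along the edge.
theorem pos_left {s t : ℝ} (hs : s ∈ Set.Icc 0 δ) (ht : t ∈ Set.Icc 0 y) :
    0 < 1 + 2 * s * A s t := by
  rcases hs.1.eq_or_lt with rfl | hs0
  · simp
  rcases ht.1.eq_or_lt with rfl | ht0
  · exact K.posA s hs
  have h := H.d2_pos (K.mem s ⟨hs0, hs.2⟩ t ⟨ht0, ht.2⟩) K.ne_zero.1
  rw [K.d2_aa s ⟨hs0, hs.2⟩ t ⟨ht0, ht.2⟩] at h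
  have : 1 + 2 * s * A s t = 2 * s * (1 / (2 * s) + A s t) := by field_simp
  rw [this]
  positivity

include K H in
theorem pos_right {s t : ℝ} (hs : s ∈ Set.Icc 0 δ) (ht : t ∈ Set.Icc 0 y) :
    0 < 1 + 2 * t * D s t :=
  (K.swap H).pos_left H ht hs

include K in
theorem hessDet_eq {s t : ℝ} (hs : s ∈ Set.Ioc 0 δ) (ht : t ∈ Set.Ioc 0 y) :
    hessDet u a b (framePt w a b s t) =
      ((1 + 2 * s * A s t) * (1 + 2 * t * D s t) - 4 * s * t * B s t ^ 2) / (4 * s * t) := by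
  have := hs.1; have := ht.1
  rw [hessDet, K.d2_aa s hs t ht, K.d2_ab s hs t ht, K.d2_bb s hs t ht]
  field_simp
  ring

include K H in
theorem num_pos {s t : ℝ} (hs : s ∈ Set.Ioc 0 δ) (ht : t ∈ Set.Ioc 0 y) :
    0 < (1 + 2 * s * A s t) * (1 + 2 * t * D s t) - 4 * s * t * B s t ^ 2 := by
  have h := H.hessDet_pos (K.mem s hs t ht) K.det
  have := hs.1; have := ht.1
  rw [K.hessDet_eq hs ht] at h
  exact (div_pos_iff_of_pos_right (by positivity)).1 h

include K H in
-- After division by 4st the hypothesis reads 2 u_ab² ≤ u_aa u_bb, that is ρ² ≤ 1/2, and the ratio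
-- is 1 / (1 - ρ²).
theorem ratio_le {s t : ℝ} (hs : s ∈ Set.Ioc 0 δ) (ht : t ∈ Set.Ioc 0 y)
    (hZ : 8 * s * t * B s t ^ 2 ≤ (1 + 2 * s * A s t) * (1 + 2 * t * D s t)) :
    d2 u a a (framePt w a b s t) * d2 u b b (framePt w a b s t) /
      hessDet u a b (framePt w a b s t) ≤ 2 := by
  have hN := K.num_pos H hs ht
  have := hs.1; have := ht.1
  rw [K.hessDet_eq hs ht, K.d2_aa s hs t ht, K.d2_bb s hs t ht]
  have e : (1 / (2 * s) + A s t) * (1 / (2 * t) + D s t) =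
      (1 + 2 * s * A s t) * (1 + 2 * t * D s t) / (4 * s * t) := by
    field_simp
    ring
  rw [e, div_div_div_cancel_right₀ (by positivity), div_le_iff₀ hN]
  linarith

theorem tendsto_left {F : ℝ → ℝ → ℝ}
    (hF : ContinuousOn (fun z : ℝ × ℝ => F z.1 z.2) (Set.Icc 0 δ ×ˢ Set.Icc 0 y))
    (hδ : 0 < δ) {t : ℝ} (ht : t ∈ Set.Icc 0 y) :
    Tendsto (fun s => F s t) (𝓝[>] 0) (𝓝 (F 0 t)) := by
  have h : Tendsto (fun z : ℝ × ℝ => F z.1 z.2) (𝓝[Set.Icc 0 δ ×ˢ Set.Icc 0 y] (0, t))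
      (𝓝 (F 0 t)) := hF (0, t) ⟨⟨le_rfl, hδ.le⟩, ht⟩
  have g : Tendsto (fun s : ℝ => (s, t)) (𝓝[>] 0) (𝓝[Set.Icc 0 δ ×ˢ Set.Icc 0 y] (0, t)) := by
    refine tendsto_nhdsWithin_iff.2 ⟨?_, ?_⟩
    · exact tendsto_nhdsWithin_of_tendsto_nhds
        ((continuous_id.prodMk continuous_const).tendsto' 0 (0, t) rfl)
    · filter_upwards [Ioo_mem_nhdsGT hδ] with s hs
      exact ⟨⟨hs.1.le, hs.2.le⟩, ht⟩
  exact h.comp g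

include K H in
-- The boundary behaviour of the inverse entry u^aa: the singular term 1/(2s) of u_aa makes it
-- vanish like 2s.
theorem tendsto_diag_div (hδ : 0 < δ) {t : ℝ} (ht : t ∈ Set.Ioc 0 y) :
    Tendsto (fun s => d2 u b b (framePt w a b s t) / hessDet u a b (framePt w a b s t) / s)
      (𝓝[>] 0) (𝓝 2) := by
  have ht' : t ∈ Set.Icc 0 y := ⟨ht.1.le, ht.2⟩
  have hid : Tendsto (fun s : ℝ => s) (𝓝[>] 0) (𝓝 0) := tendsto_nhdsWithin_of_tendsto_nhds tendsto_id
  have hA := tendsto_left K.contA hδ ht'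
  have hB := tendsto_left K.contB hδ ht'
  have hD := tendsto_left K.contD hδ ht'
  have hQ := (hD.const_mul (2 * t)).const_add 1
  have hP := ((hid.const_mul 2).mul hA).const_add 1
  have hQ0 := K.pos_right H ⟨le_rfl, hδ.le⟩ ht'
  have hl := (hQ.const_mul 2).div ((hP.mul hQ).sub (((hid.const_mul 4).mul_const t).mul (hB.pow 2)))
    (by simpa using hQ0.ne')
  have e : 2 * (1 + 2 * t * D 0 t) / ((1 + 2 * 0 * A 0 t) * (1 + 2 * t * D 0 t) -
      4 * 0 * t * B 0 t ^ 2) = 2 := by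
    rw [div_eq_iff (by simpa using hQ0.ne')]
    ring
  rw [e] at hl
  refine hl.congr' ?_
  filter_upwards [Ioo_mem_nhdsGT hδ] with s hs
  have hs' : s ∈ Set.Ioc 0 δ := ⟨hs.1, hs.2.le⟩
  have hN := K.num_pos H hs' ht
  have := hs.1; have := ht.1
  rw [K.hessDet_eq hs' ht, K.d2_bb s hs' t ht]
  have e2 : 1 / (2 * t) + D s t = (1 + 2 * t * D s t) / (2 * t) := by field_simp
  simp only [Pi.div_apply]
  rw [e2]
  generalize (1 + 2 * s * A s t) * (1 + 2 * t * D s t) - 4 * s * t * B s t ^ 2 = N at *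
  generalize 1 + 2 * t * D s t = Q at *
  field_simp
  ring

include K H in
-- At fixed t > 0 the determinant blows up like 1/s while u_ab stays bounded.
theorem tendsto_offDiag (hδ : 0 < δ) {t : ℝ} (ht : t ∈ Set.Ioc 0 y) :
    Tendsto (fun s => -d2 u a b (framePt w a b s t) / hessDet u a b (framePt w a b s t))
      (𝓝[>] 0) (𝓝 0) := by
  have ht' : t ∈ Set.Icc 0 y := ⟨ht.1.le, ht.2⟩
  have hid : Tendsto (fun s : ℝ => s) (𝓝[>] 0) (𝓝 0) := tendsto_nhdsWithin_of_tendsto_nhds tendsto_id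
  have hA := tendsto_left K.contA hδ ht'
  have hB := tendsto_left K.contB hδ ht'
  have hD := tendsto_left K.contD hδ ht'
  have hQ := (hD.const_mul (2 * t)).const_add 1
  have hP := ((hid.const_mul 2).mul hA).const_add 1
  have hQ0 := K.pos_right H ⟨le_rfl, hδ.le⟩ ht'
  have hl := (((hid.const_mul 4).mul_const t).mul hB.neg).div
    ((hP.mul hQ).sub (((hid.const_mul 4).mul_const t).mul (hB.pow 2))) (by simpa using hQ0.ne')
  rw [mul_zero, zero_mul, zero_mul, zero_div] at hl
  refine hl.congr' ?_
  filter_upwards [Ioo_mem_nhdsGT hδ] with s hs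
  have hs' : s ∈ Set.Ioc 0 δ := ⟨hs.1, hs.2.le⟩
  have hN := K.num_pos H hs' ht
  have := hs.1; have := ht.1
  rw [K.hessDet_eq hs' ht, K.d2_ab s hs' t ht]
  simp only [Pi.div_apply]
  field_simp

include K H in
-- Along the horizontal segment the entry starts with slope 2, and its second derivative is at most
-- 4C · 2 in absolute value because the ratio is at most 2.
theorem diag_lower {C S T : ℝ} (hC : ∀ y, base y ∈ Ω → rmNorm (toricMetric u) y ≤ C)
    (hS : S ∈ Set.Ioc 0 δ) (hT : T ∈ Set.Ioc 0 y)
    (hZ : ∀ s ∈ Set.Ioc 0 S, 8 * s * T * B s T ^ 2 ≤ (1 + 2 * s * A s T) * (1 + 2 * T * D s T)) :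
    2 * S - 4 * C * S ^ 2 ≤
      d2 u b b (framePt w a b S T) / hessDet u a b (framePt w a b S T) := by
  set G := fun z => d2 u b b z / hessDet u a b z with hG
  have sG : ContDiffOn ℝ ∞ G Ω := H.diag_smooth K.det b b
  have hδ : 0 < δ := hS.1.trans_le hS.2
  have hmem : ∀ s ∈ Set.Ioc 0 S, (w + T • b) + s • a ∈ Ω := fun s hs => by
    rw [← framePt_eq]; exact K.mem s ⟨hs.1, hs.2.trans hS.2⟩ T hT
  have hC0 : 0 ≤ C := (Real.sqrt_nonneg _).trans
    (hC (Sum.elim (fun i => framePt w a b S T i) 0) (by rw [base_elim]; exact K.mem S hS T hT))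
  have := two_mul_sub_le_of_second_deriv (h := fun s => G ((w + T • b) + s • a))
    (h' := fun s => dirD a G ((w + T • b) + s • a)) (h'' := fun s => d2 G a a ((w + T • b) + s • a))
    (κ := 4 * C) hS.1
    (fun s hs => hasDerivAt_line (differentiableAt_of_smooth H.isOpen sG (hmem s hs)))
    (fun s hs => hasDerivAt_line (differentiableAt_of_smooth H.isOpen
      (dirD_contDiffOn H.isOpen sG a) (hmem s hs)))
    (fun s hs => by
      have h1 := (abs_le.1 (H.abs_d2_diag_le hC (hmem s hs) K.det)).1
      have h2 := K.ratio_le H ⟨hs.1, hs.2.trans hS.2⟩ hT (hZ s hs)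
      rw [framePt_eq] at h2
      refine le_trans ?_ h1
      nlinarith)
    (by
      have h := K.tendsto_diag_div H hδ hT
      simp only [framePt_eq] at h
      exact h)
  rw [framePt_eq]
  exact this

include K H in
-- The entry vanishes on both axes and its mixed derivative is at most 4C · 2 in absolute value, so
-- it is of second order at the corner.
theorem offDiag_le {C S T : ℝ} (hC : ∀ y, base y ∈ Ω → rmNorm (toricMetric u) y ≤ C)
    (hS : S ∈ Set.Ioc 0 δ) (hT : T ∈ Set.Ioc 0 y)
    (hZ : ∀ s ∈ Set.Ioc 0 S, ∀ t ∈ Set.Ioc 0 T,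
      8 * s * t * B s t ^ 2 ≤ (1 + 2 * s * A s t) * (1 + 2 * t * D s t)) :
    |-d2 u a b (framePt w a b S T) / hessDet u a b (framePt w a b S T)| ≤ 8 * C * S * T := by
  set G := fun z => -d2 u a b z / hessDet u a b z with hG
  have sG : ContDiffOn ℝ ∞ G Ω := by
    refine (H.diag_smooth K.det a b).neg.congr fun z _ => ?_
    simp only [hG]
    rw [neg_div]
  have hδ : 0 < δ := hS.1.trans_le hS.2
  have hy : 0 < y := hT.1.trans_le hT.2
  have hmem : ∀ s ∈ Set.Ioc 0 S, ∀ t ∈ Set.Ioc 0 T, framePt w a b s t ∈ Ω := fun s hs t ht =>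
    K.mem s ⟨hs.1, hs.2.trans hS.2⟩ t ⟨ht.1, ht.2.trans hT.2⟩
  have hC0 : 0 ≤ C := (Real.sqrt_nonneg _).trans
    (hC (Sum.elim (fun i => framePt w a b S T i) 0) (by rw [base_elim]; exact K.mem S hS T hT))
  refine abs_le_of_mixed_deriv (b := fun s t => G (framePt w a b s t))
    (b₂ := fun s t => dirD b G (framePt w a b s t))
    (b₁₂ := fun s t => d2 G a b (framePt w a b s t)) hS.1 hT.1 (fun s hs t ht => ?_)
    (fun s hs t ht => ?_) (fun s hs t ht => ?_) (K.tendsto_offDiag H hδ hT) (fun s hs => ?_)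
  · exact hasDerivAt_line (x := w + s • a)
      (differentiableAt_of_smooth H.isOpen sG (hmem s hs t ht))
  · simp only [framePt_eq]
    refine hasDerivAt_line (x := w + t • b) (differentiableAt_of_smooth H.isOpen
      (dirD_contDiffOn H.isOpen sG b) ?_)
    rw [← framePt_eq]
    exact hmem s hs t ht
  · have h1 := H.abs_d2_offDiag_le hC (hmem s hs t ht) K.det
    have h2 := K.ratio_le H ⟨hs.1, hs.2.trans hS.2⟩ ⟨ht.1, ht.2.trans hT.2⟩ (hZ s hs t ht)
    refine h1.trans ?_
    nlinarith
  · have h := (K.swap H).tendsto_offDiag H hy ⟨hs.1, hs.2.trans hS.2⟩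
    refine h.congr' ?_
    filter_upwards [Ioo_mem_nhdsGT hT.1] with t ht
    have hm := hmem s hs t ⟨ht.1, ht.2.le⟩
    simp only [hG, framePt_swap]
    rw [H.d2_symm hm b a, hessDet, hessDet, H.d2_symm hm b a, mul_comm (d2 u b b _)]

/-- If the correlation stays small on the rectangle below `(S, T)`, the inverse Hessian at
`(S, T)` is controlled. -/
theorem entries_of_correlation {C S T : ℝ} (K : CornerChart u Ω w a b δ y A B D)
    (H : StrictConvexSmoothOn u Ω) (hC : ∀ y, base y ∈ Ω → rmNorm (toricMetric u) y ≤ C)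
    (hS : S ∈ Set.Ioc 0 δ) (hT : T ∈ Set.Ioc 0 y) {t₀ L c : ℝ}
    (hδC : δ * (4 * C) ≤ 1) (ht₀ : t₀ * (4 * C) ≤ 1) (hc0 : 0 < c) (hc1 : c ≤ 1)
    (hcL : c * L * y ≤ 1)
    (hL : ∀ s ∈ Set.Ioc 0 δ, ∀ t ∈ Set.Icc t₀ y, d2 u b b (framePt w a b s t) ≤ L)
    (hZ : ∀ s ∈ Set.Ioc 0 S, ∀ t ∈ Set.Ioc 0 T,
      8 * s * t * B s t ^ 2 ≤ (1 + 2 * s * A s t) * (1 + 2 * t * D s t)) :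
    S ≤ d2 u b b (framePt w a b S T) / hessDet u a b (framePt w a b S T) ∧
    c * T ≤ d2 u a a (framePt w a b S T) / hessDet u a b (framePt w a b S T) := by
  have hC0 : 0 ≤ C := (Real.sqrt_nonneg _).trans
    (hC (Sum.elim (fun i => framePt w a b S T i) 0) (by rw [base_elim]; exact K.mem S hS T hT))
  have hS0 := hS.1
  have hT0 := hT.1
  have hm := K.mem S hS T hT
  have hΔ := H.hessDet_pos hm K.det
  have hp := H.d2_pos hm K.ne_zero.1
  have hq := H.d2_pos hm K.ne_zero.2
  constructor
  · have h := K.diag_lower H hC hS hT fun s hs => hZ s hs T ⟨hT0, le_rfl⟩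
    have : S * (4 * C) ≤ 1 := le_trans (by gcongr; exact hS.2) hδC
    nlinarith
  -- For T ≤ t₀ the slope argument applies along the vertical segment. For larger T it would fail,
  -- but there u_bb ≤ L and the entry is at least 1/u_bb, which exceeds cT by the choice of c.
  · rcases le_total T t₀ with hle | hle
    · have h := (K.swap H).diag_lower H hC hT hS fun t ht => by
        have := hZ S ⟨hS0, le_rfl⟩ t ht
        linarith
      have hd : hessDet u b a (framePt w a b S T) = hessDet u a b (framePt w a b S T) := by
        rw [hessDet, hessDet, H.d2_symm hm b a, mul_comm (d2 u b b _)]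
      rw [framePt_swap, hd] at h
      have : T * (4 * C) ≤ 1 := le_trans (by gcongr) ht₀
      nlinarith
    · have hq' := hL S hS T ⟨hle, hT.2⟩
      have hL0 : 0 < L := hq.trans_le hq'
      rw [le_div_iff₀ hΔ, hessDet]
      have h1 : c * T * d2 u b b (framePt w a b S T) ≤ 1 := by
        calc c * T * d2 u b b (framePt w a b S T) ≤ c * y * L := by
              have hy := hT0.trans_le hT.2
              have := hT.2
              gcongr
          _ ≤ 1 := by linarith
      have hcT : 0 ≤ c * T := by positivity
      nlinarith [mul_nonneg hcT (sq_nonneg (d2 u a b (framePt w a b S T)))]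

/-- The correlation stays small on thin rectangles. -/
theorem correlation_lt {C : ℝ} (K : CornerChart u Ω w a b δ y A B D)
    (H : StrictConvexSmoothOn u Ω) (hC : ∀ y, base y ∈ Ω → rmNorm (toricMetric u) y ≤ C)
    {t₀ L c : ℝ} (hδC : δ * (4 * C) ≤ 1) (ht₀ : t₀ * (4 * C) ≤ 1) (hc0 : 0 < c) (hc1 : c ≤ 1)
    (hcL : c * L * y ≤ 1) (hδc : 16 * (8 * C) ^ 2 * δ * y ≤ c)
    (hL : ∀ s ∈ Set.Ioc 0 δ, ∀ t ∈ Set.Icc t₀ y, d2 u b b (framePt w a b s t) ≤ L)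
    {s t : ℝ} (hs : s ∈ Set.Icc 0 δ) (ht : t ∈ Set.Icc 0 y) :
    8 * s * t * B s t ^ 2 < (1 + 2 * s * A s t) * (1 + 2 * t * D s t) := by
  set R := Set.Icc 0 δ ×ˢ Set.Icc 0 y with hR
  set P : ℝ × ℝ → ℝ := fun z => (1 + 2 * z.1 * A z.1 z.2) * (1 + 2 * z.2 * D z.1 z.2) with hP
  set Z : ℝ × ℝ → ℝ := fun z => 8 * z.1 * z.2 * B z.1 z.2 ^ 2 with hZ
  have hPc : ContinuousOn P R :=
    (continuousOn_const.add ((Continuous.continuousOn (by fun_prop)).mul K.contA)).mul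
      (continuousOn_const.add ((Continuous.continuousOn (by fun_prop)).mul K.contD))
  have hZc : ContinuousOn Z R := (Continuous.continuousOn (by fun_prop)).mul (K.contB.pow 2)
  have hPpos : ∀ z ∈ R, 0 < P z := fun z hz =>
    mul_pos (K.pos_left H hz.1 hz.2) (K.pos_right H hz.1 hz.2)
  by_contra! hcon
  set bad := {z | z ∈ R ∧ P z - Z z ≤ 0} with hbad
  have hcomp : IsCompact bad := by
    have hRc : IsCompact R := isCompact_Icc.prod isCompact_Icc
    have hcl : IsClosed (R ∩ (fun z => P z - Z z) ⁻¹' Set.Iic 0) :=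
      (hPc.sub hZc).preimage_isClosed_of_isClosed hRc.isClosed isClosed_Iic
    exact hRc.of_isClosed_subset hcl Set.inter_subset_left
  have hne : bad.Nonempty := ⟨(s, t), ⟨hs, ht⟩, by simp only [hP, hZ]; linarith⟩
  -- A failure point with smallest first coordinate: every point strictly to its left, at any
  -- height, is good. It lies off the axes, since there `Z` vanishes and `P` is positive.
  obtain ⟨⟨S, T⟩, ⟨hST, hle⟩, hmin⟩ := hcomp.exists_isMinOn hne continuous_fst.continuousOn
  have hPST := hPpos _ hST
  have hS0 : 0 < S := by
    rcases hST.1.1.eq_or_lt with h | h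
    · simp only at h
      subst h
      simp only [hZ, mul_zero, zero_mul] at hle
      linarith
    · exact h
  have hT0 : 0 < T := by
    rcases hST.2.1.eq_or_lt with h | h
    · simp only at h
      subst h
      simp only [hZ, mul_zero, zero_mul] at hle
      linarith
    · exact h
  have hSδ : S ≤ δ := hST.1.2
  have hTy : T ≤ y := hST.2.2
  have hbelow : ∀ σ ∈ Set.Ioo 0 S, ∀ τ ∈ Set.Ioc 0 y,
      8 * σ * τ * B σ τ ^ 2 ≤ (1 + 2 * σ * A σ τ) * (1 + 2 * τ * D σ τ) := by
    intro σ hσ τ hτ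
    by_contra! h
    have : (σ, τ) ∈ bad :=
      ⟨⟨⟨hσ.1.le, hσ.2.le.trans hSδ⟩, ⟨hτ.1.le, hτ.2⟩⟩, by simp only [hP, hZ]; linarith⟩
    have := hmin this
    simp only [Set.mem_ofPred_eq] at this
    linarith [hσ.2]
  -- To the left of `S` the entry bounds give 16 u_ab² ≤ u_aa u_bb, of which only 2Z ≤ P is kept. In
  -- the limit σ → S this contradicts 0 < P ≤ Z at (S, T).
  have hkey : ∀ σ ∈ Set.Ioo 0 S, 2 * Z (σ, T) - P (σ, T) ≤ 0 := by
    intro σ hσ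
    have hσ' : σ ∈ Set.Ioc 0 δ := ⟨hσ.1, hσ.2.le.trans hSδ⟩
    have hT' : T ∈ Set.Ioc 0 y := ⟨hT0, hTy⟩
    have hσ0 := hσ.1
    have hb : ∀ s ∈ Set.Ioc 0 σ, ∀ t ∈ Set.Ioc 0 T,
        8 * s * t * B s t ^ 2 ≤ (1 + 2 * s * A s t) * (1 + 2 * t * D s t) := fun s hs t ht =>
      hbelow s ⟨hs.1, hs.2.trans_lt hσ.2⟩ t ⟨ht.1, ht.2.trans hTy⟩
    obtain ⟨h1, h2⟩ := K.entries_of_correlation H hC hσ' hT' hδC ht₀ hc0 hc1 hcL hL hb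
    have h3 := K.offDiag_le H hC hσ' hT' hb
    have hm := K.mem σ hσ' T hT'
    have hΔ := H.hessDet_pos hm K.det
    have e1 := K.d2_aa σ hσ' T hT'
    have e2 := K.d2_ab σ hσ' T hT'
    have e3 := K.d2_bb σ hσ' T hT'
    set p := d2 u a a (framePt w a b σ T)
    set r := d2 u a b (framePt w a b σ T)
    set q := d2 u b b (framePt w a b σ T)
    set Δ := hessDet u a b (framePt w a b σ T)
    have hC0 : 0 ≤ 8 * C * σ * T := (abs_nonneg _).trans h3
    have h4 : (-r / Δ) ^ 2 ≤ (8 * C * σ * T) ^ 2 := by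
      rw [← sq_abs]
      gcongr
    have h5 : σ * (c * T) ≤ (q / Δ) * (p / Δ) := by
      apply mul_le_mul h1 h2 (by positivity)
      exact hσ0.le.trans h1
    -- The thinness of the rectangle enters here: the left side is of order σ²T², the right side of
    -- order σT.
    have h6 : 16 * (8 * C * σ * T) ^ 2 ≤ σ * (c * T) := by
      have h7 : 16 * (8 * C) ^ 2 * σ * T ≤ c := by
        refine le_trans ?_ hδc
        have := hσ'.2
        have : 0 ≤ y := hT0.le.trans hTy
        have : 0 ≤ δ := hσ0.le.trans hσ'.2
        gcongr
      have h8 : 0 ≤ σ * T := by positivity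
      nlinarith
    have h9 : 16 * r ^ 2 ≤ q * p := by
      have h10 : 16 * (-r / Δ) ^ 2 ≤ (q / Δ) * (p / Δ) := by linarith
      have e : 16 * (-r / Δ) ^ 2 = (16 * r ^ 2) / Δ ^ 2 := by field_simp
      have e' : (q / Δ) * (p / Δ) = (q * p) / Δ ^ 2 := by field_simp
      rw [e, e', div_le_div_iff_of_pos_right (by positivity)] at h10
      exact h10
    rw [e1, e2, e3] at h9
    have e : (1 / (2 * T) + D σ T) * (1 / (2 * σ) + A σ T) = P (σ, T) / (4 * σ * T) := by
      simp only [hP]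
      field_simp
      ring
    rw [e, le_div_iff₀ (by positivity)] at h9
    simp only [hZ]
    nlinarith [mul_nonneg (mul_nonneg hσ0.le hT0.le) (sq_nonneg (B σ T))]
  have hlim : Tendsto (fun σ => 2 * Z (σ, T) - P (σ, T)) (𝓝[<] S) (𝓝 (2 * Z (S, T) - P (S, T))) := by
    have h := ((continuousOn_const.mul hZc).sub hPc (S, T) hST : ContinuousWithinAt
      (fun z => 2 * Z z - P z) R (S, T))
    have g : Tendsto (fun σ : ℝ => (σ, T)) (𝓝[<] S) (𝓝[R] (S, T)) := by
      refine tendsto_nhdsWithin_iff.2 ⟨?_, ?_⟩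
      · exact tendsto_nhdsWithin_of_tendsto_nhds
          ((continuous_id.prodMk continuous_const).tendsto' S (S, T) rfl)
      · filter_upwards [Ioo_mem_nhdsLT hS0] with σ hσ
        exact ⟨⟨hσ.1.le, hσ.2.le.trans hSδ⟩, hST.2⟩
    exact h.tendsto.comp g
  have : 2 * Z (S, T) - P (S, T) ≤ 0 := by
    refine le_of_tendsto hlim ?_
    filter_upwards [Ioo_mem_nhdsLT hS0] with σ hσ using hkey σ hσ
  linarith

/-- Guillemin-type upper bounds for the Hessian on thin rectangles at an edge. -/
theorem d2_le {C : ℝ} (K : CornerChart u Ω w a b δ y A B D)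
    (H : StrictConvexSmoothOn u Ω) (hC : ∀ y, base y ∈ Ω → rmNorm (toricMetric u) y ≤ C)
    {t₀ L c : ℝ} (hδC : δ * (4 * C) ≤ 1) (ht₀ : t₀ * (4 * C) ≤ 1) (hc0 : 0 < c) (hc1 : c ≤ 1)
    (hcL : c * L * y ≤ 1) (hδc : 16 * (8 * C) ^ 2 * δ * y ≤ c)
    (hL : ∀ s ∈ Set.Ioc 0 δ, ∀ t ∈ Set.Icc t₀ y, d2 u b b (framePt w a b s t) ≤ L)
    {s t : ℝ} (hs : s ∈ Set.Ioc 0 δ) (ht : t ∈ Set.Ioc 0 y) :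
    d2 u a a (framePt w a b s t) ≤ 2 / s ∧ d2 u b b (framePt w a b s t) ≤ 2 / (c * t) := by
  have hZ : ∀ σ ∈ Set.Ioc 0 s, ∀ τ ∈ Set.Ioc 0 t,
      8 * σ * τ * B σ τ ^ 2 ≤ (1 + 2 * σ * A σ τ) * (1 + 2 * τ * D σ τ) := fun σ hσ τ hτ =>
    (K.correlation_lt H hC hδC ht₀ hc0 hc1 hcL hδc hL ⟨hσ.1.le, hσ.2.trans hs.2⟩
      ⟨hτ.1.le, hτ.2.trans ht.2⟩).le
  obtain ⟨h1, h2⟩ := K.entries_of_correlation H hC hs ht hδC ht₀ hc0 hc1 hcL hL hZ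
  have h3 := K.ratio_le H hs ht (hZ s ⟨hs.1, le_rfl⟩ t ⟨ht.1, le_rfl⟩)
  have hm := K.mem s hs t ht
  have hp := H.d2_pos hm K.ne_zero.1
  have hq := H.d2_pos hm K.ne_zero.2
  have hct : 0 < c * t := mul_pos hc0 ht.1
  rw [mul_div_assoc] at h3
  constructor
  · rw [le_div_iff₀ hs.1]
    exact le_trans (by gcongr) h3
  · rw [le_div_iff₀ hct]
    refine le_trans ?_ h3
    rw [← mul_div_assoc, mul_comm, mul_div_right_comm]
    gcongr

end CornerChart
end ToricSurface

/-! ### Geometry of the polygon: vertices, frames, facets and the boundary integral. -/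

namespace ToricSurface

open Filter Topology

namespace PolygonData

variable {P : PolygonData}

theorem l_add_smul (i : Fin P.d) (x v : Plane) (t : ℝ) :
    P.l i (x + t • v) = P.l i x + t * inner ℝ v (P.nvec i) := by
  unfold l
  rw [inner_add_left, real_inner_smul_left]
  ring

theorem inner_nvec (i : Fin P.d) (v : Plane) :
    inner ℝ v (P.nvec i) = v 0 * P.normal i 0 + v 1 * P.normal i 1 := by
  simp [nvec, PiLp.inner_apply, Fin.sum_univ_two]
  ring

theorem l_sub_l (i : Fin P.d) (x y : Plane) : P.l i x - P.l i y = inner ℝ (x - y) (P.nvec i) := by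
  unfold l
  rw [inner_sub_left]
  ring

theorem l_contDiff (i : Fin P.d) : ContDiff ℝ ∞ (P.l i) := by
  exact (contDiff_id.inner ℝ contDiff_const).sub contDiff_const

theorem l_continuous (i : Fin P.d) : Continuous (P.l i) := (P.l_contDiff i).continuous

theorem l_combo (i : Fin P.d) (x y : Plane) {s t : ℝ} (h : s + t = 1) :
    P.l i (s • x + t • y) = s * P.l i x + t * P.l i y := by
  unfold l
  rw [inner_add_left, real_inner_smul_left, real_inner_smul_left]
  linear_combination P.offset i * h

theorem carrier_isClosed : IsClosed P.carrier := by
  have : P.carrier = ⋂ i, {x | 0 ≤ P.l i x} := by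
    ext x
    simp [carrier]
  rw [this]
  exact isClosed_iInter fun i => isClosed_le continuous_const (P.l_continuous i)

theorem carrier_convex : Convex ℝ P.carrier := by
  intro x hx y hy s t hs ht hst i
  rw [l_combo i x y hst]
  exact add_nonneg (mul_nonneg hs (hx i)) (mul_nonneg ht (hy i))

theorem facet_isClosed (i : Fin P.d) : IsClosed (P.facet i) :=
  P.carrier_isClosed.inter (isClosed_singleton.preimage (P.l_continuous i))

theorem facet_isExtreme (i : Fin P.d) : IsExtreme ℝ P.carrier (P.facet i) := by
  refine ⟨fun x hx => hx.1, ?_⟩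
  intro x hx y hy z hz hxyz
  obtain ⟨s, t, hs, ht, hst, rfl⟩ := hxyz
  have h := hz.2
  rw [l_combo i x y hst] at h
  refine ⟨hx, ?_⟩
  have h1 := hx i
  have h2 := hy i
  have h3 : s * P.l i x = 0 := by nlinarith [mul_nonneg hs.le h1, mul_nonneg ht.le h2]
  exact (mul_eq_zero.1 h3).resolve_left hs.ne'

/-- `w` is a vertex of the polygon, lying exactly on the edges `i` and `j`. -/
structure VertexAt (P : PolygonData) (w : Plane) (i j : Fin P.d) : Prop where
  mem : w ∈ P.carrier
  ne : i ≠ j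
  zero_iff : ∀ k, P.l k w = 0 ↔ k = i ∨ k = j
  det : (P.normal i 0 * P.normal j 1 - P.normal i 1 * P.normal j 0 : ℝ) ≠ 0

/-- The vector dual to `nᵢ` with respect to the pair `nᵢ, nⱼ`. -/
noncomputable def dual (P : PolygonData) (i j : Fin P.d) : Plane :=
  (P.normal i 0 * P.normal j 1 - P.normal i 1 * P.normal j 0 : ℝ)⁻¹ •
    !₂[(P.normal j 1 : ℝ), -(P.normal j 0 : ℝ)]

namespace VertexAt

variable {w : Plane} {i j : Fin P.d}

theorem symm (h : P.VertexAt w i j) : P.VertexAt w j i where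
  mem := h.mem
  ne := h.ne.symm
  zero_iff k := (h.zero_iff k).trans or_comm
  det h0 := h.det (by linear_combination -h0)

theorem l_left (h : P.VertexAt w i j) : P.l i w = 0 := (h.zero_iff i).2 (Or.inl rfl)

theorem l_right (h : P.VertexAt w i j) : P.l j w = 0 := (h.zero_iff j).2 (Or.inr rfl)

theorem l_pos (h : P.VertexAt w i j) {k : Fin P.d} (hi : k ≠ i) (hj : k ≠ j) : 0 < P.l k w :=
  (h.mem k).lt_of_ne fun h0 => ((h.zero_iff k).1 h0.symm).elim hi hj

theorem inner_dual_left (h : P.VertexAt w i j) : inner ℝ (P.dual i j) (P.nvec i) = 1 := by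
  rw [inner_nvec]
  have := h.det
  simp [dual]
  field_simp
  ring

theorem inner_dual_right (_h : P.VertexAt w i j) : inner ℝ (P.dual i j) (P.nvec j) = 0 := by
  rw [inner_nvec]
  simp [dual]
  ring

theorem det_dual (h : P.VertexAt w i j) :
    P.dual i j 0 * P.dual j i 1 - P.dual i j 1 * P.dual j i 0 ≠ 0 := by
  have e : (P.normal j 0 * P.normal i 1 - P.normal j 1 * P.normal i 0 : ℝ) =
    -(P.normal i 0 * P.normal j 1 - P.normal i 1 * P.normal j 0) := by ring
  have h1 := h.det
  have : P.dual i j 0 * P.dual j i 1 - P.dual i j 1 * P.dual j i 0 =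
      (P.normal i 0 * P.normal j 1 - P.normal i 1 * P.normal j 0 : ℝ)⁻¹ := by
    generalize hm : (P.normal i 0 * P.normal j 1 - P.normal i 1 * P.normal j 0 : ℝ) = m at *
    simp only [dual, e, hm, PiLp.smul_apply, smul_eq_mul, Matrix.cons_val_zero,
      Matrix.cons_val_one, inv_neg]
    field_simp
    linear_combination hm
  rw [this]
  exact inv_ne_zero h1

theorem decompose (h : P.VertexAt w i j) (v : Plane) :
    v = (inner ℝ v (P.nvec i)) • P.dual i j + (inner ℝ v (P.nvec j)) • P.dual j i := by
  have h1 := h.det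
  rw [inner_nvec, inner_nvec]
  have e : (P.normal j 0 * P.normal i 1 - P.normal j 1 * P.normal i 0 : ℝ) =
    -(P.normal i 0 * P.normal j 1 - P.normal i 1 * P.normal j 0) := by ring
  generalize hm : (P.normal i 0 * P.normal j 1 - P.normal i 1 * P.normal j 0 : ℝ) = m at *
  ext k
  fin_cases k
  · simp only [dual, e, hm, PiLp.smul_apply, PiLp.add_apply, smul_eq_mul, Matrix.cons_val_zero,
      Fin.zero_eta, inv_neg]
    field_simp
    rw [← hm]
    ring
  · simp only [dual, e, hm, PiLp.smul_apply, PiLp.add_apply, smul_eq_mul, Matrix.cons_val_one,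
      Matrix.cons_val_fin_one, Fin.mk_one, inv_neg]
    field_simp
    rw [← hm]
    ring

/-- The frame coordinates at a vertex are the two edge functions themselves, so a rectangle in the
frame is cut out by bounds on `P.l i` and `P.l j`. -/
theorem eq_framePt (h : P.VertexAt w i j) (x : Plane) :
    x = framePt w (P.dual i j) (P.dual j i) (P.l i x) (P.l j x) := by
  have e1 := P.l_sub_l i x w
  have e2 := P.l_sub_l j x w
  rw [h.l_left, sub_zero] at e1
  rw [h.l_right, sub_zero] at e2
  have := h.decompose (x - w)
  rw [← e1, ← e2] at this
  rw [framePt, add_assoc, ← this]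
  abel

theorem l_framePt (k : Fin P.d) (a b : Plane) (s t : ℝ) :
    P.l k (framePt w a b s t) =
      P.l k w + s * inner ℝ a (P.nvec k) + t * inner ℝ b (P.nvec k) := by
  rw [framePt, l_add_smul, l_add_smul]

theorem l_framePt_left (h : P.VertexAt w i j) (s t : ℝ) :
    P.l i (framePt w (P.dual i j) (P.dual j i) s t) = s := by
  rw [l_framePt, h.inner_dual_left, h.symm.inner_dual_right, h.l_left]
  ring

theorem l_framePt_right (h : P.VertexAt w i j) (s t : ℝ) :
    P.l j (framePt w (P.dual i j) (P.dual j i) s t) = t := by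
  rw [l_framePt, h.inner_dual_right, h.symm.inner_dual_left, h.l_right]
  ring

theorem exists_edge (h : P.VertexAt w i j) :
    ∃ τ : ℝ, 0 < τ ∧ ∀ t ∈ Set.Icc 0 τ, w + t • P.dual i j ∈ P.carrier := by
  have hev : ∀ᶠ t in 𝓝 (0 : ℝ), ∀ k, k ≠ i → k ≠ j → 0 < P.l k (w + t • P.dual i j) := by
    refine eventually_all.2 fun k => ?_
    by_cases hk : k ≠ i ∧ k ≠ j
    · have hc : Continuous fun t : ℝ => P.l k (w + t • P.dual i j) :=
        (P.l_continuous k).comp (by fun_prop)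
      have := hc.tendsto 0
      simp only [zero_smul, add_zero] at this
      filter_upwards [this.eventually (lt_mem_nhds (h.l_pos hk.1 hk.2))] with t ht _ _ using ht
    · exact Eventually.of_forall fun t h1 h2 => absurd ⟨h1, h2⟩ hk
  obtain ⟨ε, hε, hb⟩ := Metric.eventually_nhds_iff.1 hev
  refine ⟨ε / 2, half_pos hε, fun t ht k => ?_⟩
  by_cases hi : k = i
  · subst hi
    rw [l_add_smul, h.l_left, h.inner_dual_left]
    linarith [ht.1]
  by_cases hj : k = j
  · subst hj
    rw [l_add_smul, h.l_right, h.inner_dual_right]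
    linarith
  · refine (hb ?_ k hi hj).le
    rw [Real.dist_eq, sub_zero, abs_of_nonneg ht.1]
    linarith [ht.2]

end VertexAt

namespace IsDelzant

variable (hP : P.IsDelzant)

include hP

theorem isCompact : IsCompact P.carrier :=
  Metric.isCompact_of_isClosed_isBounded P.carrier_isClosed hP.bounded

theorem exists_vertexAt {w : Plane} (hw : w ∈ P.carrier.extremePoints ℝ) :
    ∃ i j, P.VertexAt w i j := by
  obtain ⟨i, j, hij, hz, hd⟩ := hP.vertex w hw
  refine ⟨i, j, hw.1, hij, hz, ?_⟩
  have := hd.ne_zero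
  rw [Matrix.det_fin_two_of] at this
  exact_mod_cast this

/-- A facet is a compact extreme subset, so its extreme points, which exist by compactness, are
extreme in the polygon. -/
theorem exists_vertex_on_facet (i : Fin P.d) : ∃ w j, P.VertexAt w i j := by
  have hc : IsCompact (P.facet i) :=
    hP.isCompact.of_isClosed_subset (P.facet_isClosed i) fun x hx => hx.1
  obtain ⟨w, hw⟩ := hc.extremePoints_nonempty (hP.facet_nontrivial i).nonempty
  obtain ⟨i', j', h⟩ := hP.exists_vertexAt ((P.facet_isExtreme i).extremePoints_subset_extremePoints hw)
  rcases (h.zero_iff i).1 hw.1.2 with rfl | rfl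
  · exact ⟨w, j', h⟩
  · exact ⟨w, i', h.symm⟩

theorem nvec_ne_zero (i : Fin P.d) : P.nvec i ≠ 0 := by
  obtain ⟨w, j, h⟩ := hP.exists_vertex_on_facet i
  intro h0
  have := h.inner_dual_left
  rw [h0, inner_zero_right] at this
  exact zero_ne_one this

theorem mem_interior_iff {x : Plane} : x ∈ interior P.carrier ↔ ∀ i, 0 < P.l i x := by
  constructor
  · intro hx i
    have hc : Continuous fun t : ℝ => x + t • P.nvec i := by fun_prop
    have h := hc.tendsto 0
    simp only [zero_smul, add_zero] at h
    have hev := h.eventually (mem_interior_iff_mem_nhds.1 hx)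
    obtain ⟨ε, hε, hb⟩ := Metric.eventually_nhds_iff.1 hev
    have hm : x + (-(ε / 2)) • P.nvec i ∈ P.carrier := hb (by
      rw [Real.dist_eq, sub_zero, abs_neg, abs_of_pos (half_pos hε)]
      linarith)
    have h2 := hm i
    rw [l_add_smul, real_inner_self_eq_norm_sq] at h2
    have h3 : 0 < ‖P.nvec i‖ ^ 2 := by
      have := norm_pos_iff.2 (hP.nvec_ne_zero i)
      positivity
    nlinarith
  · intro h
    have ho : IsOpen {x | ∀ i, 0 < P.l i x} := by
      simp only [Set.ofPred_forall]
      exact isOpen_iInter_of_finite fun i => isOpen_lt continuous_const (P.l_continuous i)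
    exact interior_maximal (fun y hy i => (hy i).le) ho h

/-- A linear functional attains its maximum over the polygon at a vertex. -/
theorem exists_vertex_max (φ : Plane →L[ℝ] ℝ) :
    ∃ w i j, P.VertexAt w i j ∧ ∀ x ∈ P.carrier, φ x ≤ φ w := by
  have hne : P.carrier.Nonempty := hP.interior_nonempty.mono interior_subset
  have hexp : IsExposed ℝ P.carrier (φ.toExposed P.carrier) :=
    ContinuousLinearMap.toExposed.isExposed
  obtain ⟨z, hz, hmax⟩ := hP.isCompact.exists_isMaxOn hne φ.continuous.continuousOn
  have hzne : (φ.toExposed P.carrier).Nonempty := ⟨z, hz, fun y hy => hmax hy⟩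
  obtain ⟨w, hw⟩ := (hexp.isCompact hP.isCompact).extremePoints_nonempty hzne
  obtain ⟨i, j, h⟩ := hP.exists_vertexAt (hexp.isExtreme.extremePoints_subset_extremePoints hw)
  exact ⟨w, i, j, h, hw.1.2⟩

/-- Used to see that facets have finite length, so that continuous functions are integrable on them.
-/
theorem facet_subset_segment (i : Fin P.d) : ∃ p q : Plane, P.facet i ⊆ segment ℝ p q := by
  obtain ⟨w, j, h⟩ := hP.exists_vertex_on_facet i
  obtain ⟨R, hR⟩ := hP.isCompact.bddAbove_image (P.l_continuous j).continuousOn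
  refine ⟨w, w + R • P.dual j i, fun x hx => ?_⟩
  have h1 : P.l j x ≤ R := hR ⟨x, hx.1, rfl⟩
  have h0 := hx.1 j
  have e := h.eq_framePt x
  rw [hx.2, framePt, zero_smul, add_zero] at e
  rw [segment_eq_image']
  rcases h0.eq_or_lt with h2 | h2
  · exact ⟨0, ⟨le_rfl, zero_le_one⟩, by rw [e, ← h2]; simp⟩
  · have hR0 : 0 < R := h2.trans_le h1
    refine ⟨P.l j x / R, ⟨by positivity, (div_le_one hR0).2 h1⟩, ?_⟩
    conv_rhs => rw [e]
    simp only [add_sub_cancel_left, smul_smul]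
    rw [div_mul_cancel₀ _ hR0.ne']

open MeasureTheory in
theorem facet_measure_ne_top (i : Fin P.d) :
    (Measure.hausdorffMeasure 1 : Measure Plane) (P.facet i) ≠ ⊤ := by
  obtain ⟨p, q, h⟩ := hP.facet_subset_segment i
  refine ne_top_of_le_ne_top ?_ (measure_mono h)
  rw [hausdorffMeasure_segment]
  exact edist_ne_top _ _

open MeasureTheory in
theorem integrableOn_facet {u : Plane → ℝ} (hu : ContinuousOn u P.carrier) (i : Fin P.d) :
    IntegrableOn u (P.facet i) (Measure.hausdorffMeasure 1 : Measure Plane) := by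
  have hc : IsCompact (P.facet i) :=
    hP.isCompact.of_isClosed_subset (P.facet_isClosed i) fun x hx => hx.1
  have hu' : ContinuousOn u (P.facet i) := hu.mono fun x hx => hx.1
  obtain ⟨B, hB⟩ := hc.exists_bound_of_continuousOn hu'
  have : IsFiniteMeasure ((Measure.hausdorffMeasure 1 : Measure Plane).restrict (P.facet i)) :=
    isFiniteMeasure_restrict.2 (hP.facet_measure_ne_top i)
  refine Integrable.of_bound
    (hu'.aestronglyMeasurable (P.facet_isClosed i).measurableSet) B ?_
  exact (ae_restrict_iff' (P.facet_isClosed i).measurableSet).2 (Eventually.of_forall hB)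

open MeasureTheory in
/-- A non-negative function that is at least `m` on a piece of an edge at a vertex has a boundary
integral bounded below. -/
theorem le_boundary_integral {u : Plane → ℝ} (hu : ContinuousOn u P.carrier)
    (h0 : ∀ x ∈ P.carrier, 0 ≤ u x) {w : Plane} {i j : Fin P.d} (h : P.VertexAt w i j) {δ m : ℝ}
    (hδ : 0 ≤ δ) (hmem : ∀ t ∈ Set.Icc 0 δ, w + t • P.dual i j ∈ P.carrier)
    (hm : ∀ t ∈ Set.Icc 0 δ, m ≤ u (w + t • P.dual i j)) :
    1 / ‖P.nvec j‖ * (m * (δ * ‖P.dual i j‖)) ≤ ∫ x, u x ∂P.boundaryMeasure := by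
  have hint : ∀ k, Integrable u (ENNReal.ofReal (1 / ‖P.nvec k‖) •
      (Measure.hausdorffMeasure 1).restrict (P.facet k)) := fun k =>
    (hP.integrableOn_facet hu k).smul_measure ENNReal.ofReal_ne_top
  rw [boundaryMeasure, integral_finsetSum_measure fun k _ => hint k]
  have hterm : ∀ k, ∫ x, u x ∂(ENNReal.ofReal (1 / ‖P.nvec k‖) •
      (Measure.hausdorffMeasure 1).restrict (P.facet k)) =
      1 / ‖P.nvec k‖ * ∫ x in P.facet k, u x ∂(Measure.hausdorffMeasure 1) := by
    intro k
    rw [integral_smul_measure, ENNReal.toReal_ofReal (by positivity), smul_eq_mul]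
  have hnn : ∀ k, 0 ≤ ∫ x in P.facet k, u x ∂(Measure.hausdorffMeasure 1) := fun k =>
    setIntegral_nonneg (P.facet_isClosed k).measurableSet fun x hx => h0 x hx.1
  refine le_trans ?_ (Finset.single_le_sum (f := fun k => ∫ x, u x ∂(ENNReal.ofReal (1 / ‖P.nvec k‖) •
      (Measure.hausdorffMeasure 1).restrict (P.facet k))) (fun k _ => ?_) (Finset.mem_univ j))
  · simp only [hterm]
    gcongr
    set S := segment ℝ w (w + δ • P.dual i j) with hS
    have hSt : ∀ x ∈ S, ∃ t ∈ Set.Icc 0 δ, x = w + t • P.dual i j := by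
      intro x hx
      rw [hS, segment_eq_image'] at hx
      obtain ⟨θ, hθ, rfl⟩ := hx
      refine ⟨θ * δ, ⟨mul_nonneg hθ.1 hδ, mul_le_of_le_one_left hδ hθ.2⟩, ?_⟩
      simp [smul_smul]
    have hSf : S ⊆ P.facet j := by
      intro x hx
      obtain ⟨t, ht, rfl⟩ := hSt x hx
      refine ⟨hmem t ht, ?_⟩
      rw [l_add_smul, h.l_right, h.inner_dual_right]
      simp
    have hSm : MeasurableSet S := by
      rw [hS, segment_eq_image']
      exact (isCompact_Icc.image (by fun_prop)).isClosed.measurableSet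
    have hSμ : (Measure.hausdorffMeasure 1 : Measure Plane) S = edist w (w + δ • P.dual i j) :=
      hausdorffMeasure_segment _ _
    have hreal : (Measure.hausdorffMeasure 1 : Measure Plane).real S = δ * ‖P.dual i j‖ := by
      rw [Measure.real, hSμ, edist_dist, ENNReal.toReal_ofReal dist_nonneg, dist_eq_norm]
      rw [sub_add_cancel_left, norm_neg, norm_smul, Real.norm_of_nonneg hδ]
    have hI := hP.integrableOn_facet hu j
    calc m * (δ * ‖P.dual i j‖) ≤ ∫ x in S, u x ∂(Measure.hausdorffMeasure 1) := by
          rw [← hreal]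
          refine setIntegral_ge_of_const_le_real hSm ?_ ?_ (hI.mono_set hSf)
          · rw [hSμ]
            exact edist_ne_top _ _
          · intro x hx
            obtain ⟨t, ht, rfl⟩ := hSt x hx
            exact hm t ht
      _ ≤ _ := by
          refine setIntegral_mono_set hI ?_ hSf.eventuallyLE
          exact (ae_restrict_iff' (P.facet_isClosed j).measurableSet).2
            (Eventually.of_forall fun x hx => h0 x hx.1)
  · simp only [hterm]
    have := hnn k
    positivity

end IsDelzant
end PolygonData
end ToricSurface

/-! ### Derivatives of symplectic potentials on faces and in the interior. -/

namespace ToricSurface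

open Filter Topology

theorem d2_add_add {Ω : Set Plane} {F : Plane → ℝ} {x : Plane} (hΩ : IsOpen Ω)
    (hF : ContDiffOn ℝ ∞ F Ω) (hx : x ∈ Ω) (a b : Plane) (s t : ℝ) :
    d2 F (s • a + t • b) (s • a + t • b) x =
      s ^ 2 * d2 F a a x + 2 * s * t * d2 F a b x + t ^ 2 * d2 F b b x := by
  have h := dirD_comm hΩ hF hx a b
  simp only [d2] at *
  rw [dirD_dirD_eq_sum hΩ hF hx, dirD_dirD_eq_sum hΩ hF hx] at h
  simp only [dirD_dirD_eq_sum hΩ hF hx, Fin.sum_univ_two, PiLp.add_apply, PiLp.smul_apply,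
    smul_eq_mul] at *
  linear_combination s * t * (-1) * h

namespace PolygonData

variable {P : PolygonData}

/-- `v` is tangent to the face of `P` containing `x` in its relative interior. -/
def IsTangent (P : PolygonData) (x v : Plane) : Prop :=
  ∀ i, P.l i x = 0 → inner ℝ v (P.nvec i) = 0

/-- The derivative of `f + ∑ ½ lᵢ log lᵢ` in a tangent direction. -/
noncomputable def potD (P : PolygonData) (f : Plane → ℝ) (v x : Plane) : ℝ :=
  dirD v f x + ∑ k, 1 / 2 * (inner ℝ v (P.nvec k) * (Real.log (P.l k x) + 1))

/-- The second derivative of `f + ∑ ½ lᵢ log lᵢ` in a tangent direction. -/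
noncomputable def potD2 (P : PolygonData) (f : Plane → ℝ) (v x : Plane) : ℝ :=
  d2 f v v x + ∑ k, 1 / 2 * (inner ℝ v (P.nvec k) * (inner ℝ v (P.nvec k) / P.l k x))

theorem l_line_hasDerivAt (k : Fin P.d) (x v : Plane) (t : ℝ) :
    HasDerivAt (fun t : ℝ => P.l k (x + t • v)) (inner ℝ v (P.nvec k)) t := by
  simp only [l_add_smul]
  simpa using ((hasDerivAt_id t).mul_const (inner ℝ v (P.nvec k))).const_add (P.l k x)

/-- A tangent direction keeps the active edge functions at zero, and the finitely many inactive ones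
stay positive for small times. Derivatives along a face are therefore two-sided. -/
theorem eventually_line {x v : Plane} (hx : x ∈ P.carrier) (hv : P.IsTangent x v) :
    ∀ᶠ t in 𝓝 (0 : ℝ), x + t • v ∈ P.carrier ∧ P.IsTangent (x + t • v) v := by
  have hev : ∀ᶠ t in 𝓝 (0 : ℝ), ∀ k, P.l k x ≠ 0 → 0 < P.l k (x + t • v) := by
    refine eventually_all.2 fun k => ?_
    by_cases hk : P.l k x = 0
    · exact Eventually.of_forall fun t h => absurd hk h
    · have hpos : 0 < P.l k x := (hx k).lt_of_ne (Ne.symm hk)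
      have := (P.l_line_hasDerivAt k x v 0).continuousAt
      have h2 := this.eventually (lt_mem_nhds (by simpa using hpos))
      exact h2.mono fun t ht _ => ht
  filter_upwards [hev] with t ht
  constructor
  · intro k
    by_cases hk : P.l k x = 0
    · rw [l_add_smul, hk, hv k hk]
      simp
    · exact (ht k hk).le
  · intro k hk
    by_contra hne
    have : P.l k x ≠ 0 := fun h0 => hne (hv k h0)
    exact (ht k this).ne' hk

section Potential

variable {u f : Plane → ℝ} (hf : ContDiff ℝ ∞ f)
  (hu : ∀ x ∈ P.carrier, u x = f x + ∑ i, (1 / 2) * (P.l i x * Real.log (P.l i x)))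

include hf hu

theorem potential_continuousOn : ContinuousOn u P.carrier := by
  refine ContinuousOn.congr (Continuous.continuousOn ?_) hu
  refine hf.continuous.add (continuous_finsetSum _ fun i _ => continuous_const.mul ?_)
  exact Real.continuous_mul_log.comp (P.l_continuous i)

/-- The terms of active edges vanish identically along the line, and their coefficients in `potD`
are zero, so the value given to the logarithm at 0 is irrelevant. -/
theorem hasDerivAt_potential {x v : Plane} (hx : x ∈ P.carrier) (hv : P.IsTangent x v) :
    HasDerivAt (fun t : ℝ => u (x + t • v)) (P.potD f v x) 0 := by
  have hterm : ∀ k, HasDerivAt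
      (fun t : ℝ => 1 / 2 * (P.l k (x + t • v) * Real.log (P.l k (x + t • v))))
      (1 / 2 * (inner ℝ v (P.nvec k) * (Real.log (P.l k x) + 1))) 0 := by
    intro k
    by_cases hk : P.l k x = 0
    · simp only [l_add_smul, hk, hv k hk, mul_zero, add_zero, zero_mul]
      exact hasDerivAt_const _ _
    · have h1 := Real.hasDerivAt_mul_log (x := P.l k (x + (0 : ℝ) • v)) (by simpa using hk)
      have h2 := h1.comp 0 (P.l_line_hasDerivAt k x v 0)
      simp only [zero_smul, add_zero] at h2
      refine (h2.const_mul (1 / 2)).congr_deriv ?_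
      ring
  have h1 := hasDerivAt_line (F := f) (x := x) (v := v) (t := 0)
    (hf.differentiable (by simp) _)
  simp only [zero_smul, add_zero] at h1
  have h2 := h1.add (HasDerivAt.fun_sum (u := Finset.univ) fun k _ => hterm k)
  refine h2.congr_of_eventuallyEq ?_
  filter_upwards [eventually_line hx hv] with t ht using hu _ ht.1

theorem eventually_hasDerivAt_potential {x v : Plane} (hx : x ∈ P.carrier)
    (hv : P.IsTangent x v) :
    ∀ᶠ t in 𝓝 (0 : ℝ), HasDerivAt (fun t : ℝ => u (x + t • v)) (P.potD f v (x + t • v)) t := by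
  filter_upwards [eventually_line hx hv] with t ht
  have h := hasDerivAt_potential hf hu ht.1 ht.2
  have h2 : HasDerivAt (fun s : ℝ => u (x + t • v + s • v)) (P.potD f v (x + t • v)) (t - t) := by
    rwa [sub_self]
  have h3 := h2.comp_sub_const t t
  refine h3.congr_of_eventuallyEq (Eventually.of_forall fun s => ?_)
  simp only
  congr 1
  rw [sub_smul]
  abel

omit hu in
theorem hasDerivAt_potD {x v : Plane} (hv : P.IsTangent x v) :
    HasDerivAt (fun t : ℝ => P.potD f v (x + t • v)) (P.potD2 f v x) 0 := by
  have hterm : ∀ k, HasDerivAt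
      (fun t : ℝ => 1 / 2 * (inner ℝ v (P.nvec k) * (Real.log (P.l k (x + t • v)) + 1)))
      (1 / 2 * (inner ℝ v (P.nvec k) * (inner ℝ v (P.nvec k) / P.l k x))) 0 := by
    intro k
    by_cases hk : P.l k x = 0
    · simp only [hv k hk, mul_zero, zero_mul]
      exact hasDerivAt_const _ _
    · have h1 := (P.l_line_hasDerivAt k x v 0).log (by simpa using hk)
      simp only [zero_smul, add_zero] at h1
      exact ((h1.add_const 1).const_mul _).const_mul _
  have hd : Differentiable ℝ (dirD v f) := fun z =>
    differentiableAt_of_smooth isOpen_univ (dirD_contDiffOn isOpen_univ hf.contDiffOn v)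
      (Set.mem_univ z)
  have h1 := hasDerivAt_line (F := dirD v f) (x := x) (v := v) (t := 0) (hd _)
  simp only [zero_smul, add_zero] at h1
  exact h1.add (HasDerivAt.fun_sum (u := Finset.univ) fun k _ => hterm k)

theorem iteratedDeriv_potential {x v : Plane} (hx : x ∈ P.carrier) (hv : P.IsTangent x v) :
    iteratedDeriv 2 (fun t : ℝ => u (x + t • v)) 0 = P.potD2 f v x := by
  rw [iteratedDeriv_succ, iteratedDeriv_one]
  have : deriv (fun t : ℝ => u (x + t • v)) =ᶠ[𝓝 0] fun t => P.potD f v (x + t • v) :=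
    (eventually_hasDerivAt_potential hf hu hx hv).mono fun t ht => ht.deriv
  rw [this.deriv_eq, (hasDerivAt_potD hf hv).deriv]

end Potential

namespace IsDelzant

variable (hP : P.IsDelzant)

include hP

theorem isTangent_of_mem_interior {x : Plane} (hx : x ∈ interior P.carrier) (v : Plane) :
    P.IsTangent x v := fun i hi => absurd hi (hP.mem_interior_iff.1 hx i).ne'

section Potential

variable {u f : Plane → ℝ} (hf : ContDiff ℝ ∞ f)
  (hu : ∀ x ∈ P.carrier, u x = f x + ∑ i, (1 / 2) * (P.l i x * Real.log (P.l i x)))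

include hf hu

theorem potential_smooth : ContDiffOn ℝ ∞ u (interior P.carrier) := by
  refine ContDiffOn.congr ?_ fun x hx => hu x (interior_subset hx)
  refine hf.contDiffOn.add (ContDiffOn.sum fun i _ => contDiffOn_const.mul ?_)
  refine (P.l_contDiff i).contDiffOn.mul ((P.l_contDiff i).contDiffOn.log fun x hx => ?_)
  exact (hP.mem_interior_iff.1 hx i).ne'

theorem dirD_potential {x : Plane} (hx : x ∈ interior P.carrier) (v : Plane) :
    dirD v u x = P.potD f v x := by
  have h1 := hasDerivAt_line (x := x) (v := v) (t := 0) (differentiableAt_of_smooth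
    isOpen_interior (hP.potential_smooth hf hu) (by simpa using hx))
  rw [zero_smul, add_zero] at h1
  exact h1.unique (hasDerivAt_potential hf hu (interior_subset hx)
    (hP.isTangent_of_mem_interior hx v))

theorem d2_potential {x : Plane} (hx : x ∈ interior P.carrier) (v : Plane) :
    d2 u v v x = P.potD2 f v x := by
  have hs := hP.potential_smooth hf hu
  have h1 := hasDerivAt_line (x := x) (v := v) (t := 0) (differentiableAt_of_smooth
    isOpen_interior (dirD_contDiffOn isOpen_interior hs v) (by simpa using hx))
  rw [zero_smul, add_zero] at h1
  refine h1.unique ((hasDerivAt_potD hf (hP.isTangent_of_mem_interior hx v)).congr_of_eventuallyEq ?_)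
  have hc : Continuous fun t : ℝ => x + t • v := by fun_prop
  have hev := (hc.tendsto' 0 x (by simp)).eventually (isOpen_interior.mem_nhds hx)
  filter_upwards [hev] with t ht using hP.dirD_potential hf hu ht v

/-- Polarization of the diagonal formula, applied to a + b. -/
theorem d2_potential_mixed {x : Plane} (hx : x ∈ interior P.carrier) (a b : Plane) :
    d2 u a b x = d2 f a b x +
      ∑ k, 1 / 2 * (inner ℝ a (P.nvec k) * (inner ℝ b (P.nvec k) / P.l k x)) := by
  have hs := hP.potential_smooth hf hu
  have h1 := d2_add_add isOpen_interior hs hx a b 1 1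
  have h2 := d2_add_add isOpen_univ hf.contDiffOn (Set.mem_univ x) a b 1 1
  have e := hP.d2_potential hf hu hx
  rw [e, e, e] at h1
  simp only [potD2, h2] at h1
  have h3 : ∑ k, 1 / 2 * (inner ℝ ((1 : ℝ) • a + (1 : ℝ) • b) (P.nvec k) *
      (inner ℝ ((1 : ℝ) • a + (1 : ℝ) • b) (P.nvec k) / P.l k x)) =
      ∑ k, 1 / 2 * (inner ℝ a (P.nvec k) * (inner ℝ a (P.nvec k) / P.l k x)) +
      2 * ∑ k, 1 / 2 * (inner ℝ a (P.nvec k) * (inner ℝ b (P.nvec k) / P.l k x)) +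
      ∑ k, 1 / 2 * (inner ℝ b (P.nvec k) * (inner ℝ b (P.nvec k) / P.l k x)) := by
    rw [Finset.mul_sum, ← Finset.sum_add_distrib, ← Finset.sum_add_distrib]
    refine Finset.sum_congr rfl fun k _ => ?_
    rw [one_smul, one_smul, inner_add_left]
    ring
  rw [h3] at h1
  linarith

end Potential

theorem strictConvexSmoothOn {u : Plane → ℝ} (hu : P.IsSymplecticPotential u) :
    StrictConvexSmoothOn u (interior P.carrier) := by
  obtain ⟨f, hf, hfu⟩ := hu.guillemin
  have hs := hP.potential_smooth hf hfu
  refine ⟨isOpen_interior, hs, fun x hx => ?_⟩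
  refine Matrix.PosDef.of_dotProduct_mulVec_pos ?_ fun v hv => ?_
  · ext i j
    rw [Matrix.conjTranspose_apply, star_trivial]
    exact pdv_comm isOpen_interior hs hx j i
  · have hv' : (WithLp.toLp 2 v : Plane) ≠ 0 := by
      intro h
      apply hv
      ext k
      exact congrFun (congrArg (fun z : Plane => (z : Fin 2 → ℝ)) h) k
    have h1 := hu.strictly_convex x (interior_subset hx) _ hv' (hP.isTangent_of_mem_interior hx _)
    rw [iteratedDeriv_potential hf hfu (interior_subset hx) (hP.isTangent_of_mem_interior hx _),
      ← hP.d2_potential hf hfu hx, d2, dirD_dirD_eq_sum isOpen_interior hs hx] at h1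
    refine h1.trans_eq ?_
    simp only [dotProduct, Matrix.mulVec, Fin.sum_univ_two, star_trivial]
    change v 0 * v 0 * hess u x 0 0 + v 0 * v 1 * hess u x 0 1 +
      (v 1 * v 0 * hess u x 1 0 + v 1 * v 1 * hess u x 1 1) = _
    ring

/-- The graph of a symplectic potential lies above its tangent planes. -/
theorem le_of_tangent {u : Plane → ℝ} (hu : P.IsSymplecticPotential u) {q x : Plane}
    (hq : q ∈ interior P.carrier) (hx : x ∈ P.carrier) : u q + dirD (x - q) u q ≤ u x := by
  obtain ⟨f, hf, hfu⟩ := hu.guillemin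
  have H := hP.strictConvexSmoothOn hu
  by_cases hxq : x - q = 0
  · rw [sub_eq_zero.1 hxq]
    simp [dirD]
  have hmem : ∀ t ∈ Set.Ico (0 : ℝ) 1, q + t • (x - q) ∈ interior P.carrier := by
    intro t ht
    have := P.carrier_convex.combo_interior_self_mem_interior hq hx (a := 1 - t) (b := t)
      (by linarith [ht.2]) ht.1 (by ring)
    convert this using 1
    rw [smul_sub, sub_smul, one_smul]
    abel
  have hmem1 : ∀ t ∈ Set.Icc (0 : ℝ) 1, q + t • (x - q) ∈ P.carrier := fun t ht =>
    P.carrier_convex.add_smul_sub_mem (interior_subset hq) hx ht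
  -- The end point x may lie on the boundary, where only continuity of u is known; it suffices for
  -- convexity on the closed interval.
  have hconv : ConvexOn ℝ (Set.Icc (0 : ℝ) 1) fun t => u (q + t • (x - q)) := by
    refine convexOn_of_hasDerivWithinAt2_nonneg (f' := fun t => dirD (x - q) u (q + t • (x - q)))
      (f'' := fun t => d2 u (x - q) (x - q) (q + t • (x - q))) (convex_Icc _ _) ?_
      (fun t ht => ?_) (fun t ht => ?_) (fun t ht => ?_)
    · exact (potential_continuousOn hf hfu).comp (by fun_prop) hmem1
    all_goals
      rw [interior_Icc] at ht
      have hm := hmem t ⟨ht.1.le, ht.2⟩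
    · exact (hasDerivAt_line (differentiableAt_of_smooth H.isOpen H.smooth hm)).hasDerivWithinAt
    · exact (hasDerivAt_line (differentiableAt_of_smooth H.isOpen
        (dirD_contDiffOn H.isOpen H.smooth _) hm)).hasDerivWithinAt
    · exact (H.d2_pos hm hxq).le
  have hd := hasDerivAt_line (x := q) (v := x - q) (t := 0)
    (differentiableAt_of_smooth H.isOpen H.smooth (hmem 0 ⟨le_rfl, zero_lt_one⟩))
  have := hconv.le_slope_of_hasDerivAt (Set.left_mem_Icc.2 zero_le_one)
    (Set.right_mem_Icc.2 zero_le_one) zero_lt_one hd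
  simp only [slope, zero_smul, add_zero, one_smul, sub_zero, inv_one, vsub_eq_sub, smul_eq_mul,
    one_mul, add_sub_cancel] at this
  linarith

end IsDelzant
end PolygonData
end ToricSurface

/-! ### Bounds on values away from the vertices, and the interior Hessian bound. -/

namespace ToricSurface

open Filter Topology

namespace PolygonData

variable {P : PolygonData}

/-- Non-negative symplectic potentials with bounded curvature and bounded boundary integral. -/
structure IsControlled (P : PolygonData) (C₁ C₂ : ℝ) (u : Plane → ℝ) : Prop where
  potential : P.IsSymplecticPotential u
  nonneg : ∀ x ∈ P.carrier, 0 ≤ u x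
  curvature : CurvatureBoundedBy P u C₁
  integral : ∫ x, u x ∂P.boundaryMeasure < C₂

theorem IsControlled.curvature_le {C₁ C₂ : ℝ} {u : Plane → ℝ} (hu : P.IsControlled C₁ C₂ u) :
    ∀ y, base y ∈ interior P.carrier → rmNorm (toricMetric u) y ≤ |C₁| := fun y hy =>
  (hu.curvature y hy).trans (le_abs_self _)

/-- The Guillemin-type upper bound for the Hessian of controlled potentials near `p`. -/
def HessBoundNear (P : PolygonData) (C₁ C₂ : ℝ) (p : Plane) : Prop :=
  ∃ K : ℝ, 0 ≤ K ∧ ∀ᶠ q in 𝓝 p, ∀ u, P.IsControlled C₁ C₂ u → q ∈ interior P.carrier →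
    ∀ v : Plane, d2 u v v q ≤
      K * (‖v‖ ^ 2 + ∑ k, inner ℝ v (P.nvec k) ^ 2 / P.l k q)

namespace IsDelzant

variable (hP : P.IsDelzant)

include hP

theorem nonneg_of_normalized {u : Plane → ℝ} (hu : P.IsSymplecticPotential u) {x₀ : Plane}
    (hx₀ : x₀ ∈ interior P.carrier) (hn : IsNormalizedAt u x₀) {x : Plane} (hx : x ∈ P.carrier) :
    0 ≤ u x := by
  have h := hP.le_of_tangent hu hx₀ hx
  rw [hn.1, dirD, hn.2.fderiv] at h
  simpa using h

/-- Maximality at w makes the differential at q non-positive along both edges leaving w. Points of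
the edge piece have frame coordinates no larger than those of q, so there the tangent plane at q,
and with it u, is at least u(q); the boundary integral then bounds u(q). -/
theorem value_le_of_max {C₁ C₂ : ℝ} {u : Plane → ℝ} (hu : P.IsControlled C₁ C₂ u) {q w : Plane}
    (hq : q ∈ interior P.carrier) {i j : Fin P.d} (h : P.VertexAt w i j)
    (hmax : ∀ x ∈ P.carrier, fderiv ℝ u q x ≤ fderiv ℝ u q w) {δ : ℝ} (hδ : 0 < δ)
    (hmem : ∀ t ∈ Set.Icc 0 δ, w + t • P.dual i j ∈ P.carrier) (hqδ : δ ≤ P.l i q) :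
    u q ≤ |C₂| * ‖P.nvec j‖ / (δ * ‖P.dual i j‖) := by
  obtain ⟨f, hf, hfu⟩ := hu.potential.guillemin
  obtain ⟨τ, hτ, hτm⟩ := h.symm.exists_edge
  set φ := fderiv ℝ u q with hφ
  have h1 : φ (P.dual i j) ≤ 0 := by
    have := hmax _ (hmem δ ⟨hδ.le, le_rfl⟩)
    rw [map_add, map_smul, smul_eq_mul] at this
    nlinarith
  have h2 : φ (P.dual j i) ≤ 0 := by
    have := hmax _ (hτm τ ⟨hτ.le, le_rfl⟩)
    rw [map_add, map_smul, smul_eq_mul] at this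
    nlinarith
  have hlow : ∀ t ∈ Set.Icc 0 δ, u q ≤ u (w + t • P.dual i j) := by
    intro t ht
    have h3 := hP.le_of_tangent hu.potential hq (hmem t ht)
    have h4 : 0 ≤ dirD (w + t • P.dual i j - q) u q := by
      have e : w + t • P.dual i j - q =
          (t - P.l i q) • P.dual i j + (-P.l j q) • P.dual j i := by
        conv_lhs => rw [h.eq_framePt q]
        rw [framePt, sub_smul, neg_smul]
        abel
      rw [e, dirD, map_add, map_smul, map_smul, ← hφ, smul_eq_mul, smul_eq_mul]
      have h5 := hP.mem_interior_iff.1 hq j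
      nlinarith [ht.2]
    linarith
  have hI := hP.le_boundary_integral (potential_continuousOn hf hfu) hu.nonneg h hδ.le hmem hlow
  have hI2 := hI.trans (hu.integral.le.trans (le_abs_self C₂))
  have hn : 0 < ‖P.nvec j‖ := norm_pos_iff.2 (hP.nvec_ne_zero j)
  have hd : 0 < ‖P.dual i j‖ := by
    refine norm_pos_iff.2 fun h0 => ?_
    have := h.inner_dual_left
    rw [h0, inner_zero_left] at this
    exact zero_ne_one this
  rw [le_div_iff₀ (by positivity)]
  rw [div_mul_eq_mul_div, one_mul, div_le_iff₀ hn] at hI2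
  exact hI2

/-- Controlled potentials are locally uniformly bounded away from the vertices. -/
theorem eventually_le {C₁ C₂ : ℝ} {p : Plane} (hp : p ∈ P.carrier)
    (hnv : ∀ i j, ¬ P.VertexAt p i j) :
    ∃ B, ∀ᶠ q in 𝓝 p, ∀ u, P.IsControlled C₁ C₂ u → q ∈ interior P.carrier → u q ≤ B := by
  -- The maximizing vertex depends on u and q, so one bound is prepared for each ordered pair of
  -- edges. The order is used so that the first edge function is positive at p, which fixes the
  -- length of the edge piece.
  have hpair : ∀ ij : Fin P.d × Fin P.d, ∃ B, 0 ≤ B ∧ ∀ᶠ q in 𝓝 p, ∀ w, P.VertexAt w ij.1 ij.2 →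
      ∀ u, P.IsControlled C₁ C₂ u → q ∈ interior P.carrier →
      (∀ x ∈ P.carrier, fderiv ℝ u q x ≤ fderiv ℝ u q w) → 0 < P.l ij.1 p → u q ≤ B := by
    rintro ⟨i, j⟩
    by_cases hw : ∃ w, P.VertexAt w i j ∧ 0 < P.l i p
    · obtain ⟨w, h, hpos⟩ := hw
      obtain ⟨τ, hτ, hτm⟩ := h.exists_edge
      set δ := min τ (P.l i p / 2) with hδ
      have hδ0 : 0 < δ := lt_min hτ (half_pos hpos)
      refine ⟨|C₂| * ‖P.nvec j‖ / (δ * ‖P.dual i j‖), by positivity, ?_⟩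
      have hev := (P.l_continuous i).continuousAt.eventually
        (lt_mem_nhds (show P.l i p / 2 < P.l i p by linarith))
      filter_upwards [hev] with q hq w' h' u hu hqi hmax _
      have hww : w' = w := by
        have e := h.eq_framePt w'
        rw [h'.l_left, h'.l_right, framePt] at e
        simpa using e
      subst hww
      exact hP.value_le_of_max hu hqi h hmax hδ0
        (fun t ht => hτm t ⟨ht.1, ht.2.trans (min_le_left _ _)⟩) ((min_le_right _ _).trans hq.le)
    · refine ⟨0, le_rfl, Eventually.of_forall fun q w h u hu hq hmax hpos => ?_⟩
      exact absurd ⟨w, h, hpos⟩ hw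
  choose B hB0 hB using hpair
  refine ⟨∑ ij, B ij, ?_⟩
  filter_upwards [eventually_all.2 hB] with q hq u hu hqi
  obtain ⟨w, i, j, h, hmax⟩ := hP.exists_vertex_max (fderiv ℝ u q)
  have hle : ∀ ij, B ij ≤ ∑ ij, B ij := fun ij =>
    Finset.single_le_sum (fun k _ => hB0 k) (Finset.mem_univ ij)
  -- If both edge functions of the maximizing vertex vanish at p, then p is that vertex, which is
  -- excluded.
  by_cases hi : P.l i p = 0
  · by_cases hj : P.l j p = 0
    · exfalso
      have e := h.eq_framePt p
      rw [hi, hj, framePt] at e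
      simp only [zero_smul, add_zero] at e
      exact hnv i j (e ▸ h)
    · exact (hq (j, i) w h.symm u hu hqi hmax ((hp j).lt_of_ne (Ne.symm hj))).trans (hle _)
  · exact (hq (i, j) w h u hu hqi hmax ((hp i).lt_of_ne (Ne.symm hi))).trans (hle _)

/-- Controlled potentials are uniformly bounded on compact sets without vertices. -/
theorem exists_bound_on_compact {C₁ C₂ : ℝ} {K : Set Plane} (hK : IsCompact K)
    (hKP : K ⊆ P.carrier) (hnv : ∀ p ∈ K, ∀ i j, ¬ P.VertexAt p i j) :
    ∃ B, ∀ q ∈ K, ∀ u, P.IsControlled C₁ C₂ u → q ∈ interior P.carrier → u q ≤ B := by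
  refine hK.induction_on (p := fun S => ∃ B, ∀ q ∈ S, ∀ u, P.IsControlled C₁ C₂ u →
    q ∈ interior P.carrier → u q ≤ B) ⟨0, by simp⟩ ?_ ?_ ?_
  · rintro S T hST ⟨B, hB⟩
    exact ⟨B, fun q hq => hB q (hST hq)⟩
  · rintro S T ⟨B, hB⟩ ⟨B', hB'⟩
    refine ⟨max B B', fun q hq u hu hqi => ?_⟩
    rcases hq with hq | hq
    · exact (hB q hq u hu hqi).trans (le_max_left _ _)
    · exact (hB' q hq u hu hqi).trans (le_max_right _ _)
  · intro p hp
    obtain ⟨B, hB⟩ := hP.eventually_le (C₁ := C₁) (C₂ := C₂) (hKP hp) (hnv p hp)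
    exact ⟨_, mem_nhdsWithin_of_mem_nhds hB, B, fun q hq => hq⟩

/-- A small closed ball contains no vertex, so potentials are bounded on it, and every point near
the centre has room r/4 in all directions. -/
theorem hessBoundNear_interior {C₁ C₂ : ℝ} {p : Plane} (hp : p ∈ interior P.carrier) :
    P.HessBoundNear C₁ C₂ p := by
  obtain ⟨r, hr, hball⟩ := Metric.isOpen_iff.1 isOpen_interior p hp
  have hK : IsCompact (Metric.closedBall p (r / 2)) := isCompact_closedBall _ _
  have hKi : Metric.closedBall p (r / 2) ⊆ interior P.carrier :=
    (Metric.closedBall_subset_ball (by linarith)).trans hball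
  obtain ⟨B, hB⟩ := hP.exists_bound_on_compact (C₁ := C₁) (C₂ := C₂) hK
    (hKi.trans interior_subset) fun q hq i j h =>
      (hP.mem_interior_iff.1 (hKi hq) i).ne' h.l_left
  set L := 4 / (r / 4) ^ 2 + (4 * B * (1 + 4 * |C₁| / 2) / (r / 4)) ^ 2 with hL
  have hL0 : 0 ≤ L := by positivity
  refine ⟨L, hL0, ?_⟩
  filter_upwards [Metric.ball_mem_nhds p (show 0 < r / 4 by linarith)] with q hq u hu hqi v
  have H := hP.strictConvexSmoothOn hu.potential
  have hsum : 0 ≤ ∑ k, inner ℝ v (P.nvec k) ^ 2 / P.l k q :=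
    Finset.sum_nonneg fun k _ => div_nonneg (sq_nonneg _) (interior_subset hqi k)
  by_cases hv : v = 0
  · subst hv
    have : d2 u 0 0 q = 0 := by simp [d2, dirD]
    rw [this]
    positivity
  have hvn : 0 < ‖v‖ := norm_pos_iff.2 hv
  set e := ‖v‖⁻¹ • v with he
  have hen : ‖e‖ = 1 := by rw [he, norm_smul, norm_inv, norm_norm, inv_mul_cancel₀ hvn.ne']
  have he0 : e ≠ 0 := by
    intro h0
    rw [h0, norm_zero] at hen
    exact zero_ne_one hen
  have hmem : ∀ t : ℝ, |t| ≤ r / 4 → q + t • e ∈ Metric.closedBall p (r / 2) := by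
    intro t ht
    rw [Metric.mem_closedBall, dist_eq_norm]
    calc ‖q + t • e - p‖ = ‖(q - p) + t • e‖ := by congr 1; abel
      _ ≤ ‖q - p‖ + ‖t • e‖ := norm_add_le _ _
      _ ≤ r / 4 + r / 4 := by
          gcongr
          · rw [← dist_eq_norm]
            exact (Metric.mem_ball.1 hq).le
          · rw [norm_smul, hen, mul_one]
            exact ht
      _ = r / 2 := by ring
  have hb := H.d2_le_of_room (by linarith) hu.curvature_le he0
    (fun t ht => hKi (hmem t ht)) (fun t ht => hu.nonneg _ (interior_subset (hKi (hmem t ht))))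
    (fun t ht => hB _ (hmem t ht) u hu (hKi (hmem t ht)))
  have hve : v = ‖v‖ • e + (0 : ℝ) • e := by
    rw [he, smul_smul, mul_inv_cancel₀ hvn.ne']
    simp
  rw [← hL] at hb
  have h1 : d2 u v v q = ‖v‖ ^ 2 * d2 u e e q := by
    conv_lhs => rw [hve]
    rw [d2_add_add isOpen_interior H.smooth hqi]
    ring
  rw [h1]
  calc ‖v‖ ^ 2 * d2 u e e q ≤ ‖v‖ ^ 2 * L := by gcongr
    _ ≤ L * (‖v‖ ^ 2 + ∑ k, inner ℝ v (P.nvec k) ^ 2 / P.l k q) := by nlinarith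

end IsDelzant
end PolygonData
end ToricSurface

/-! ### Corner charts for symplectic potentials. -/

namespace ToricSurface

open Filter Topology

namespace PolygonData

variable {P : PolygonData}

/-- The part of the Hessian of `f + ∑ ½ lₖ log lₖ` that stays regular near the vertex on the
edges `i`, `j`. -/
noncomputable def regularPart (P : PolygonData) (f : Plane → ℝ) (i j : Fin P.d) (a b x : Plane) : ℝ :=
  d2 f a b x + ∑ k, if k = i ∨ k = j then 0 else
    1 / 2 * (inner ℝ a (P.nvec k) * (inner ℝ b (P.nvec k) / P.l k x))

theorem sum_eq_add_add_sum_ite {n : ℕ} {i j : Fin n} (hij : i ≠ j) (F : Fin n → ℝ) :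
    ∑ k, F k = F i + F j + ∑ k, if k = i ∨ k = j then 0 else F k := by
  have : ∀ k, F k = (if k = i then F i else 0) + (if k = j then F j else 0) +
      (if k = i ∨ k = j then 0 else F k) := by
    intro k
    by_cases h1 : k = i
    · subst h1
      simp [hij]
    · by_cases h2 : k = j
      · subst h2
        simp [h1]
      · simp [h1, h2]
  rw [Finset.sum_congr rfl fun k _ => this k]
  simp [Finset.sum_add_distrib]

theorem regularPart_eq (f : Plane → ℝ) {i j : Fin P.d} (hij : i ≠ j) (a b x : Plane) :
    d2 f a b x + ∑ k, 1 / 2 * (inner ℝ a (P.nvec k) * (inner ℝ b (P.nvec k) / P.l k x)) =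
      P.regularPart f i j a b x +
      1 / 2 * (inner ℝ a (P.nvec i) * (inner ℝ b (P.nvec i) / P.l i x)) +
      1 / 2 * (inner ℝ a (P.nvec j) * (inner ℝ b (P.nvec j) / P.l j x)) := by
  rw [regularPart, sum_eq_add_add_sum_ite hij]
  ring

theorem regularPart_continuousOn {f : Plane → ℝ} (hf : ContDiff ℝ ∞ f) (i j : Fin P.d)
    (w a b a' b' : Plane) {R : Set (ℝ × ℝ)}
    (hR : ∀ z ∈ R, ∀ k, k ≠ i → k ≠ j → 0 < P.l k (framePt w a b z.1 z.2)) :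
    ContinuousOn (fun z : ℝ × ℝ => P.regularPart f i j a' b' (framePt w a b z.1 z.2)) R := by
  have hX : Continuous fun z : ℝ × ℝ => framePt w a b z.1 z.2 := by
    unfold framePt
    fun_prop
  have hd : Continuous (d2 f a' b') := by
    have := dirD_contDiffOn isOpen_univ (dirD_contDiffOn isOpen_univ hf.contDiffOn b') a'
    exact continuousOn_univ.1 this.continuousOn
  refine (hd.comp hX).continuousOn.add (continuousOn_finsetSum _ fun k _ => ?_)
  by_cases hk : k = i ∨ k = j
  · simp only [hk, if_true]
    exact continuousOn_const
  · simp only [hk, if_false]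
    push Not at hk
    refine continuousOn_const.mul (continuousOn_const.mul (continuousOn_const.div ?_ ?_))
    · exact ((P.l_continuous k).comp hX).continuousOn
    · exact fun z hz => (hR z hz k hk.1 hk.2).ne'

namespace VertexAt

variable {w : Plane} {i j : Fin P.d} (h : P.VertexAt w i j)

include h

/-- Rectangles at a vertex along a piece of the edge `i`. -/
theorem exists_rectangle {y y₂ : ℝ} (hy : y < y₂) (hy0 : 0 ≤ y)
    (hm : w + y₂ • P.dual j i ∈ P.carrier) :
    ∃ δ > 0, ∀ s ∈ Set.Icc 0 δ, ∀ t ∈ Set.Icc 0 y, ∀ k, k ≠ i → k ≠ j →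
      0 < P.l k (framePt w (P.dual i j) (P.dual j i) s t) := by
  have hy2 : 0 < y₂ := hy0.trans_lt hy
  have hedge : ∀ t ∈ Set.Icc 0 y, ∀ k, k ≠ i → k ≠ j →
      0 < P.l k (framePt w (P.dual i j) (P.dual j i) 0 t) := by
    intro t ht k hki hkj
    have h1 := h.l_pos hki hkj
    have h2 := hm k
    rw [l_add_smul] at h2
    rw [l_framePt, zero_mul, add_zero]
    have ht2 : t < y₂ := ht.2.trans_lt hy
    rcases ht.1.eq_or_lt with h0 | h0
    · rw [← h0]
      simpa using h1
    -- The product is (y₂ - t)·l_k(w) + t·l_k(w + y₂ b), with first term positive and second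
    -- non-negative.
    · have : 0 < y₂ * (P.l k w + t * inner ℝ (P.dual j i) (P.nvec k)) := by
        nlinarith [mul_nonneg h0.le h2, mul_pos (sub_pos.2 ht2) h1]
      exact (mul_pos_iff_of_pos_left hy2).1 this
  have hev : ∀ᶠ s in 𝓝 (0 : ℝ), ∀ t ∈ Set.Icc 0 y, ∀ k, k ≠ i → k ≠ j →
      0 < P.l k (framePt w (P.dual i j) (P.dual j i) s t) := by
    refine isCompact_Icc.eventually_forall_of_forall_eventually fun t ht => ?_
    refine eventually_all.2 fun k => ?_
    by_cases hk : k ≠ i ∧ k ≠ j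
    · have hc : Continuous fun z : ℝ × ℝ =>
          P.l k (framePt w (P.dual i j) (P.dual j i) z.1 z.2) := by
        refine (P.l_continuous k).comp ?_
        unfold framePt
        fun_prop
      have := hc.continuousAt (x := ((0 : ℝ), t)) |>.eventually
        (lt_mem_nhds (hedge t ht k hk.1 hk.2))
      exact this.mono fun z hz _ _ => hz
    · exact Eventually.of_forall fun z h1 h2 => absurd ⟨h1, h2⟩ hk
  obtain ⟨ε, hε, hb⟩ := Metric.eventually_nhds_iff.1 hev
  refine ⟨ε / 2, half_pos hε, fun s hs => hb ?_⟩
  rw [Real.dist_eq, sub_zero, abs_of_nonneg hs.1]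
  linarith [hs.2]

theorem framePt_mem_carrier {s t : ℝ} (hs : 0 ≤ s) (ht : 0 ≤ t)
    (hk : ∀ k, k ≠ i → k ≠ j → 0 < P.l k (framePt w (P.dual i j) (P.dual j i) s t)) :
    framePt w (P.dual i j) (P.dual j i) s t ∈ P.carrier := by
  intro k
  by_cases hi : k = i
  · subst hi
    rwa [h.l_framePt_left]
  by_cases hj : k = j
  · subst hj
    rwa [h.l_framePt_right]
  exact (hk k hi hj).le

theorem framePt_mem_interior (hP : P.IsDelzant) {s t : ℝ} (hs : 0 < s) (ht : 0 < t)
    (hk : ∀ k, k ≠ i → k ≠ j → 0 < P.l k (framePt w (P.dual i j) (P.dual j i) s t)) :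
    framePt w (P.dual i j) (P.dual j i) s t ∈ interior P.carrier := by
  rw [hP.mem_interior_iff]
  intro k
  by_cases hi : k = i
  · subst hi
    rwa [h.l_framePt_left]
  by_cases hj : k = j
  · subst hj
    rwa [h.l_framePt_right]
  exact hk k hi hj

/-- For s > 0 this is 2s times the second derivative of u along edge j, so it comes from strict
convexity on the relative interior of the edge. It supplies the positivity of a corner chart on its
axes. -/
theorem regularPart_pos {u f : Plane → ℝ} (hf : ContDiff ℝ ∞ f)
    (hfu : ∀ x ∈ P.carrier, u x = f x + ∑ i, (1 / 2) * (P.l i x * Real.log (P.l i x)))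
    (hu : P.IsSymplecticPotential u) {s : ℝ} (hs : 0 ≤ s)
    (hk : ∀ k, k ≠ i → k ≠ j → 0 < P.l k (framePt w (P.dual i j) (P.dual j i) s 0)) :
    0 < 1 + 2 * s * P.regularPart f i j (P.dual i j) (P.dual i j)
      (framePt w (P.dual i j) (P.dual j i) s 0) := by
  rcases hs.eq_or_lt with rfl | hs0
  · simp
  have hm := h.framePt_mem_carrier hs le_rfl hk
  have ht : P.IsTangent (framePt w (P.dual i j) (P.dual j i) s 0) (P.dual i j) := by
    intro k hk0
    by_cases hi : k = i
    · subst hi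
      rw [h.l_framePt_left] at hk0
      exact absurd hk0 hs0.ne'
    by_cases hj : k = j
    · subst hj
      exact h.inner_dual_right
    exact absurd hk0 (hk k hi hj).ne'
  have hne : P.dual i j ≠ 0 := by
    intro h0
    have := h.inner_dual_left
    rw [h0, inner_zero_left] at this
    exact zero_ne_one this
  have := hu.strictly_convex _ hm _ hne ht
  rw [iteratedDeriv_potential hf hfu hm ht, potD2, regularPart_eq f h.ne, h.inner_dual_left,
    h.inner_dual_right, h.l_framePt_left] at this
  have e : 1 + 2 * s * P.regularPart f i j (P.dual i j) (P.dual i j)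
      (framePt w (P.dual i j) (P.dual j i) s 0) = 2 * s * (P.regularPart f i j (P.dual i j)
      (P.dual i j) (framePt w (P.dual i j) (P.dual j i) s 0) + 1 / 2 * (1 * (1 / s)) +
      1 / 2 * (0 * (0 / P.l j (framePt w (P.dual i j) (P.dual j i) s 0)))) := by
    field_simp
    ring
  rw [e]
  positivity

omit h in
theorem regularPart_swap (f : Plane → ℝ) (a b x : Plane) :
    P.regularPart f j i a b x = P.regularPart f i j a b x := by
  simp only [regularPart, or_comm]

/-- By duality of the frame, the singular term of edge i enters only the aa entry and that of edge j
only the bb entry; all other edge functions are positive on the rectangle. The condition on the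
rectangle does not involve u, so one rectangle serves all potentials. -/
theorem cornerChart (hP : P.IsDelzant) {u f : Plane → ℝ} (hf : ContDiff ℝ ∞ f)
    (hfu : ∀ x ∈ P.carrier, u x = f x + ∑ i, (1 / 2) * (P.l i x * Real.log (P.l i x)))
    (hu : P.IsSymplecticPotential u) {δ y : ℝ} (hδ : 0 ≤ δ) (hy : 0 ≤ y)
    (hk : ∀ s ∈ Set.Icc 0 δ, ∀ t ∈ Set.Icc 0 y, ∀ k, k ≠ i → k ≠ j →
      0 < P.l k (framePt w (P.dual i j) (P.dual j i) s t)) :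
    CornerChart u (interior P.carrier) w (P.dual i j) (P.dual j i) δ y
      (fun s t => P.regularPart f i j (P.dual i j) (P.dual i j)
        (framePt w (P.dual i j) (P.dual j i) s t))
      (fun s t => P.regularPart f i j (P.dual i j) (P.dual j i)
        (framePt w (P.dual i j) (P.dual j i) s t))
      (fun s t => P.regularPart f i j (P.dual j i) (P.dual j i)
        (framePt w (P.dual i j) (P.dual j i) s t)) := by
  have hmem : ∀ s ∈ Set.Ioc 0 δ, ∀ t ∈ Set.Ioc 0 y,
      framePt w (P.dual i j) (P.dual j i) s t ∈ interior P.carrier := fun s hs t ht =>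
    h.framePt_mem_interior hP hs.1 ht.1 (hk s ⟨hs.1.le, hs.2⟩ t ⟨ht.1.le, ht.2⟩)
  refine ⟨h.det_dual, hmem, ?_, ?_, ?_, ?_, ?_, ?_, ?_, ?_⟩
  · exact regularPart_continuousOn hf i j _ _ _ _ _ fun z hz => hk z.1 hz.1 z.2 hz.2
  · exact regularPart_continuousOn hf i j _ _ _ _ _ fun z hz => hk z.1 hz.1 z.2 hz.2
  · exact regularPart_continuousOn hf i j _ _ _ _ _ fun z hz => hk z.1 hz.1 z.2 hz.2
  · intro s hs t ht
    have := hs.1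
    rw [hP.d2_potential_mixed hf hfu (hmem s hs t ht), regularPart_eq f h.ne, h.inner_dual_left,
      h.inner_dual_right, h.l_framePt_left]
    field_simp
    ring
  · intro s hs t ht
    rw [hP.d2_potential_mixed hf hfu (hmem s hs t ht), regularPart_eq f h.ne, h.inner_dual_left,
      h.inner_dual_right, h.symm.inner_dual_left, h.symm.inner_dual_right]
    ring
  · intro s hs t ht
    have := ht.1
    rw [hP.d2_potential_mixed hf hfu (hmem s hs t ht), regularPart_eq f h.ne,
      h.symm.inner_dual_left, h.symm.inner_dual_right, h.l_framePt_right]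
    field_simp
    ring
  · exact fun s hs => h.regularPart_pos hf hfu hu hs.1 (hk s hs 0 ⟨le_rfl, hy⟩)
  · intro t ht
    have := h.symm.regularPart_pos hf hfu hu ht.1 (by
      rw [framePt_swap]
      exact fun k hki hkj => hk 0 ⟨le_rfl, hδ⟩ t ht k hkj hki)
    rwa [framePt_swap, regularPart_swap] at this

end VertexAt

namespace IsDelzant

variable (hP : P.IsDelzant)

include hP

/-- Every boundary point lies on an edge that continues, seen from one of its vertices, beyond
the point. -/
theorem exists_vertex_frame {p : Plane} (hp : p ∈ P.carrier) (hpi : p ∉ interior P.carrier) :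
    ∃ w i j y y₂, P.VertexAt w i j ∧ p = framePt w (P.dual i j) (P.dual j i) 0 y ∧ 0 ≤ y ∧ y < y₂ ∧
      w + y₂ • P.dual j i ∈ P.carrier := by
  by_cases hext : p ∈ P.carrier.extremePoints ℝ
  · obtain ⟨i, j, h⟩ := hP.exists_vertexAt hext
    obtain ⟨τ, hτ, hm⟩ := h.symm.exists_edge
    exact ⟨p, i, j, 0, τ, h, by simp [framePt], le_rfl, hτ, hm τ ⟨hτ.le, le_rfl⟩⟩
  · obtain ⟨i, hi⟩ : ∃ i, P.l i p = 0 := by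
      by_contra! hne
      exact hpi (hP.mem_interior_iff.2 fun k => (hp k).lt_of_ne (hne k).symm)
    obtain ⟨w, j, h⟩ := hP.exists_vertex_on_facet i
    have hframe : ∀ x ∈ P.facet i, x = w + P.l j x • P.dual j i := by
      intro x hx
      have := h.eq_framePt x
      rwa [hx.2, framePt, zero_smul, add_zero] at this
    obtain ⟨x, hx, hlt⟩ : ∃ x ∈ P.facet i, P.l j p < P.l j x := by
      -- If `P.l j` were maximal on the facet at p, then p would be an end of the edge and thus an
      -- extreme point.
      by_contra! hle
      apply hext
      rw [mem_extremePoints]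
      refine ⟨hp, fun x₁ h₁ x₂ h₂ hseg => ?_⟩
      have hf : ∀ {a b : Plane}, a ∈ P.carrier → b ∈ P.carrier → p ∈ openSegment ℝ a b →
          a ∈ P.facet i := fun ha hb hs => (P.facet_isExtreme i).2 ha hb ⟨hp, hi⟩ hs
      have f₁ := hf h₁ h₂ hseg
      have f₂ := hf h₂ h₁ (by rwa [openSegment_symm])
      have l₁ := hle _ f₁
      have l₂ := hle _ f₂
      have hpf := hframe p ⟨hp, hi⟩
      obtain ⟨s, t, hs, ht, hst, hsum⟩ := hseg
      have hl : s * P.l j x₁ + t * P.l j x₂ = P.l j p := by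
        rw [← l_combo j x₁ x₂ hst, hsum]
      have hs1 : s = 1 - t := by linarith
      subst hs1
      have e₁ : P.l j x₁ = P.l j p := by nlinarith
      have e₂ : P.l j x₂ = P.l j p := by nlinarith
      refine ⟨?_, ?_⟩
      · rw [hframe x₁ f₁, e₁, ← hpf]
      · rw [hframe x₂ f₂, e₂, ← hpf]
    refine ⟨w, i, j, P.l j p, P.l j x, h, ?_, hp j, hlt, ?_⟩
    · have := h.eq_framePt p
      rwa [hi] at this
    · rw [← hframe x hx]
      exact hx.1

end IsDelzant
end PolygonData
end ToricSurface

/-! ### The Hessian bound at the boundary and its globalization. -/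

namespace ToricSurface

open Filter Topology

namespace PolygonData

variable {P : PolygonData}

/-- Non-negativity of the form at αa - βb bounds the mixed term, so its value at αa + βb is at most
twice the sum of the diagonal terms. -/
theorem VertexAt.d2_le_of_frame_bound {w : Plane} {i j : Fin P.d} (h : P.VertexAt w i j)
    (hP : P.IsDelzant) {u : Plane → ℝ} (hu : P.IsSymplecticPotential u) {q : Plane}
    (hq : q ∈ interior P.carrier) {K : ℝ} (hK : 0 ≤ K)
    (ha : d2 u (P.dual i j) (P.dual i j) q ≤ K / P.l i q)
    (hb : d2 u (P.dual j i) (P.dual j i) q ≤ K / P.l j q) (v : Plane) :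
    d2 u v v q ≤ 2 * K * (‖v‖ ^ 2 + ∑ k, inner ℝ v (P.nvec k) ^ 2 / P.l k q) := by
  have H := hP.strictConvexSmoothOn hu
  set a := P.dual i j
  set b := P.dual j i
  set α := inner ℝ v (P.nvec i) with hα
  set β := inner ℝ v (P.nvec j) with hβ
  have hl := hP.mem_interior_iff.1 hq
  have hv : v = α • a + β • b := h.decompose v
  have e₁ : d2 u v v q = α ^ 2 * d2 u a a q + 2 * α * β * d2 u a b q + β ^ 2 * d2 u b b q := by
    rw [hv]
    exact d2_add_add isOpen_interior H.smooth hq a b α β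
  have e₂ := d2_add_add isOpen_interior H.smooth hq a b α (-β)
  have hpos : 0 ≤ d2 u (α • a + (-β) • b) (α • a + (-β) • b) q := by
    by_cases h0 : α • a + (-β) • b = 0
    · rw [h0]
      simp [d2, dirD]
    · exact (H.d2_pos hq h0).le
  have hsum : α ^ 2 / P.l i q + β ^ 2 / P.l j q ≤ ∑ k, inner ℝ v (P.nvec k) ^ 2 / P.l k q := by
    rw [sum_eq_add_add_sum_ite h.ne]
    refine le_add_of_nonneg_right (Finset.sum_nonneg fun k _ => ?_)
    split_ifs
    · exact le_rfl
    · exact div_nonneg (sq_nonneg _) (hl k).le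
  have h₁ : α ^ 2 * d2 u a a q ≤ α ^ 2 * (K / P.l i q) := by gcongr
  have h₂ : β ^ 2 * d2 u b b q ≤ β ^ 2 * (K / P.l j q) := by gcongr
  calc d2 u v v q ≤ 2 * (α ^ 2 * (K / P.l i q) + β ^ 2 * (K / P.l j q)) := by linarith
    _ = 2 * K * (α ^ 2 / P.l i q + β ^ 2 / P.l j q) := by ring
    _ ≤ 2 * K * (‖v‖ ^ 2 + ∑ k, inner ℝ v (P.nvec k) ^ 2 / P.l k q) :=
        mul_le_mul_of_nonneg_left (hsum.trans (le_add_of_nonneg_left (sq_nonneg _))) (by positivity)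

namespace IsDelzant

variable (hP : P.IsDelzant)

include hP

/-- All constants are fixed before u: t₀ from the curvature bound, then B on a strip avoiding the
vertices, then the tangential bound L, the constant c, and last the thickness δ. -/
theorem hessBoundNear_boundary {C₁ C₂ : ℝ} {p : Plane} (hp : p ∈ P.carrier)
    (hpi : p ∉ interior P.carrier) : P.HessBoundNear C₁ C₂ p := by
  obtain ⟨w, i, j, y, y₂, h, hpw, hy, hyy, hm⟩ := hP.exists_vertex_frame hp hpi
  set C := |C₁| with hC
  have hC0 : 0 ≤ C := abs_nonneg _
  -- The chart has height y₁, beyond p. The gap up to y₃ is room for vertical segments, and y₃ < y₂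
  -- keeps the other edges away.
  set y₁ := (y + y₂) / 2 with hy₁
  set y₃ := (y₁ + y₂) / 2 with hy₃
  have hy1 : y < y₁ := by rw [hy₁]; linarith
  have hy13 : y₁ < y₃ := by rw [hy₃]; linarith
  have hy32 : y₃ < y₂ := by rw [hy₃]; linarith
  obtain ⟨δ₀, hδ₀, hrect⟩ := h.exists_rectangle hy32 (by linarith) hm
  set a := P.dual i j with ha
  set b := P.dual j i with hb
  set t₀ := 1 / (4 * C + 1) with ht₀
  have ht0 : 0 < t₀ := by positivity
  have htC : t₀ * (4 * C) ≤ 1 := by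
    rw [ht₀, div_mul_eq_mul_div, div_le_one (by positivity)]
    linarith
  -- Starting at t₀/2 leaves room below height t₀. On this strip only the edge function of i can
  -- vanish, so it contains no vertex.
  set S : Set Plane := (fun z : ℝ × ℝ => framePt w a b z.1 z.2) ''
    (Set.Icc 0 δ₀ ×ˢ Set.Icc (t₀ / 2) y₃) with hS
  have hSc : IsCompact S := by
    refine (isCompact_Icc.prod isCompact_Icc).image ?_
    unfold framePt
    fun_prop
  have hSP : S ⊆ P.carrier := by
    rintro _ ⟨⟨s, t⟩, ⟨hs, ht⟩, rfl⟩
    have ht' : 0 ≤ t := by linarith [ht.1]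
    exact h.framePt_mem_carrier hs.1 ht' (hrect s hs t ⟨ht', ht.2⟩)
  have hSv : ∀ x ∈ S, ∀ i' j', ¬ P.VertexAt x i' j' := by
    rintro _ ⟨⟨s, t⟩, ⟨hs, ht⟩, rfl⟩ i' j' h'
    have ht' : 0 < t := by linarith [ht.1]
    have hi : ∀ k, P.l k (framePt w a b s t) = 0 → k = i := by
      intro k hk
      by_contra hki
      by_cases hkj : k = j
      · subst hkj
        rw [h.l_framePt_right] at hk
        exact ht'.ne' hk
      · exact (hrect s hs t ⟨ht'.le, ht.2⟩ k hki hkj).ne' hk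
    exact h'.ne ((hi i' h'.l_left).trans (hi j' h'.l_right).symm)
  obtain ⟨B, hB⟩ := hP.exists_bound_on_compact (C₁ := C₁) (C₂ := C₂) hSc hSP hSv
  set r := min (t₀ / 2) (y₃ - y₁) with hr
  have hr0 : 0 < r := lt_min (by linarith) (by linarith)
  set L := 4 / r ^ 2 + (4 * B * (1 + 4 * C / 2) / r) ^ 2 with hL
  have hL0 : 0 ≤ L := by positivity
  have hy10 : 0 < y₁ := by linarith
  set c := 1 / (L * y₁ + 1) with hc
  have hc0 : 0 < c := by positivity
  have hc1 : c ≤ 1 := by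
    rw [hc, div_le_one (by positivity)]
    nlinarith [mul_nonneg hL0 hy10.le]
  have hcL : c * L * y₁ ≤ 1 := by
    rw [hc, mul_assoc, div_mul_eq_mul_div, div_le_one (by positivity)]
    linarith
  set δ := min δ₀ (min t₀ (c / (16 * (8 * C) ^ 2 * y₁ + 1))) with hδ
  have hδ0 : 0 < δ := lt_min hδ₀ (lt_min ht0 (by positivity))
  have hδδ : δ ≤ δ₀ := min_le_left _ _
  have hδC : δ * (4 * C) ≤ 1 :=
    (mul_le_mul_of_nonneg_right ((min_le_right _ _).trans (min_le_left _ _))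
      (by positivity)).trans htC
  have hδc : 16 * (8 * C) ^ 2 * δ * y₁ ≤ c := by
    have h1 : δ ≤ c / (16 * (8 * C) ^ 2 * y₁ + 1) :=
      (min_le_right _ _).trans (min_le_right _ _)
    rw [le_div_iff₀ (by positivity)] at h1
    nlinarith
  refine ⟨2 * (2 / c), by positivity, ?_⟩
  have hi0 : P.l i p = 0 := by rw [hpw, h.l_framePt_left]
  have hjy : P.l j p = y := by rw [hpw, h.l_framePt_right]
  have ev₁ := (P.l_continuous i).continuousAt.eventually
    (gt_mem_nhds (show P.l i p < δ by rwa [hi0]))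
  have ev₂ := (P.l_continuous j).continuousAt.eventually
    (gt_mem_nhds (show P.l j p < y₁ by rwa [hjy]))
  filter_upwards [ev₁, ev₂] with q hq₁ hq₂ u hu hqi v
  obtain ⟨f, hf, hfu⟩ := hu.potential.guillemin
  have H := hP.strictConvexSmoothOn hu.potential
  have hl := hP.mem_interior_iff.1 hqi
  have chart := h.cornerChart hP hf hfu hu.potential hδ0.le hy10.le fun s hs t ht =>
    hrect s ⟨hs.1, hs.2.trans hδδ⟩ t ⟨ht.1, ht.2.trans hy13.le⟩
  have hroom : ∀ s ∈ Set.Ioc 0 δ, ∀ t ∈ Set.Icc t₀ y₁, d2 u b b (framePt w a b s t) ≤ L := by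
    intro s hs t ht
    have hs' : s ∈ Set.Icc 0 δ₀ := ⟨hs.1.le, hs.2.trans hδδ⟩
    have hline : ∀ τ : ℝ, framePt w a b s t + τ • b = framePt w a b s (t + τ) := by
      intro τ
      rw [framePt, framePt, add_smul, add_assoc]
    have hτ : ∀ τ : ℝ, |τ| ≤ r → t + τ ∈ Set.Icc (t₀ / 2) y₃ := by
      intro τ hτ
      have h1 := abs_le.1 hτ
      have h2 : r ≤ t₀ / 2 := min_le_left _ _
      have h3 : r ≤ y₃ - y₁ := min_le_right _ _
      constructor <;> linarith [ht.1, ht.2, h1.1, h1.2]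
    have hin : ∀ τ : ℝ, |τ| ≤ r → framePt w a b s t + τ • b ∈ interior P.carrier := by
      intro τ h1
      have h2 := hτ τ h1
      have h3 : 0 < t + τ := by linarith [h2.1]
      rw [hline]
      exact h.framePt_mem_interior hP hs.1 h3 (hrect s hs' _ ⟨h3.le, h2.2⟩)
    exact H.d2_le_of_room hr0 hu.curvature_le chart.ne_zero.2 hin
      (fun τ h1 => hu.nonneg _ (interior_subset (hin τ h1)))
      (fun τ h1 => hB _ (by
        rw [hline]
        exact ⟨(s, t + τ), ⟨hs', hτ τ h1⟩, rfl⟩) u hu (hin τ h1))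
  have key := chart.d2_le H hu.curvature_le hδC htC hc0 hc1 hcL hδc hroom
    ⟨hl i, hq₁.le⟩ ⟨hl j, hq₂.le⟩
  rw [← h.eq_framePt q] at key
  refine h.d2_le_of_frame_bound hP hu.potential hqi (by positivity) ?_ ?_ v
  · refine key.1.trans ?_
    have : 2 ≤ 2 / c := by
      rw [le_div_iff₀ hc0]
      linarith
    exact div_le_div_of_nonneg_right this (hl i).le
  · rw [div_div]
    exact key.2

/-- The global upper bound for the Hessian of controlled potentials. -/
theorem exists_hess_bound (C₁ C₂ : ℝ) :
    ∃ K : ℝ, 0 ≤ K ∧ ∀ q ∈ interior P.carrier, ∀ u, P.IsControlled C₁ C₂ u → ∀ v : Plane,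
      d2 u v v q ≤ K * (‖v‖ ^ 2 + ∑ k, inner ℝ v (P.nvec k) ^ 2 / P.l k q) := by
  suffices hs : ∃ K : ℝ, 0 ≤ K ∧ ∀ q ∈ P.carrier, q ∈ interior P.carrier →
      ∀ u, P.IsControlled C₁ C₂ u → ∀ v : Plane,
      d2 u v v q ≤ K * (‖v‖ ^ 2 + ∑ k, inner ℝ v (P.nvec k) ^ 2 / P.l k q) by
    obtain ⟨K, hK, hb⟩ := hs
    exact ⟨K, hK, fun q hq => hb q (interior_subset hq) hq⟩
  refine hP.isCompact.induction_on (p := fun S => ∃ K : ℝ, 0 ≤ K ∧ ∀ q ∈ S,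
    q ∈ interior P.carrier → ∀ u, P.IsControlled C₁ C₂ u → ∀ v : Plane,
      d2 u v v q ≤ K * (‖v‖ ^ 2 + ∑ k, inner ℝ v (P.nvec k) ^ 2 / P.l k q))
    ⟨0, le_rfl, by simp⟩ ?_ ?_ ?_
  · rintro S T hST ⟨K, hK, hb⟩
    exact ⟨K, hK, fun q hq => hb q (hST hq)⟩
  · rintro S T ⟨K, hK, hb⟩ ⟨K', hK', hb'⟩
    have hle : ∀ q ∈ interior P.carrier, ∀ v : Plane,
        0 ≤ ‖v‖ ^ 2 + ∑ k, inner ℝ v (P.nvec k) ^ 2 / P.l k q := fun q hq v =>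
      add_nonneg (sq_nonneg _) (Finset.sum_nonneg fun k _ =>
        div_nonneg (sq_nonneg _) (interior_subset hq k))
    refine ⟨max K K', hK.trans (le_max_left _ _), fun q hq hqi u hu v => ?_⟩
    rcases hq with hq | hq
    · exact (hb q hq hqi u hu v).trans
        (mul_le_mul_of_nonneg_right (le_max_left _ _) (hle q hqi v))
    · exact (hb' q hq hqi u hu v).trans
        (mul_le_mul_of_nonneg_right (le_max_right _ _) (hle q hqi v))
  · intro p hp
    have hnear : P.HessBoundNear C₁ C₂ p := by
      by_cases hpi : p ∈ interior P.carrier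
      · exact hP.hessBoundNear_interior hpi
      · exact hP.hessBoundNear_boundary hp hpi
    obtain ⟨K, hK, hb⟩ := hnear
    exact ⟨_, mem_nhdsWithin_of_mem_nhds hb, K, hK, fun q hq hqi u hu v => hq u hu hqi v⟩

end IsDelzant
end PolygonData
end ToricSurface

/-! ### From the Hessian bound to the M-condition. -/

namespace ToricSurface

open Filter Topology

namespace PolygonData

variable {P : PolygonData}

theorem potD_smul (f : Plane → ℝ) (r : ℝ) (v x : Plane) :
    P.potD f (r • v) x = r * P.potD f v x := by
  simp only [potD, dirD, map_smul, smul_eq_mul, real_inner_smul_left, mul_add, Finset.mul_sum]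
  congr 1
  exact Finset.sum_congr rfl fun k _ => by ring

/-- Continuity holds from all directions, not only along the face, since the logarithms of active
edges have coefficient zero. This allows derivatives on an edge to be approximated from the
interior. -/
theorem potD_continuousAt {f : Plane → ℝ} (hf : ContDiff ℝ ∞ f) {x v : Plane}
    (hv : P.IsTangent x v) : ContinuousAt (P.potD f v) x := by
  have hd : Continuous (dirD v f) :=
    continuousOn_univ.1 (dirD_contDiffOn isOpen_univ hf.contDiffOn v).continuousOn
  refine hd.continuousAt.add (tendsto_finsetSum _ fun k _ => ?_)
  by_cases hk : P.l k x = 0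
  · simp only [hv k hk, zero_mul, mul_zero]
    exact tendsto_const_nhds
  · exact tendsto_const_nhds.mul (tendsto_const_nhds.mul
      (((P.l_continuous k).continuousAt.log hk).add tendsto_const_nhds))

/-- An edge function that is non-negative at both ends and zero at an inner point of a segment is
zero on the whole segment. -/
theorem isTangent_of_segment {p q : Plane} (hp : p ∈ P.carrier) (hq : q ∈ P.carrier) {t : ℝ}
    (ht0 : 0 < t) (ht1 : t < 1) (r : ℝ) : P.IsTangent (p + t • (q - p)) (r • (q - p)) := by
  intro k hk
  have h1 := P.l_sub_l k q p
  rw [l_add_smul, ← h1] at hk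
  rw [real_inner_smul_left, ← h1]
  have h2 := hp k
  have h3 := hq k
  have h4 : P.l k p = 0 := by nlinarith [mul_nonneg ht0.le h3]
  have h5 : P.l k q = 0 := by nlinarith
  rw [h4, h5, sub_zero, mul_zero]

namespace IsDelzant

variable (hP : P.IsDelzant)

include hP

/-- The variation of the derivative along the middle third of an interior segment, when the
Hessian has Guillemin-type upper bounds. -/
theorem abs_dirD_sub_le {u : Plane → ℝ} (hu : P.IsSymplecticPotential u) {K R : ℝ} (hK : 0 ≤ K)
    (hb : ∀ q ∈ interior P.carrier, ∀ v : Plane,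
      d2 u v v q ≤ K * (‖v‖ ^ 2 + ∑ k, inner ℝ v (P.nvec k) ^ 2 / P.l k q))
    {p q : Plane} (hp : p ∈ interior P.carrier) (hq : q ∈ interior P.carrier)
    (hR : ‖q - p‖ ≤ R) :
    |dirD (q - p) u (p + (1 / 3 : ℝ) • (q - p)) - dirD (q - p) u (p + (2 / 3 : ℝ) • (q - p))| ≤
      K * (R + ∑ k, 3 * ‖P.nvec k‖) * ‖q - p‖ := by
  have H := hP.strictConvexSmoothOn hu
  set e := q - p with he
  have hl : ∀ k (t : ℝ), P.l k (p + t • e) = (1 - t) * P.l k p + t * P.l k q := by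
    intro k t
    rw [l_add_smul, he, ← P.l_sub_l k q p]
    ring
  have hlp := hP.mem_interior_iff.1 hp
  have hlq := hP.mem_interior_iff.1 hq
  have hmem : ∀ t ∈ Set.Icc (1 / 3 : ℝ) (2 / 3), p + t • e ∈ interior P.carrier := by
    intro t ht
    rw [hP.mem_interior_iff]
    intro k
    rw [hl]
    have h1 := hlp k
    have h2 := hlq k
    have h3 : 0 < t := by linarith [ht.1]
    have h4 : 0 < 1 - t := by linarith [ht.2]
    positivity
  set b := K * (R + ∑ k, 3 * ‖P.nvec k‖) * ‖e‖ with hbdef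
  have hd : ∀ t ∈ Set.Icc (1 / 3 : ℝ) (2 / 3),
      HasDerivWithinAt (fun t : ℝ => dirD e u (p + t • e)) (d2 u e e (p + t • e))
        (Set.Icc (1 / 3 : ℝ) (2 / 3)) t := fun t ht =>
    (hasDerivAt_line (differentiableAt_of_smooth isOpen_interior
      (dirD_contDiffOn isOpen_interior H.smooth e) (hmem t ht))).hasDerivWithinAt
  have hbound : ∀ t ∈ Set.Icc (1 / 3 : ℝ) (2 / 3), ‖d2 u e e (p + t • e)‖ ≤ b := by
    intro t ht
    have hnn : 0 ≤ d2 u e e (p + t • e) := by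
      by_cases h0 : e = 0
      · rw [h0]
        simp [d2, dirD]
      · exact (H.d2_pos (hmem t ht) h0).le
    rw [Real.norm_of_nonneg hnn]
    refine (hb _ (hmem t ht) e).trans ?_
    have hterm : ∀ k, inner ℝ e (P.nvec k) ^ 2 / P.l k (p + t • e) ≤ 3 * ‖P.nvec k‖ * ‖e‖ := by
      intro k
      have hpos := hP.mem_interior_iff.1 (hmem t ht) k
      have h1 := hlp k
      have h2 := hlq k
      -- The inner product is the difference of the values of l_k at the two ends, each of which is
      -- at most 3 l_k at a point of the middle third. One of the two factors ⟨e,n_k⟩ then absorbs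
      -- the denominator and the other provides |e|.
      have h3 : |inner ℝ e (P.nvec k)| ≤ 3 * P.l k (p + t • e) := by
        rw [hl, he, ← P.l_sub_l k q p, abs_le]
        constructor <;> nlinarith [ht.1, ht.2]
      have h4 := abs_real_inner_le_norm e (P.nvec k)
      rw [div_le_iff₀ hpos, ← sq_abs]
      calc |inner ℝ e (P.nvec k)| ^ 2
          ≤ (‖e‖ * ‖P.nvec k‖) * (3 * P.l k (p + t • e)) := by
            rw [sq]
            gcongr
        _ = 3 * ‖P.nvec k‖ * ‖e‖ * P.l k (p + t • e) := by ring
    calc K * (‖e‖ ^ 2 + ∑ k, inner ℝ e (P.nvec k) ^ 2 / P.l k (p + t • e))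
        ≤ K * (R * ‖e‖ + ∑ k, 3 * ‖P.nvec k‖ * ‖e‖) := by
          refine mul_le_mul_of_nonneg_left (add_le_add ?_ ?_) hK
          · rw [sq]
            exact mul_le_mul_of_nonneg_right hR (norm_nonneg _)
          · exact Finset.sum_le_sum fun k _ => hterm k
      _ = b := by
          rw [hbdef, ← Finset.sum_mul]
          ring
  have := (convex_Icc (1 / 3 : ℝ) (2 / 3)).norm_image_sub_le_of_norm_hasDerivWithin_le hd hbound
    (x := 2 / 3) (y := 1 / 3) (by norm_num) (by norm_num)
  rw [Real.norm_eq_abs, Real.norm_eq_abs] at this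
  refine this.trans ?_
  have hb0 : 0 ≤ b := (norm_nonneg _).trans (hbound (1 / 3) (by norm_num))
  have : |(1 / 3 - 2 / 3 : ℝ)| ≤ 1 := by norm_num [abs_le]
  exact mul_le_of_le_one_right hb0 this

/-- Controlled potentials satisfy the `M`-condition uniformly. -/
theorem exists_mCondition (C₁ C₂ : ℝ) :
    ∃ M : ℝ, 0 < M ∧ ∀ u, P.IsControlled C₁ C₂ u → P.MCondition M u := by
  obtain ⟨K, hK, hb⟩ := hP.exists_hess_bound C₁ C₂
  obtain ⟨c, hc⟩ := hP.interior_nonempty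
  set R := Metric.diam P.carrier with hR
  set M := K * (R + ∑ k, 3 * ‖P.nvec k‖) with hM
  have hM0 : 0 ≤ M := mul_nonneg hK (add_nonneg Metric.diam_nonneg
    (Finset.sum_nonneg fun k _ => by positivity))
  -- The added 1 provides both the strict inequality and a positive constant.
  refine ⟨M + 1, by positivity, fun u hu p q hpq hseg => ?_⟩
  obtain ⟨f, hf, hfu⟩ := hu.potential.guillemin
  have hp : p ∈ P.carrier := hseg (left_mem_segment ℝ p q)
  have hq : q ∈ P.carrier := hseg (right_mem_segment ℝ p q)
  have hen : 0 < ‖q - p‖ := norm_pos_iff.2 (sub_ne_zero.2 hpq.symm)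
  have hpt : ∀ t ∈ Set.Ioo (0 : ℝ) 1, p + t • (q - p) ∈ P.carrier := by
    intro t ht
    refine hseg ?_
    rw [segment_eq_image']
    exact ⟨t, ⟨ht.1.le, ht.2.le⟩, rfl⟩
  have hline : ∀ t ∈ Set.Ioo (0 : ℝ) 1,
      lineDeriv ℝ u (p + t • (q - p)) (‖q - p‖⁻¹ • (q - p)) =
        ‖q - p‖⁻¹ * P.potD f (q - p) (p + t • (q - p)) := by
    intro t ht
    rw [lineDeriv, (hasDerivAt_potential hf hfu (hpt t ht)
      (isTangent_of_segment hp hq ht.1 ht.2 _)).deriv, potD_smul]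
  have hlim : ∀ t ∈ Set.Ioo (0 : ℝ) 1, Tendsto
      (fun ε : ℝ => P.potD f (q - p) ((1 - ε) • (p + t • (q - p)) + ε • c)) (𝓝[>] 0)
      (𝓝 (P.potD f (q - p) (p + t • (q - p)))) := by
    intro t ht
    have htan := isTangent_of_segment hp hq ht.1 ht.2 1
    rw [one_smul] at htan
    refine (potD_continuousAt hf htan).tendsto.comp (tendsto_nhdsWithin_of_tendsto_nhds ?_)
    have hcont : Continuous fun ε : ℝ => (1 - ε) • (p + t • (q - p)) + ε • c := by fun_prop
    exact hcont.tendsto' 0 _ (by simp)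
  -- Contracting the segment towards the interior point c moves it into the interior and only
  -- rescales its direction.
  have hshift : ∀ ε ∈ Set.Ioo (0 : ℝ) 1, ∀ x ∈ P.carrier,
      (1 - ε) • x + ε • c ∈ interior P.carrier := by
    intro ε hε x hx
    rw [hP.mem_interior_iff]
    intro k
    rw [l_combo k x c (by ring)]
    have h1 := hx k
    have h2 := hP.mem_interior_iff.1 hc k
    have h3 : 0 < 1 - ε := by linarith [hε.2]
    have h4 := hε.1
    positivity
  have hev : ∀ᶠ ε in 𝓝[>] (0 : ℝ),
      |P.potD f (q - p) ((1 - ε) • (p + (1 / 3 : ℝ) • (q - p)) + ε • c) -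
        P.potD f (q - p) ((1 - ε) • (p + (2 / 3 : ℝ) • (q - p)) + ε • c)| ≤ M * ‖q - p‖ := by
    filter_upwards [Ioo_mem_nhdsGT (zero_lt_one (α := ℝ))] with ε hε
    have h3 : 0 < 1 - ε := by linarith [hε.2]
    have hp' := hshift ε hε p hp
    have hq' := hshift ε hε q hq
    have he : (1 - ε) • q + ε • c - ((1 - ε) • p + ε • c) = (1 - ε) • (q - p) := by
      rw [smul_sub]
      abel
    have hpts : ∀ t : ℝ, (1 - ε) • p + ε • c + t • (1 - ε) • (q - p) =
        (1 - ε) • (p + t • (q - p)) + ε • c := by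
      intro t
      rw [smul_comm t, smul_add]
      abel
    have h := hP.abs_dirD_sub_le hu.potential hK (fun x hx => hb x hx u hu) hp' hq'
      (R := R) (by
        rw [← dist_eq_norm]
        exact Metric.dist_le_diam_of_mem hP.bounded (interior_subset hq') (interior_subset hp'))
    -- The contraction factor 1 - ε appears on both sides and cancels, so the bound is uniform in ε.
    rw [he, hpts, hpts, hP.dirD_potential hf hfu (hshift ε hε _ (hpt _ (by norm_num))),
      hP.dirD_potential hf hfu (hshift ε hε _ (hpt _ (by norm_num))), potD_smul, potD_smul,
      ← mul_sub, abs_mul, abs_of_pos h3, norm_smul, Real.norm_of_nonneg h3.le, ← hM,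
      mul_left_comm] at h
    exact le_of_mul_le_mul_left h h3
  have hfin := le_of_tendsto (((hlim (1 / 3) (by norm_num)).sub (hlim (2 / 3) (by norm_num))).abs)
    hev
  rw [hline _ (by norm_num), hline _ (by norm_num), ← mul_sub, abs_mul,
    abs_of_pos (inv_pos.2 hen)]
  calc _ ≤ ‖q - p‖⁻¹ * (M * ‖q - p‖) := by gcongr
    _ = M := by field_simp
    _ < M + 1 := lt_add_one M

end IsDelzant
end PolygonData
end ToricSurface

theorem theorem1p6 (P : ToricSurface.PolygonData) (hP : P.IsDelzant) (C₁ C₂ : ℝ) :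
    ∃ M : ℝ, 0 < M ∧
      ∀ x₀ ∈ interior P.carrier, ∀ u : ToricSurface.Plane → ℝ,
        P.IsSymplecticPotential u →
        ToricSurface.IsNormalizedAt u x₀ →
        ToricSurface.CurvatureBoundedBy P u C₁ →
        ∫ x, u x ∂P.boundaryMeasure < C₂ →
        P.MCondition M u := by
  obtain ⟨M, hM, h⟩ := hP.exists_mCondition C₁ C₂
  exact ⟨M, hM, fun x₀ hx₀ u hu hn hC hI =>
    h u ⟨hu, fun x hx => hP.nonneg_of_normalized hu hx₀ hn hx, hC, hI⟩⟩
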